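/- Let $n\ge 2$ and let $\phi:M^n\to\mathbb R^{n+1}$ be a smooth immersion with affine normal field $\xi$: writing $D$ for the standard connection of $\mathbb R^{n+1}$ and $D_X(\phi_*Y)=\phi_*(\nabla_XY)+h(X,Y)\,\xi$, the field $\xi$ is smooth and transversal, $D_X\xi$ is tangent to $\phi$ for all $X$, and $\det(\phi_*e_1,\dots,\phi_*e_n,\xi)^2=|\det(h(e_i,e_j))|$ for all tangent vectors $e_1,\dots,e_n$ at a point. Assume that $\phi$ is a positive definite hyperbolic affine hypersphere with mean curvature $\lambda<0$, i.e. the affine metric $h$ is positive definite and $D_X\xi=-\lambda\,\phi_*X$. Let $\widehat\nabla$ be the Levi-Civita connection of $h$ and $K(X,Y)=\nabla_XY-\widehat\nabla_XY$ the difference tensor. Suppose there are distributions $\mathcal D_1,\mathcal D_2$ on $M$ with $T_pM=\mathcal D_1(p)\oplus\mathcal D_2(p)$ for all $p$, orthogonal with respect to $h$, such that $\mathcal D_1$ is spanned by a smooth vector field $T$ with $h(T,T)=1$, and suppose there are $\lambda_1,\lambda_2$ (numbers, or more generally real functions on $M$) with $-\lambda+\lambda_1\lambda_2-\lambda_2^2=0$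 and $$K(T,T)=\lambda_1T,\qquad K(T,U)=\lambda_2U\quad\text{for all }U\in\mathcal D_2 .$$ Then $\phi$ is locally the Calabi product of an $(n-1)$-dimensional hyperbolic affine hypersphere and a point. That is, every $p\in M$ has an open neighbourhood that is the diffeomorphic image, under some map $\Phi$, of a product $(a,b)\times M_1$ with $M_1\subseteq\mathbb R^{n-1}$ open, and there are a positive definite hyperbolic affine hypersphere $\psi:M_1\to\mathbb R^n$ with mean curvature $-1$ and centre at the origin (its affine normal is $\psi$ itself), constants $c_1,c_2>0$, and an equiaffine transformation $A$ of $\mathbb R^{n+1}$ (an affine map whose linear part has determinant $1$), such that $$\phi(\Phi(t,q))=A\bigl(c_1e^{t/\sqrt n}\,\psi(q),\;c_2e^{-\sqrt n\,t}\bigr)\qquad\text{for all }t\in(a,b),\ q\in M_1 .$$ -/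

import Mathlib

open scoped Manifold ContDiff Topology
open TopologicalSpace (Opens)

noncomputable section

namespace AffineGeometry

/-- The model of `n`-dimensional manifolds. -/
abbrev Model (n : ℕ) : Type := EuclideanSpace ℝ (Fin n)

/-- The affine space `ℝ^N`; its norm plays no role. -/
abbrev Aff (N : ℕ) : Type := Fin N → ℝ

/-- The tangent space of an `n`-dimensional manifold. -/
abbrev Tan (n : ℕ) {M : Type*} [TopologicalSpace M] [ChartedSpace (Model n) M]
    (x : M) : Type := TangentSpace 𝓘(ℝ, Model n) x

section Immersion

variable {n : ℕ} {M : Type*} [TopologicalSpace M] [ChartedSpace (Model n) M]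
  [IsManifold 𝓘(ℝ, Model n) ∞ M]

/-- The section `X` of `TM` is differentiable at `x`. -/
def DiffFieldAt (X : Π x : M, Tan n x) (x : M) : Prop :=
  MDifferentiableAt 𝓘(ℝ, Model n) 𝓘(ℝ, Model n).tangent
    (fun y ↦ (⟨y, X y⟩ : TangentBundle 𝓘(ℝ, Model n) M)) x

/-- The section `X` of `TM` is smooth. -/
def SmoothField (X : Π x : M, Tan n x) : Prop :=
  ContMDiff 𝓘(ℝ, Model n) 𝓘(ℝ, Model n).tangent ∞
    (fun y ↦ (⟨y, X y⟩ : TangentBundle 𝓘(ℝ, Model n) M))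

/-- The differential at `x` of a map from `M` to a vector space. -/
def diff {F : Type*} [NormedAddCommGroup F] [NormedSpace ℝ F] (f : M → F) (x : M) :
    Tan n x →L[ℝ] F :=
  mvfderiv 𝓘(ℝ, Model n) f x

/-- Some vector field, smooth near `x`, with value `v` at `x` (constant in the preferred chart
at `x`). -/
def extendField {x : M} (v : Tan n x) : Π y : M, Tan n y :=
  FiberBundle.extend (Model n) v

variable (φ ξ : M → Aff (n + 1))

/-- The map `T_xM × ℝ → ℝ^{n+1}`, `(u, c) ↦ φ_* u + c ξ`. -/
def frameMap (x : M) : (Tan n x × ℝ) →L[ℝ] Aff (n + 1) :=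
  (diff φ x).coprod (ContinuousLinearMap.toSpanSingleton ℝ (ξ x))

/-- The decomposition `D_u (φ_* Y) = φ_* (∇_u Y) + h(u, Y) ξ` at `x`, as the pair
`(∇_u Y, h(u, Y))`, where `D` is the standard connection of `ℝ^{n+1}`. -/
def gaussSplit (Y : Π y : M, Tan n y) (x : M) (u : Tan n x) :
    Tan n x × ℝ :=
  (frameMap φ ξ x).inverse (diff (fun y ↦ diff φ y (Y y)) x u)

/-- The induced connection `∇_u Y` at `x`. -/
def inducedConnection (Y : Π y : M, Tan n y) (x : M) (u : Tan n x) :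
    Tan n x :=
  (gaussSplit φ ξ Y x u).1

/-- The affine fundamental form `h(u, v)` at `x` (the affine metric, when `ξ` is the affine
normal). -/
def affineMetric (x : M) (u v : Tan n x) : ℝ :=
  (gaussSplit φ ξ (extendField v) x u).2

/-- Twice the value `g(∇̂_X Y, Z)` at `x`, by the Koszul formula. -/
def koszul (g : Π x : M, Tan n x → Tan n x → ℝ)
    (X Y Z : Π x : M, Tan n x) (x : M) : ℝ :=
  diff (fun y ↦ g y (Y y) (Z y)) x (X x)
    + diff (fun y ↦ g y (X y) (Z y)) x (Y x)
    - diff (fun y ↦ g y (X y) (Y y)) x (Z x)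
    + g x (VectorField.mlieBracket 𝓘(ℝ, Model n) X Y x) (Z x)
    - g x (VectorField.mlieBracket 𝓘(ℝ, Model n) X Z x) (Y x)
    - g x (VectorField.mlieBracket 𝓘(ℝ, Model n) Y Z x) (X x)

/-- The Levi-Civita connection of a metric `g`: the value at `x` of `∇̂_X Y`, that is, the unique
vector `w` at `x` that satisfies the Koszul formula. -/
def leviCivita (g : Π x : M, Tan n x → Tan n x → ℝ)
    (X Y : Π x : M, Tan n x) (x : M) : Tan n x :=
  Classical.epsilon fun w : Tan n x ↦
    ∀ Z : Π y : M, Tan n y, DiffFieldAt Z x → 2 * g x w (Z x) = koszul g X Y Z x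

/-- The difference tensor `K(u, v) = ∇_u v - ∇̂_u v` at `x`. -/
def differenceTensor (x : M) (u v : Tan n x) : Tan n x :=
  inducedConnection φ ξ (extendField v) x u
    - leviCivita (affineMetric φ ξ) (extendField u) (extendField v) x

/-- `φ` is a smooth immersed hypersurface of `ℝ^{n+1}` with affine normal `ξ`: `ξ` is a smooth
transversal field, equiaffine (`D_u ξ` is tangent to `φ`), and the induced volume
`|det(φ_* e_1, …, φ_* e_n, ξ)|` is the volume of the affine metric `h`. The last condition forces
`h` to be nondegenerate, and it determines `ξ` up to sign. -/
structure IsAffineNormal : Prop where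
  smooth_map : ContMDiff 𝓘(ℝ, Model n) 𝓘(ℝ, Aff (n + 1)) ∞ φ
  immersion : ∀ x : M, Function.Injective (diff (n := n) φ x)
  smooth_normal : ContMDiff 𝓘(ℝ, Model n) 𝓘(ℝ, Aff (n + 1)) ∞ ξ
  transversal : ∀ x : M, ∀ u : Tan n x, diff φ x u ≠ ξ x
  equiaffine : ∀ x : M, ∀ u : Tan n x, ∃ w : Tan n x, diff ξ x u = diff φ x w
  volume_eq : ∀ x : M, ∀ e : Fin n → Tan n x,
    (Matrix.of (Fin.snoc (α := fun _ ↦ Aff (n + 1)) (fun i ↦ diff φ x (e i)) (ξ x))).det ^ 2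
      = |(Matrix.of fun i j ↦ affineMetric φ ξ x (e i) (e j)).det|

/-- `φ` is an affine hypersphere with affine normal `ξ`, positive definite affine metric and
mean curvature `lam`: the shape operator, given by `D_u ξ = - φ_* (S u)`, is `S = lam • id`.
For `lam < 0` this is a positive definite hyperbolic affine hypersphere. -/
structure IsAffineHypersphere (lam : ℝ) : Prop extends IsAffineNormal φ ξ where
  posDef : ∀ x : M, ∀ u : Tan n x, u ≠ 0 → 0 < affineMetric φ ξ x u u
  shape : ∀ x : M, ∀ u : Tan n x, diff ξ x u = - diff φ x (lam • u)

end Immersion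

/-- The Calabi product of `ψ : M₁ → ℝ^n` and a point, with constants `c₁` and `c₂`:
`(t, q) ↦ (c₁ e^{t/√n} ψ(q), c₂ e^{-√n t}) ∈ ℝ^n × ℝ = ℝ^{n+1}`. -/
def calabiProductPoint {n : ℕ} {M₁ : Type*} (c₁ c₂ : ℝ) (ψ : M₁ → Aff n) (t : ℝ) (q : M₁) :
    Aff (n + 1) :=
  Fin.snoc (α := fun _ ↦ ℝ) ((c₁ * Real.exp (t / √n)) • ψ q) (c₂ * Real.exp (-√n * t))

/-- Near every point of `M`, `φ : M → ℝ^{m+2}` is, up to an equiaffine transformation of `ℝ^{m+2}`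
and in suitable coordinates `(t, q) ∈ (a, b) × M₁`, a Calabi product of an `m`-dimensional
hyperbolic affine hypersphere `ψ : M₁ → ℝ^{m+1}` with mean curvature `-1`, centred at the origin
(its affine normal is `ψ` itself), and a point. -/
def IsLocallyCalabiProductPoint {m : ℕ} {M : Type*} [TopologicalSpace M]
    [ChartedSpace (Model (m + 1)) M] [IsManifold 𝓘(ℝ, Model (m + 1)) ∞ M]
    (φ : M → Aff (m + 2)) : Prop :=
  ∀ p : M, ∃ (a b : ℝ) (M₁ : Opens (Model m)) (ψ : M₁ → Aff (m + 1)) (c₁ c₂ : ℝ)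
    (A : Aff (m + 2) ≃ᵃ[ℝ] Aff (m + 2))
    (Φ : PartialDiffeomorph (𝓘(ℝ, ℝ).prod 𝓘(ℝ, Model m)) 𝓘(ℝ, Model (m + 1)) (ℝ × M₁) M ∞),
    IsAffineHypersphere ψ ψ (-1) ∧ 0 < c₁ ∧ 0 < c₂ ∧
    LinearMap.det (A.linear : Aff (m + 2) →ₗ[ℝ] Aff (m + 2)) = 1 ∧
    Φ.source = Set.Ioo a b ×ˢ Set.univ ∧ p ∈ Φ.target ∧
    ∀ t ∈ Set.Ioo a b, ∀ q : M₁, φ (Φ (t, q)) = A (calabiProductPoint c₁ c₂ ψ t q)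

end AffineGeometry

end

noncomputable section

namespace AffineGeometry

/-! Since `D ξ = -λ φ_*`, the position vector `f = ξ / (-λ)` from the centre differs from `φ` by a
locally constant vector. With the conormal field `ℓ` (zero on tangent vectors, `ℓ(ξ) = 1`) all the
geometry becomes calculus for the pair `(f, ℓ)` in a chart. The metric is `h(a, c) = ℓ(D²f(a, c)) =
-(D_a ℓ)(D_c f)`, the Levi-Civita connection is the mean of the connections induced by `f` and by
`ℓ`, and `h(K(a, c), e) = -C(a, c, e) / 2` for a totally symmetric cubic form `C`
(`IsCentroaffine.koszul_eq`, `affineMetric_differenceTensor`).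

Put `b = λ₂`, `μ = λ₁ - λ₂`, `θ = h(T, ·)`. The hypothesis on `K` says `C(T, a, c) = -2(b h(a, c) +
μ θ(a) θ(c))`, and the equation for the eigenvalues says `-λ = -bμ`. The volume condition makes `C`
trace-free (`sum_cubic_eq_zero`), hence `μ = -nb` and `-λ = n b²`. A continuous `b` with constant
nonzero square is locally constant (`exists_ball_isAxis`).

The core is `fderiv_axis_eq`: `σ = D_T f - b f` and `τ = D_T ℓ + b ℓ` satisfy `Dσ = μ θ σ` and `Dτ =
-μ θ τ`. In general `D_a σ = Df(P a) + μ θ(a) σ`, where `P a` is the Levi-Civita derivative of `T`;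
the symmetry of the second derivatives of `σ` and `τ` is a Codazzi-type identity that forces `P =
0`, because `μ ≠ b`.

Consequently `θ = dt` locally, `σ = e^{μt} σ₀` and `τ = e^{-μt} τ₀`. Solving for `f` gives `f =
e^{bt} χ + e^{μt} v` with `v` constant, `χ` in the hyperplane `ker τ₀`, and `dχ(T) = 0`
(`exists_cone`). Thus `χ` is a hypersurface of that hyperplane in the variables transversal to `T`,
and the substitution `u = √n b t` turns the exponents into `u / √n` and `-√n u`. A rescaled `χ` is
the factor `ψ`; its metric is a constant multiple of the restriction of `h`, and the scale is fixed
by the volume condition (`exists_calabi_coordinates`). -/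

lemma two_le_infty : (2 : WithTop ℕ∞) ≤ ∞ := by
  exact WithTop.coe_le_coe.2 (le_top : (2 : ℕ∞) ≤ ⊤)

lemma mlieBracket_modelSpace {E : Type*} [NormedAddCommGroup E] [NormedSpace ℝ E] (V W : E → E)
    (z : E) : VectorField.mlieBracket 𝓘(ℝ, E) V W z = fderiv ℝ W z (V z) - fderiv ℝ V z (W z) := by
  refine (congrFun (VectorField.mlieBracketWithin_univ (I := 𝓘(ℝ, E))).symm z).trans ?_
  refine (congrFun VectorField.mlieBracketWithin_eq_lieBracketWithin z).trans ?_
  exact congrFun VectorField.lieBracketWithin_univ z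

/-! ### Vector fields and differentials read in a chart -/

section Chart

/-- The inverse of the preferred chart at `p`. -/
def chartInv {n : ℕ} {M : Type*} [TopologicalSpace M] [ChartedSpace (Model n) M]
    (p : M) : Model n → M := (chartAt (Model n) p).symm

/-- The domain of the inverse of the preferred chart at `p`. -/
def chartDom {n : ℕ} {M : Type*} [TopologicalSpace M] [ChartedSpace (Model n) M]
    (p : M) : Set (Model n) := (chartAt (Model n) p).target

lemma isOpen_chartDom {n : ℕ} {M : Type*} [TopologicalSpace M] [ChartedSpace (Model n) M]
    (p : M) : IsOpen (chartDom (n := n) p) := (chartAt (Model n) p).open_target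

variable {n : ℕ} {M : Type*} [TopologicalSpace M] [ChartedSpace (Model n) M]
  [IsManifold 𝓘(ℝ, Model n) ∞ M]

lemma contMDiffAt_chartInv (p : M) {z : Model n} (hz : z ∈ chartDom p) :
    ContMDiffAt 𝓘(ℝ, Model n) 𝓘(ℝ, Model n) ∞ (chartInv p) z :=
  (contMDiffOn_chart_symm (I := 𝓘(ℝ, Model n)) (x := p) (n := ∞)).contMDiffAt
    ((isOpen_chartDom p).mem_nhds hz)

lemma isInvertible_mfderiv_chartInv (p : M) {z : Model n} (hz : z ∈ chartDom p) :
    (mfderiv 𝓘(ℝ, Model n) 𝓘(ℝ, Model n) (chartInv p) z).IsInvertible := by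
  have := isInvertible_mfderivWithin_extChartAt_symm (I := 𝓘(ℝ, Model n)) (x := p) (y := z)
    (by simpa [chartDom] using hz)
  rw [modelWithCornersSelf_coe, Set.range_id, mfderivWithin_univ] at this
  exact this

lemma diff_comp_chartInv {F : Type*} [NormedAddCommGroup F] [NormedSpace ℝ F] (p : M)
    {z : Model n} (hz : z ∈ chartDom p) {G : M → F}
    (hG : MDifferentiableAt 𝓘(ℝ, Model n) 𝓘(ℝ, F) G (chartInv p z)) (v : Model n) :
    diff G (chartInv p z) (mfderiv 𝓘(ℝ, Model n) 𝓘(ℝ, Model n) (chartInv p) z v)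
      = fderiv ℝ (G ∘ chartInv p) z v := by
  have h := mfderiv_comp_apply (I := 𝓘(ℝ, Model n)) (I' := 𝓘(ℝ, Model n)) z hG
    ((contMDiffAt_chartInv p hz).mdifferentiableAt (by simp)) v
  rw [mfderiv_eq_fderiv] at h
  exact h.symm

lemma contDiffOn_comp_chartInv {F : Type*} [NormedAddCommGroup F] [NormedSpace ℝ F] (p : M)
    {G : M → F} (hG : ContMDiff 𝓘(ℝ, Model n) 𝓘(ℝ, F) ∞ G) :
    ContDiffOn ℝ ∞ (G ∘ chartInv p) (chartDom (n := n) p) := fun z hz ↦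
  ((hG.contMDiffAt.comp z (contMDiffAt_chartInv p hz)).contDiffAt).contDiffWithinAt

/-- The representation of a vector field in the preferred chart at `p`. -/
def chartField (p : M) (Y : Π x : M, Tan n x) : Model n → Model n :=
  fun z ↦ VectorField.mpullback 𝓘(ℝ, Model n) 𝓘(ℝ, Model n) (chartInv p) Y z

lemma mfderiv_chartField (p : M) (Y : Π x : M, Tan n x) {z : Model n} (hz : z ∈ chartDom p) :
    mfderiv 𝓘(ℝ, Model n) 𝓘(ℝ, Model n) (chartInv p) z (chartField p Y z) = Y (chartInv p z) :=
  (isInvertible_mfderiv_chartInv p hz).self_apply_inverse _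

lemma differentiableAt_chartField (p : M) {Y : Π x : M, Tan n x} {z : Model n}
    (hz : z ∈ chartDom p) (hY : DiffFieldAt Y (chartInv p z)) :
    DifferentiableAt ℝ (chartField p Y) z := by
  have : IsManifold 𝓘(ℝ, Model n) 2 M := IsManifold.of_le (n := ∞) two_le_infty
  have h := MDifferentiableAt.mpullback_vectorField (n := ∞) hY (contMDiffAt_chartInv p hz)
    (isInvertible_mfderiv_chartInv p hz) two_le_infty
  exact (((contMDiff_snd_tangentBundle_modelSpace (Model n) 𝓘(ℝ, Model n) (n := 1)).mdifferentiable
    one_ne_zero _).comp z h).differentiableAt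

lemma contDiffOn_chartField (p : M) {Y : Π x : M, Tan n x} (hY : SmoothField Y) :
    ContDiffOn ℝ ∞ (chartField p Y) (chartDom (n := n) p) := by
  intro z hz
  have : IsManifold 𝓘(ℝ, Model n) (∞ + 1) M := by simpa
  have := ContMDiffAt.mpullback_vectorField_preimage (n := ∞) (m := ∞) (hY _)
    (contMDiffAt_chartInv p hz) (isInvertible_mfderiv_chartInv p hz) (by simp)
  exact (contMDiffAt_vectorSpace_iff_contDiffAt.1 this).contDiffWithinAt

lemma mlieBracket_chartInv (p : M) {X Y : Π x : M, Tan n x} {z : Model n}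
    (hz : z ∈ chartDom p) (hX : DiffFieldAt X (chartInv p z)) (hY : DiffFieldAt Y (chartInv p z)) :
    VectorField.mlieBracket 𝓘(ℝ, Model n) X Y (chartInv p z)
      = mfderiv 𝓘(ℝ, Model n) 𝓘(ℝ, Model n) (chartInv p) z
        (fderiv ℝ (chartField p Y) z (chartField p X z)
          - fderiv ℝ (chartField p X) z (chartField p Y z)) := by
  have : IsManifold 𝓘(ℝ, Model n) (minSmoothness ℝ 2) M :=
    IsManifold.of_le (n := ∞) (by simpa using two_le_infty)
  have h := VectorField.mpullback_mlieBracket (n := ∞) hX hY (contMDiffAt_chartInv p hz)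
    (by simpa using two_le_infty)
  rw [← mfderiv_chartField p (VectorField.mlieBracket 𝓘(ℝ, Model n) X Y) hz]
  exact congrArg _ (h.trans (mlieBracket_modelSpace _ _ _))

end Chart

lemma isInvertible_of_injective {E F : Type*} [NormedAddCommGroup E] [NormedSpace ℝ E]
    [NormedAddCommGroup F] [NormedSpace ℝ F] [FiniteDimensional ℝ E] [FiniteDimensional ℝ F]
    (L : E →L[ℝ] F) (hL : ∀ v, L v = 0 → v = 0)
    (hd : Module.finrank ℝ E = Module.finrank ℝ F) : L.IsInvertible := by
  have hinj : Function.Injective (L : E →ₗ[ℝ] F) := (injective_iff_map_eq_zero _).2 hL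
  refine ⟨(LinearMap.linearEquivOfInjective (L : E →ₗ[ℝ] F) hinj hd).toContinuousLinearEquiv, ?_⟩
  ext v
  rfl

/-! ### The conormal functional and the Gauss decomposition -/

section Conormal

variable {n : ℕ} {M : Type*} [TopologicalSpace M] [ChartedSpace (Model n) M]
  (φ ξ : M → Aff (n + 1))

/-- The functional that vanishes on the tangent space and is `1` at the transversal field. -/
def conormal (x : M) : Aff (n + 1) →L[ℝ] ℝ :=
  (ContinuousLinearMap.snd ℝ (Tan n x) ℝ) ∘L (frameMap φ ξ x).inverse

variable {φ ξ}

lemma frameMap_apply (x : M) (u : Tan n x) (c : ℝ) :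
    frameMap φ ξ x (u, c) = diff φ x u + c • ξ x := by
  simp [frameMap]

lemma isInvertible_frameMap {x : M} (h₁ : Function.Injective (diff (n := n) φ x))
    (h₂ : ∀ u : Tan n x, diff φ x u ≠ ξ x) : (frameMap φ ξ x).IsInvertible := by
  have key : ∀ (u : Tan n x) (c : ℝ), diff φ x u + c • ξ x = 0 → u = 0 ∧ c = 0 := by
    intro u c h
    have hc : c = 0 := by
      by_contra hc
      refine h₂ (-(c⁻¹ • u)) ?_
      rw [map_neg, map_smul, eq_neg_of_add_eq_zero_left h, smul_neg, neg_neg, smul_smul,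
        inv_mul_cancel₀ hc, one_smul]
    subst hc
    refine ⟨h₁ ?_, rfl⟩
    rw [map_zero]
    simpa using h
  refine isInvertible_of_injective (E := Model n × ℝ) _ ?_ (by simp)
  rintro ⟨u, c⟩ h
  obtain ⟨hu, hc⟩ := key u c ((frameMap_apply x u c).symm.trans h)
  exact Prod.ext hu hc

lemma conormal_add {x : M} (h : (frameMap φ ξ x).IsInvertible) (u : Tan n x) (c : ℝ) :
    conormal φ ξ x (diff φ x u + c • ξ x) = c := by
  rw [← frameMap_apply]
  change ((frameMap φ ξ x).inverse (frameMap φ ξ x (u, c))).2 = c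
  rw [h.inverse_apply_self]

lemma conormal_diff {x : M} (h : (frameMap φ ξ x).IsInvertible) (u : Tan n x) :
    conormal φ ξ x (diff φ x u) = 0 := by
  simpa using conormal_add h u 0

lemma conormal_normal {x : M} (h : (frameMap φ ξ x).IsInvertible) :
    conormal φ ξ x (ξ x) = 1 := by
  simpa using conormal_add h 0 1

/-- This identifies conormals that are constructed by other means, such as the inverse of a frame in
a chart, or the conormal of the factor of the product. -/
lemma conormal_unique {x : M} (h : (frameMap φ ξ x).IsInvertible) {η : Aff (n + 1) →L[ℝ] ℝ}
    (h₁ : ∀ u : Tan n x, η (diff φ x u) = 0) (h₂ : η (ξ x) = 1) : η = conormal φ ξ x := by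
  ext1 w
  obtain ⟨⟨u, c⟩, rfl⟩ : ∃ a, frameMap φ ξ x a = w := ⟨_, h.self_apply_inverse w⟩
  rw [frameMap_apply, conormal_add h, map_add, h₁, map_smul, h₂]
  simp

lemma diff_inducedConnection {x : M} (h : (frameMap φ ξ x).IsInvertible)
    (Y : Π y : M, Tan n y) (u : Tan n x) :
    diff φ x (inducedConnection φ ξ Y x u)
      + conormal φ ξ x (diff (fun y ↦ diff φ y (Y y)) x u) • ξ x
      = diff (fun y ↦ diff φ y (Y y)) x u := by
  rw [← frameMap_apply]
  exact h.self_apply_inverse _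

variable [IsManifold 𝓘(ℝ, Model n) ∞ M]

lemma affineMetric_eq (x : M) (u v : Tan n x) : affineMetric φ ξ x u v
    = conormal φ ξ x (diff (fun y ↦ diff φ y (extendField v y)) x u) := rfl

end Conormal

/-! ### The second fundamental form in a chart -/

section MetricChart

variable {n : ℕ} {M : Type*} [TopologicalSpace M] [ChartedSpace (Model n) M]
  [IsManifold 𝓘(ℝ, Model n) ∞ M]

/-- The differential of the inverse of the preferred chart at `p`. -/
def chartPush (p : M) (z : Model n) : Model n →L[ℝ] Tan n (chartInv p z) :=
  mfderiv 𝓘(ℝ, Model n) 𝓘(ℝ, Model n) (chartInv p) z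

lemma chartPush_bijective (p : M) {z : Model n} (hz : z ∈ chartDom p) :
    Function.Bijective (chartPush p z) := (isInvertible_mfderiv_chartInv p hz).bijective

lemma chartPush_chartField (p : M) (Y : Π x : M, Tan n x) {z : Model n} (hz : z ∈ chartDom p) :
    chartPush p z (chartField p Y z) = Y (chartInv p z) := mfderiv_chartField p Y hz

lemma mdifferentiableAt_of_comp_chartInv {F : Type*} [NormedAddCommGroup F] [NormedSpace ℝ F]
    (p : M) {z : Model n} (hz : z ∈ chartDom p) {G : M → F}
    (hG : DifferentiableAt ℝ (G ∘ chartInv p) z) :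
    MDifferentiableAt 𝓘(ℝ, Model n) 𝓘(ℝ, F) G (chartInv p z) := by
  have hsrc : chartInv p z ∈ (chartAt (Model n) p).source := (chartAt (Model n) p).map_target hz
  have h₁ : MDifferentiableAt 𝓘(ℝ, Model n) 𝓘(ℝ, Model n) (chartAt (Model n) p) (chartInv p z) :=
    mdifferentiableAt_atlas (chart_mem_atlas _ p) hsrc
  have h₂ : DifferentiableAt ℝ (G ∘ chartInv p) (chartAt (Model n) p (chartInv p z)) := by
    rwa [chartInv, (chartAt (Model n) p).right_inv hz]
  refine (MDifferentiableAt.comp _ h₂.mdifferentiableAt h₁).congr_of_eventuallyEq ?_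
  filter_upwards [(chartAt (Model n) p).open_source.mem_nhds hsrc] with y hy
  simp [chartInv, (chartAt (Model n) p).left_inv hy]

lemma diff_chartPush {F : Type*} [NormedAddCommGroup F] [NormedSpace ℝ F] (p : M)
    {z : Model n} (hz : z ∈ chartDom p) {G : M → F}
    (hG : DifferentiableAt ℝ (G ∘ chartInv p) z) (v : Model n) :
    diff G (chartInv p z) (chartPush p z v) = fderiv ℝ (G ∘ chartInv p) z v :=
  diff_comp_chartInv p hz (mdifferentiableAt_of_comp_chartInv p hz hG) v

lemma diffFieldAt_extendField {x : M} (v : Tan n x) : DiffFieldAt (extendField v) x :=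
  FiberBundle.mdifferentiableAt_extend 𝓘(ℝ, Model n) (Model n) v

lemma extendField_self {x : M} (v : Tan n x) : extendField v x = v :=
  FiberBundle.extend_apply_self (F := Model n) v

lemma chartField_extendField (p : M) {z : Model n} (hz : z ∈ chartDom p) (v : Model n) :
    chartField p (extendField (chartPush p z v)) z = v :=
  (chartPush_bijective p hz).1
    ((chartPush_chartField p _ hz).trans (extendField_self _))

variable {φ ξ : M → Aff (n + 1)}

/-- The term with the derivative of the field is tangent. The conormal therefore sees only the
Hessian of the immersion, and the affine metric does not depend on how a tangent vector is extended.
-/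
lemma diff_diff_field (hφ : ContMDiff 𝓘(ℝ, Model n) 𝓘(ℝ, Aff (n + 1)) ∞ φ) (p : M) {z : Model n}
    (hz : z ∈ chartDom p) {Y : Π x : M, Tan n x} (hY : DiffFieldAt Y (chartInv p z))
    (u : Model n) :
    diff (fun y ↦ diff φ y (Y y)) (chartInv p z) (chartPush p z u)
      = fderiv ℝ (fderiv ℝ (φ ∘ chartInv p)) z u (chartField p Y z)
        + fderiv ℝ (φ ∘ chartInv p) z (fderiv ℝ (chartField p Y) z u) := by
  have hf := contDiffOn_comp_chartInv p hφ
  have hnhds := (isOpen_chartDom p).mem_nhds hz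
  have hf' : DifferentiableAt ℝ (fderiv ℝ (φ ∘ chartInv p)) z :=
    ((hf.contDiffAt hnhds).fderiv_right (m := 1) two_le_infty).differentiableAt one_ne_zero
  have hY' := differentiableAt_chartField p hz hY
  have heq : ((fun y ↦ diff φ y (Y y)) ∘ chartInv p)
      =ᶠ[𝓝 z] fun z' ↦ fderiv ℝ (φ ∘ chartInv p) z' (chartField p Y z') := by
    filter_upwards [hnhds] with z' hz'
    have := diff_chartPush p hz' ((hf.contDiffAt
      ((isOpen_chartDom p).mem_nhds hz')).differentiableAt (by simp)) (chartField p Y z')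
    rw [chartPush_chartField p Y hz'] at this
    exact this
  have hd : DifferentiableAt ℝ
      (fun z' ↦ fderiv ℝ (φ ∘ chartInv p) z' (chartField p Y z')) z := hf'.clm_apply hY'
  rw [diff_chartPush p hz (hd.congr_of_eventuallyEq heq), heq.fderiv_eq, fderiv_clm_apply hf' hY']
  simp [add_comm]

end MetricChart

/-! ### Metric, cubic form and Koszul formula of a hypersurface with its conormal -/

section Centroaffine

variable {E F : Type*} [NormedAddCommGroup E] [NormedSpace ℝ E]
  [NormedAddCommGroup F] [NormedSpace ℝ F]

/-- The metric `ℓ (D²f (a, b))` of a hypersurface `f` with conormal field `ℓ`. -/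
def conormalMetric (f : E → F) (ℓ : E → F →L[ℝ] ℝ) (z a b : E) : ℝ :=
  -(fderiv ℝ ℓ z a (fderiv ℝ f z b))

/-- The cubic form of a hypersurface `f` with conormal field `ℓ`. -/
def conormalCubic (f : E → F) (ℓ : E → F →L[ℝ] ℝ) (z a b c : E) : ℝ :=
  fderiv ℝ ℓ z c (fderiv ℝ (fderiv ℝ f) z a b)
    - fderiv ℝ (fderiv ℝ ℓ) z a b (fderiv ℝ f z c)

/-- `f` is an immersed hypersurface, on an open set `Ω`, with transversal field `κ f`, conormal
field `ℓ` and positive definite metric. -/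
structure IsCentroaffine (Ω : Set E) (f : E → F) (ℓ : E → F →L[ℝ] ℝ) (κ : ℝ) : Prop where
  isOpen : IsOpen Ω
  smooth : ContDiffOn ℝ ∞ f Ω
  smooth_conormal : ContDiffOn ℝ ∞ ℓ Ω
  tangent : ∀ z ∈ Ω, ∀ a, ℓ z (fderiv ℝ f z a) = 0
  normal : ∀ z ∈ Ω, κ * ℓ z (f z) = 1
  pos : ∀ z ∈ Ω, ∀ a, a ≠ 0 → 0 < conormalMetric f ℓ z a a

namespace IsCentroaffine

variable {Ω : Set E} {f : E → F} {ℓ : E → F →L[ℝ] ℝ} {κ : ℝ} {z : E}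

lemma mono (h : IsCentroaffine Ω f ℓ κ) {U : Set E} (hU : IsOpen U) (hUΩ : U ⊆ Ω) :
    IsCentroaffine U f ℓ κ :=
  ⟨hU, h.smooth.mono hUΩ, h.smooth_conormal.mono hUΩ, fun z hz ↦ h.tangent z (hUΩ hz),
    fun z hz ↦ h.normal z (hUΩ hz), fun z hz ↦ h.pos z (hUΩ hz)⟩

lemma contDiffAt (h : IsCentroaffine Ω f ℓ κ) (hz : z ∈ Ω) : ContDiffAt ℝ ∞ f z :=
  h.smooth.contDiffAt (h.isOpen.mem_nhds hz)

lemma contDiffAt_conormal (h : IsCentroaffine Ω f ℓ κ) (hz : z ∈ Ω) : ContDiffAt ℝ ∞ ℓ z :=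
  h.smooth_conormal.contDiffAt (h.isOpen.mem_nhds hz)

lemma contDiffAt_fderiv (h : IsCentroaffine Ω f ℓ κ) (hz : z ∈ Ω) :
    ContDiffAt ℝ ∞ (fderiv ℝ f) z :=
  (h.contDiffAt hz).fderiv_right (m := ∞) (by simp)

lemma contDiffAt_fderiv_conormal (h : IsCentroaffine Ω f ℓ κ) (hz : z ∈ Ω) :
    ContDiffAt ℝ ∞ (fderiv ℝ ℓ) z :=
  (h.contDiffAt_conormal hz).fderiv_right (m := ∞) (by simp)

lemma differentiableAt (h : IsCentroaffine Ω f ℓ κ) (hz : z ∈ Ω) : DifferentiableAt ℝ f z :=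
  (h.contDiffAt hz).differentiableAt (by simp)

lemma differentiableAt_conormal (h : IsCentroaffine Ω f ℓ κ) (hz : z ∈ Ω) :
    DifferentiableAt ℝ ℓ z := (h.contDiffAt_conormal hz).differentiableAt (by simp)

lemma differentiableAt_fderiv (h : IsCentroaffine Ω f ℓ κ) (hz : z ∈ Ω) :
    DifferentiableAt ℝ (fderiv ℝ f) z := (h.contDiffAt_fderiv hz).differentiableAt (by simp)

lemma differentiableAt_fderiv_conormal (h : IsCentroaffine Ω f ℓ κ) (hz : z ∈ Ω) :
    DifferentiableAt ℝ (fderiv ℝ ℓ) z :=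
  (h.contDiffAt_fderiv_conormal hz).differentiableAt (by simp)

lemma second_symm (h : IsCentroaffine Ω f ℓ κ) (hz : z ∈ Ω) (a b : E) :
    fderiv ℝ (fderiv ℝ f) z a b = fderiv ℝ (fderiv ℝ f) z b a :=
  ((h.contDiffAt hz).isSymmSndFDerivAt (by simpa using two_le_infty)).eq a b

lemma second_conormal_symm (h : IsCentroaffine Ω f ℓ κ) (hz : z ∈ Ω) (a b : E) :
    fderiv ℝ (fderiv ℝ ℓ) z a b = fderiv ℝ (fderiv ℝ ℓ) z b a :=
  ((h.contDiffAt_conormal hz).isSymmSndFDerivAt (by simpa using two_le_infty)).eq a b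

/-- Differentiate `ℓ(D_b f) = 0` in the direction `a`. The Hessian form gives the symmetry of the
metric, whereas the definition in first derivatives is the convenient one to differentiate. -/
lemma metric_eq (h : IsCentroaffine Ω f ℓ κ) (hz : z ∈ Ω) (a b : E) :
    conormalMetric f ℓ z a b = ℓ z (fderiv ℝ (fderiv ℝ f) z a b) := by
  have h₀ : (fun z' ↦ ℓ z' (fderiv ℝ f z' b)) =ᶠ[𝓝 z] fun _ ↦ 0 := by
    filter_upwards [h.isOpen.mem_nhds hz] with z' hz' using h.tangent z' hz' b
  have h₁ := h₀.fderiv_eq (𝕜 := ℝ)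
  rw [fderiv_clm_apply (h.differentiableAt_conormal hz)
    ((h.differentiableAt_fderiv hz).clm_apply (differentiableAt_const b)),
    fderiv_clm_apply (h.differentiableAt_fderiv hz) (differentiableAt_const b)] at h₁
  have h₂ := DFunLike.congr_fun h₁ a
  simp at h₂
  rw [conormalMetric]
  linarith

lemma metric_symm (h : IsCentroaffine Ω f ℓ κ) (hz : z ∈ Ω) (a b : E) :
    conormalMetric f ℓ z a b = conormalMetric f ℓ z b a := by
  rw [h.metric_eq hz, h.metric_eq hz, h.second_symm hz]

lemma fderiv_conormal_self (h : IsCentroaffine Ω f ℓ κ) (hz : z ∈ Ω) (a : E) :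
    fderiv ℝ ℓ z a (f z) = 0 := by
  have hκ : κ ≠ 0 := left_ne_zero_of_mul_eq_one (h.normal z hz)
  have h₀ : (fun z' ↦ ℓ z' (f z')) =ᶠ[𝓝 z] fun _ ↦ κ⁻¹ := by
    filter_upwards [h.isOpen.mem_nhds hz] with z' hz'
    rw [eq_inv_of_mul_eq_one_right (h.normal z' hz')]
  have h₁ := h₀.fderiv_eq (𝕜 := ℝ)
  rw [fderiv_clm_apply (h.differentiableAt_conormal hz) (h.differentiableAt hz)] at h₁
  have h₂ := DFunLike.congr_fun h₁ a
  simpa [h.tangent z hz] using h₂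

lemma eq_zero_of_fderiv_eq_zero (h : IsCentroaffine Ω f ℓ κ) (hz : z ∈ Ω) {a : E}
    (ha : fderiv ℝ f z a = 0) : a = 0 := by
  by_contra hne
  have := h.pos z hz a hne
  simp [conormalMetric, ha] at this

lemma differentiableAt_metric (h : IsCentroaffine Ω f ℓ κ) (hz : z ∈ Ω) {Y Z : E → E}
    (hY : DifferentiableAt ℝ Y z) (hZ : DifferentiableAt ℝ Z z) :
    DifferentiableAt ℝ (fun z' ↦ conormalMetric f ℓ z' (Y z') (Z z')) z :=
  (((h.differentiableAt_fderiv_conormal hz).clm_apply hY).clm_apply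
    ((h.differentiableAt_fderiv hz).clm_apply hZ)).neg

lemma fderiv_metric (h : IsCentroaffine Ω f ℓ κ) (hz : z ∈ Ω) {Y Z : E → E}
    (hY : DifferentiableAt ℝ Y z) (hZ : DifferentiableAt ℝ Z z) (u : E) :
    fderiv ℝ (fun z' ↦ conormalMetric f ℓ z' (Y z') (Z z')) z u
      = -(fderiv ℝ (fderiv ℝ ℓ) z u (Y z) (fderiv ℝ f z (Z z)))
        - fderiv ℝ ℓ z (Y z) (fderiv ℝ (fderiv ℝ f) z u (Z z))
        + conormalMetric f ℓ z (fderiv ℝ Y z u) (Z z)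
        + conormalMetric f ℓ z (Y z) (fderiv ℝ Z z u) := by
  have hℓ := h.differentiableAt_fderiv_conormal hz
  have hf := h.differentiableAt_fderiv hz
  simp only [conormalMetric]
  rw [fderiv_fun_neg, fderiv_clm_apply (hℓ.clm_apply hY) (hf.clm_apply hZ),
    fderiv_clm_apply hℓ hY, fderiv_clm_apply hf hZ]
  simp
  ring

lemma cubic_symm_left (h : IsCentroaffine Ω f ℓ κ) (hz : z ∈ Ω) (a b c : E) :
    conormalCubic f ℓ z a b c = conormalCubic f ℓ z b a c := by
  rw [conormalCubic, conormalCubic, h.second_symm hz, h.second_conormal_symm hz]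

/-- Differentiate `h(b, c) = h(c, b)` along `a`, with the metric written as `-(Dℓ)(Df)`. Together
with `cubic_symm_left` this yields total symmetry, which is the Codazzi equation. -/
lemma cubic_symm_right (h : IsCentroaffine Ω f ℓ κ) (hz : z ∈ Ω) (a b c : E) :
    conormalCubic f ℓ z a b c = conormalCubic f ℓ z a c b := by
  have h₁ := h.fderiv_metric hz (differentiableAt_const b) (differentiableAt_const c) a
  have h₂ := h.fderiv_metric hz (differentiableAt_const c) (differentiableAt_const b) a
  have h₃ : (fun z' ↦ conormalMetric f ℓ z' b c) =ᶠ[𝓝 z] fun z' ↦ conormalMetric f ℓ z' c b := by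
    filter_upwards [h.isOpen.mem_nhds hz] with z' hz' using h.metric_symm hz' b c
  rw [h₃.fderiv_eq, h₂] at h₁
  simp [conormalMetric] at h₁
  rw [conormalCubic, conormalCubic]
  linarith

lemma metric_add_left (z a b c : E) : conormalMetric f ℓ z (a + b) c
    = conormalMetric f ℓ z a c + conormalMetric f ℓ z b c := by
  simp [conormalMetric]; ring

lemma metric_sub_left (z a b c : E) : conormalMetric f ℓ z (a - b) c
    = conormalMetric f ℓ z a c - conormalMetric f ℓ z b c := by
  simp [conormalMetric]; ring

lemma metric_smul_left (z : E) (r : ℝ) (a c : E) : conormalMetric f ℓ z (r • a) c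
    = r * conormalMetric f ℓ z a c := by
  simp [conormalMetric]

lemma metric_add_right (z a b c : E) : conormalMetric f ℓ z a (b + c)
    = conormalMetric f ℓ z a b + conormalMetric f ℓ z a c := by
  simp [conormalMetric]; ring

lemma metric_smul_right (z : E) (r : ℝ) (a c : E) : conormalMetric f ℓ z a (r • c)
    = r * conormalMetric f ℓ z a c := by
  simp [conormalMetric]

/-- The right-hand side is the sum of `h(∇_X Y, Z)` for the connection `∇` induced by `f` and
`h(∇*_X Y, Z)` for the conjugate connection `∇*` induced by `ℓ`. The identity thus says that the
Levi-Civita connection is the mean of the two. -/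
lemma koszul_eq (h : IsCentroaffine Ω f ℓ κ) (hz : z ∈ Ω) {X Y Z : E → E}
    (hX : DifferentiableAt ℝ X z) (hY : DifferentiableAt ℝ Y z) (hZ : DifferentiableAt ℝ Z z) :
    fderiv ℝ (fun z' ↦ conormalMetric f ℓ z' (Y z') (Z z')) z (X z)
      + fderiv ℝ (fun z' ↦ conormalMetric f ℓ z' (X z') (Z z')) z (Y z)
      - fderiv ℝ (fun z' ↦ conormalMetric f ℓ z' (X z') (Y z')) z (Z z)
      + conormalMetric f ℓ z (fderiv ℝ Y z (X z) - fderiv ℝ X z (Y z)) (Z z)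
      - conormalMetric f ℓ z (fderiv ℝ Z z (X z) - fderiv ℝ X z (Z z)) (Y z)
      - conormalMetric f ℓ z (fderiv ℝ Z z (Y z) - fderiv ℝ Y z (Z z)) (X z)
    = 2 * conormalMetric f ℓ z (fderiv ℝ Y z (X z)) (Z z)
      - fderiv ℝ ℓ z (Z z) (fderiv ℝ (fderiv ℝ f) z (X z) (Y z))
      - fderiv ℝ (fderiv ℝ ℓ) z (X z) (Y z) (fderiv ℝ f z (Z z)) := by
  rw [h.fderiv_metric hz hY hZ, h.fderiv_metric hz hX hZ, h.fderiv_metric hz hX hY]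
  simp only [metric_sub_left]
  have h₁ := h.cubic_symm_right hz (X z) (Y z) (Z z)
  have h₂ := h.cubic_symm_right hz (Y z) (X z) (Z z)
  rw [conormalCubic, conormalCubic] at h₁ h₂
  have e (a b c : E) : fderiv ℝ ℓ z c (fderiv ℝ (fderiv ℝ f) z a b)
      = fderiv ℝ ℓ z c (fderiv ℝ (fderiv ℝ f) z b a) := by rw [h.second_symm hz]
  have e' (a b c : E) : fderiv ℝ (fderiv ℝ ℓ) z a b (fderiv ℝ f z c)
      = fderiv ℝ (fderiv ℝ ℓ) z b a (fderiv ℝ f z c) := by rw [h.second_conormal_symm hz]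
  linarith [h.metric_symm hz (X z) (fderiv ℝ Z z (Y z)),
    h.metric_symm hz (Y z) (fderiv ℝ Z z (X z)), h.metric_symm hz (X z) (fderiv ℝ Y z (Z z)),
    e (X z) (Y z) (Z z), e (X z) (Z z) (Y z), e (Y z) (Z z) (X z),
    e' (X z) (Y z) (Z z), e' (X z) (Z z) (Y z), e' (Y z) (Z z) (X z)]

/-- A positive definite form is nondegenerate, so it represents every functional in finite
dimension. -/
lemma exists_metric_eq [FiniteDimensional ℝ E] (h : IsCentroaffine Ω f ℓ κ) (hz : z ∈ Ω)
    (θ : E →ₗ[ℝ] ℝ) : ∃ w, ∀ c, conormalMetric f ℓ z w c = θ c := by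
  let B : E →ₗ[ℝ] Module.Dual ℝ E := LinearMap.mk₂ ℝ (conormalMetric f ℓ z)
    (metric_add_left z) (metric_smul_left z) (metric_add_right z) (metric_smul_right z)
  have hB : Function.Injective B := by
    refine (injective_iff_map_eq_zero _).2 fun a ha ↦ ?_
    by_contra hne
    have h₁ := h.pos z hz a hne
    have h₂ : conormalMetric f ℓ z a a = 0 := LinearMap.congr_fun ha a
    linarith
  obtain ⟨w, hw⟩ := (LinearMap.injective_iff_surjective_of_finrank_eq_finrank
    (Subspace.dual_finrank_eq (K := ℝ) (V := E)).symm).1 hB θ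
  exact ⟨w, fun c ↦ LinearMap.congr_fun hw c⟩

end IsCentroaffine

end Centroaffine

/-! ### From the affine hypersphere to its position vector and conormal in a chart -/

section ChartData

variable {n : ℕ} {M : Type*} [TopologicalSpace M] [ChartedSpace (Model n) M]

/-- The position vector with respect to the centre, in the preferred chart at `p`. -/
def chartPos (ξ : M → Aff (n + 1)) (lam : ℝ) (p : M) (z : Model n) : Aff (n + 1) :=
  (-lam)⁻¹ • ξ (chartInv p z)

/-- The conormal field in the preferred chart at `p`. -/
def chartConormal (φ ξ : M → Aff (n + 1)) (p : M) (z : Model n) : Aff (n + 1) →L[ℝ] ℝ :=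
  conormal φ ξ (chartInv p z)

variable [IsManifold 𝓘(ℝ, Model n) ∞ M] {φ ξ : M → Aff (n + 1)} {lam : ℝ}

lemma IsAffineNormal.isInvertible_frameMap (h : IsAffineNormal φ ξ) (x : M) :
    (frameMap φ ξ x).IsInvertible :=
  AffineGeometry.isInvertible_frameMap (h.immersion x) (h.transversal x)

lemma diff_map_chartPush (hφ : ContMDiff 𝓘(ℝ, Model n) 𝓘(ℝ, Aff (n + 1)) ∞ φ) (p : M)
    {z : Model n} (hz : z ∈ chartDom p) (u : Model n) :
    diff φ (chartInv p z) (chartPush p z u) = fderiv ℝ (φ ∘ chartInv p) z u :=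
  diff_chartPush p hz (((contDiffOn_comp_chartInv p hφ).contDiffAt
      ((isOpen_chartDom p).mem_nhds hz)).differentiableAt (by simp)) u

lemma contDiffOn_chartConormal (h : IsAffineNormal φ ξ) (p : M) :
    ContDiffOn ℝ ∞ (chartConormal φ ξ p) (chartDom p) := by
  intro z hz
  refine ContDiffAt.contDiffWithinAt ?_
  have hnhds := (isOpen_chartDom p).mem_nhds hz
  -- The source of `frameMap` varies with the point. Read in the chart it is a family of invertible
  -- maps between fixed spaces, and inversion is smooth there.
  let R : Model n → (Model n × ℝ →L[ℝ] Aff (n + 1)) := fun z ↦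
    (fderiv ℝ (φ ∘ chartInv p) z) ∘L (ContinuousLinearMap.fst ℝ (Model n) ℝ)
      + (ContinuousLinearMap.toSpanSingletonCLE (𝕜 := ℝ) (ξ (chartInv p z)))
        ∘L (ContinuousLinearMap.snd ℝ (Model n) ℝ)
  have hR (z : Model n) (u : Model n) (c : ℝ) :
      R z (u, c) = fderiv ℝ (φ ∘ chartInv p) z u + c • ξ (chartInv p z) := by simp [R]
  have hRinv : ∀ z ∈ chartDom p, (R z).IsInvertible := by
    intro z hz
    refine isInvertible_of_injective _ ?_ (by simp)
    rintro ⟨u, c⟩ h0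
    rw [hR, ← diff_map_chartPush h.smooth_map p hz] at h0
    have hc : c = 0 := by
      rw [← conormal_add (h.isInvertible_frameMap (chartInv p z)) (chartPush p z u) c, h0, map_zero]
    subst hc
    rw [zero_smul, add_zero] at h0
    have hu : chartPush p z u = chartPush p z 0 := h.immersion _ (by rw [h0, map_zero, map_zero])
    rw [(chartPush_bijective p hz).1 hu]
    rfl
  have hRsmooth : ContDiffAt ℝ ∞ R z := by
    have h₁ : ContDiffAt ℝ ∞ (fderiv ℝ (φ ∘ chartInv p)) z :=
      ((contDiffOn_comp_chartInv p h.smooth_map).contDiffAt hnhds).fderiv_right (m := ∞) (by simp)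
    have h₂ : ContDiffAt ℝ ∞ (ξ ∘ chartInv p) z :=
      (contDiffOn_comp_chartInv p h.smooth_normal).contDiffAt hnhds
    have h₃ : ContDiffAt ℝ ∞ (fun z ↦ ContinuousLinearMap.toSpanSingletonCLE (𝕜 := ℝ)
        (E := Aff (n + 1)) (ξ (chartInv p z))) z :=
      (ContinuousLinearEquiv.contDiff _).contDiffAt.comp z h₂
    exact (h₁.clm_comp contDiffAt_const).add (h₃.clm_comp contDiffAt_const)
  have hinv : ContDiffAt ℝ ∞ (fun z ↦ (ContinuousLinearMap.snd ℝ (Model n) ℝ) ∘L (R z).inverse) z :=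
    contDiffAt_const.clm_comp ((hRinv z hz).contDiffAt_map_inverse.comp z hRsmooth)
  refine hinv.congr_of_eventuallyEq ?_
  filter_upwards [hnhds] with z' hz'
  have key (u : Model n) (c : ℝ) :
      ((ContinuousLinearMap.snd ℝ (Model n) ℝ) ∘L (R z').inverse)
        (fderiv ℝ (φ ∘ chartInv p) z' u + c • ξ (chartInv p z')) = c := by
    rw [← hR]
    change ((R z').inverse (R z' (u, c))).2 = c
    rw [(hRinv z' hz').inverse_apply_self]
  refine (conormal_unique (h.isInvertible_frameMap _) (fun u ↦ ?_) ?_).symm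
  · obtain ⟨u, rfl⟩ := (chartPush_bijective p hz').2 u
    rw [diff_map_chartPush h.smooth_map p hz']
    simpa using key u 0
  · simpa using key 0 1

lemma fderiv_chartPos (h : IsAffineHypersphere φ ξ lam) (hlam : lam ≠ 0) (p : M) {z : Model n}
    (hz : z ∈ chartDom p) :
    fderiv ℝ (chartPos ξ lam p) z = fderiv ℝ (φ ∘ chartInv p) z := by
  have hξ : DifferentiableAt ℝ (ξ ∘ chartInv p) z :=
    ((contDiffOn_comp_chartInv p h.smooth_normal).contDiffAt
      ((isOpen_chartDom p).mem_nhds hz)).differentiableAt (by simp)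
  ext1 u
  have h₁ : fderiv ℝ (chartPos ξ lam p) z u = (-lam)⁻¹ • fderiv ℝ (ξ ∘ chartInv p) z u := by
    have : chartPos ξ lam p = fun z ↦ (-lam)⁻¹ • (ξ ∘ chartInv p) z := rfl
    rw [this, fderiv_fun_const_smul hξ]
    rfl
  rw [h₁, ← diff_map_chartPush h.smooth_normal p hz, h.shape,
    ← diff_map_chartPush h.smooth_map p hz, map_smul, ← neg_smul, smul_smul,
    inv_mul_cancel₀ (neg_ne_zero.2 hlam), one_smul]

lemma fderiv_chartPos_eventuallyEq (h : IsAffineHypersphere φ ξ lam) (hlam : lam ≠ 0) (p : M)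
    {z : Model n} (hz : z ∈ chartDom p) :
    fderiv ℝ (chartPos ξ lam p) =ᶠ[𝓝 z] fderiv ℝ (φ ∘ chartInv p) := by
  filter_upwards [(isOpen_chartDom p).mem_nhds hz] with z' hz' using fderiv_chartPos h hlam p hz'

lemma conormal_second (h : IsAffineNormal φ ξ) (p : M) {z : Model n} (hz : z ∈ chartDom p)
    (u v : Model n) :
    affineMetric φ ξ (chartInv p z) (chartPush p z u) (chartPush p z v)
      = chartConormal φ ξ p z (fderiv ℝ (fderiv ℝ (φ ∘ chartInv p)) z u v) := by
  rw [affineMetric_eq, diff_diff_field h.smooth_map p hz (diffFieldAt_extendField _) u,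
    chartField_extendField p hz, map_add, ← diff_map_chartPush h.smooth_map p hz,
    conormal_diff (h.isInvertible_frameMap _), add_zero]
  rfl

lemma chartConormal_fderiv (h : IsAffineNormal φ ξ) (p : M) {z : Model n} (hz : z ∈ chartDom p)
    (u : Model n) : chartConormal φ ξ p z (fderiv ℝ (φ ∘ chartInv p) z u) = 0 := by
  rw [← diff_map_chartPush h.smooth_map p hz]
  exact conormal_diff (h.isInvertible_frameMap _) _

lemma affineMetric_chartPush (h : IsAffineHypersphere φ ξ lam) (hlam : lam ≠ 0) (p : M)
    {z : Model n} (hz : z ∈ chartDom p) (u v : Model n) :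
    affineMetric φ ξ (chartInv p z) (chartPush p z u) (chartPush p z v)
      = conormalMetric (chartPos ξ lam p) (chartConormal φ ξ p) z u v := by
  have hnhds := (isOpen_chartDom p).mem_nhds hz
  have hℓ : DifferentiableAt ℝ (chartConormal φ ξ p) z :=
    ((contDiffOn_chartConormal h.toIsAffineNormal p).contDiffAt hnhds).differentiableAt (by simp)
  have hf : DifferentiableAt ℝ (fderiv ℝ (φ ∘ chartInv p)) z :=
    (((contDiffOn_comp_chartInv p h.smooth_map).contDiffAt hnhds).fderiv_right
      (m := 1) two_le_infty).differentiableAt one_ne_zero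
  have h₀ : (fun z' ↦ chartConormal φ ξ p z' (fderiv ℝ (φ ∘ chartInv p) z' v))
      =ᶠ[𝓝 z] fun _ ↦ 0 := by
    filter_upwards [hnhds] with z' hz' using chartConormal_fderiv h.toIsAffineNormal p hz' v
  have h₁ := h₀.fderiv_eq (𝕜 := ℝ)
  rw [fderiv_clm_apply hℓ (hf.clm_apply (differentiableAt_const v)),
    fderiv_clm_apply hf (differentiableAt_const v)] at h₁
  have h₂ := DFunLike.congr_fun h₁ u
  simp at h₂
  rw [conormal_second h.toIsAffineNormal p hz, conormalMetric, fderiv_chartPos h hlam p hz]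
  linarith

/-- The factor is `-lam` because `ξ = -lam • f` for the position vector `f`. -/
lemma isCentroaffine_chart (h : IsAffineHypersphere φ ξ lam) (hlam : lam ≠ 0) (p : M) :
    IsCentroaffine (chartDom p) (chartPos ξ lam p) (chartConormal φ ξ p) (-lam) where
  isOpen := isOpen_chartDom p
  smooth := (contDiffOn_comp_chartInv p h.smooth_normal).const_smul _
  smooth_conormal := contDiffOn_chartConormal h.toIsAffineNormal p
  tangent z hz a := by
    rw [fderiv_chartPos h hlam p hz]
    exact chartConormal_fderiv h.toIsAffineNormal p hz a
  normal z hz := by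
    rw [chartPos, map_smul, chartConormal, conormal_normal (h.isInvertible_frameMap _)]
    simp [hlam]
  pos z hz a ha := by
    rw [← affineMetric_chartPush h hlam p hz]
    refine h.posDef _ _ fun h0 ↦ ha ((chartPush_bijective p hz).1 ?_)
    rw [h0, map_zero]

lemma diff_affineMetric_field (h : IsAffineHypersphere φ ξ lam) (hlam : lam ≠ 0) (p : M)
    {z : Model n} (hz : z ∈ chartDom p) {Y Z : Π x : M, Tan n x}
    (hY : DiffFieldAt Y (chartInv p z)) (hZ : DiffFieldAt Z (chartInv p z)) (u : Model n) :
    diff (fun y ↦ affineMetric φ ξ y (Y y) (Z y)) (chartInv p z) (chartPush p z u)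
      = fderiv ℝ (fun z' ↦ conormalMetric (chartPos ξ lam p) (chartConormal φ ξ p) z'
          (chartField p Y z') (chartField p Z z')) z u := by
  have heq : ((fun y ↦ affineMetric φ ξ y (Y y) (Z y)) ∘ chartInv p)
      =ᶠ[𝓝 z] fun z' ↦ conormalMetric (chartPos ξ lam p) (chartConormal φ ξ p) z'
        (chartField p Y z') (chartField p Z z') := by
    filter_upwards [(isOpen_chartDom p).mem_nhds hz] with z' hz'
    rw [← affineMetric_chartPush h hlam p hz', chartPush_chartField p Y hz',
      chartPush_chartField p Z hz']
    rfl
  have hd := (isCentroaffine_chart h hlam p).differentiableAt_metric hz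
    (differentiableAt_chartField p hz hY) (differentiableAt_chartField p hz hZ)
  rw [diff_chartPush p hz (hd.congr_of_eventuallyEq heq), heq.fderiv_eq]

lemma koszul_affineMetric (h : IsAffineHypersphere φ ξ lam) (hlam : lam ≠ 0) (p : M)
    {z : Model n} (hz : z ∈ chartDom p) {X Y Z : Π x : M, Tan n x}
    (hX : DiffFieldAt X (chartInv p z)) (hY : DiffFieldAt Y (chartInv p z))
    (hZ : DiffFieldAt Z (chartInv p z)) :
    koszul (affineMetric φ ξ) X Y Z (chartInv p z)
      = 2 * conormalMetric (chartPos ξ lam p) (chartConormal φ ξ p) z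
          (fderiv ℝ (chartField p Y) z (chartField p X z)) (chartField p Z z)
        - fderiv ℝ (chartConormal φ ξ p) z (chartField p Z z)
          (fderiv ℝ (fderiv ℝ (chartPos ξ lam p)) z (chartField p X z) (chartField p Y z))
        - fderiv ℝ (fderiv ℝ (chartConormal φ ξ p)) z (chartField p X z) (chartField p Y z)
          (fderiv ℝ (chartPos ξ lam p) z (chartField p Z z)) := by
  rw [← (isCentroaffine_chart h hlam p).koszul_eq hz (differentiableAt_chartField p hz hX)
    (differentiableAt_chartField p hz hY) (differentiableAt_chartField p hz hZ),
    ← diff_affineMetric_field h hlam p hz hY hZ, ← diff_affineMetric_field h hlam p hz hX hZ,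
    ← diff_affineMetric_field h hlam p hz hX hY]
  simp only [← affineMetric_chartPush h hlam p hz, chartPush_chartField p _ hz]
  rw [koszul, mlieBracket_chartInv p hz hX hY, mlieBracket_chartInv p hz hX hZ,
    mlieBracket_chartInv p hz hY hZ]
  rfl

/-- With `∇̂ = (∇ + ∇*) / 2` the difference tensor is `(∇ - ∇*) / 2`, and the cubic form is `-h((∇ -
∇*)(u, v), w)`. The derivatives of the extended fields cancel. -/
lemma affineMetric_differenceTensor (h : IsAffineHypersphere φ ξ lam) (hlam : lam ≠ 0) (p : M)
    {z : Model n} (hz : z ∈ chartDom p) (u v w : Model n) :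
    2 * affineMetric φ ξ (chartInv p z)
        (differenceTensor φ ξ (chartInv p z) (chartPush p z u) (chartPush p z v))
        (chartPush p z w)
      = -conormalCubic (chartPos ξ lam p) (chartConormal φ ξ p) z u v w := by
  have hC := isCentroaffine_chart h hlam p
  have hX := diffFieldAt_extendField (chartPush p z u)
  have hY := diffFieldAt_extendField (chartPush p z v)
  have hW := diffFieldAt_extendField (chartPush p z w)
  have hkos {Z : Π x : M, Tan n x} (hZ : DiffFieldAt Z (chartInv p z)) :=
    koszul_affineMetric h hlam p hz hX hY hZ
  simp only [chartField_extendField p hz] at hkos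
  set D := fderiv ℝ (chartField p (extendField (chartPush p z v))) z u
  set f := chartPos ξ lam p with hf
  set ℓ := chartConormal φ ξ p with hℓ
  -- The Koszul formula has a solution: its right-hand side depends on `Z` only through the value at
  -- the point, linearly, and is represented by the metric. Hence the vector chosen by
  -- `Classical.epsilon` satisfies the formula.
  obtain ⟨l₀, hl₀⟩ := hC.exists_metric_eq hz
    (-(fderiv ℝ ℓ z D ∘L fderiv ℝ f z) - (2⁻¹ : ℝ) • ((fderiv ℝ ℓ z).flip
      (fderiv ℝ (fderiv ℝ f) z u v) + fderiv ℝ (fderiv ℝ ℓ) z u v ∘L fderiv ℝ f z) :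
      Model n →L[ℝ] ℝ)
  have hlc : ∀ Z : Π y : M, Tan n y, DiffFieldAt Z (chartInv p z) →
      2 * affineMetric φ ξ (chartInv p z) (leviCivita (affineMetric φ ξ)
        (extendField (chartPush p z u)) (extendField (chartPush p z v)) (chartInv p z))
        (Z (chartInv p z)) = koszul (affineMetric φ ξ) (extendField (chartPush p z u))
          (extendField (chartPush p z v)) Z (chartInv p z) := by
    refine Classical.epsilon_spec (p := fun w : Tan n (chartInv p z) ↦
      ∀ Z : Π y : M, Tan n y, DiffFieldAt Z (chartInv p z) →
        2 * affineMetric φ ξ (chartInv p z) w (Z (chartInv p z)) = koszul (affineMetric φ ξ)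
          (extendField (chartPush p z u)) (extendField (chartPush p z v)) Z (chartInv p z))
      ⟨chartPush p z l₀, fun Z hZ ↦ ?_⟩
    rw [hkos hZ, ← chartPush_chartField p Z hz, affineMetric_chartPush h hlam p hz, hl₀]
    simp [conormalMetric]
    ring
  have hlcw := (hlc _ hW).trans (hkos hW)
  obtain ⟨l, hl⟩ := (chartPush_bijective p hz).2 (leviCivita (affineMetric φ ξ)
        (extendField (chartPush p z u)) (extendField (chartPush p z v)) (chartInv p z))
  obtain ⟨d, hd⟩ := (chartPush_bijective p hz).2 (inducedConnection φ ξ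
        (extendField (chartPush p z v)) (chartInv p z) (chartPush p z u))
  rw [extendField_self, ← hl, affineMetric_chartPush h hlam p hz,
    chartField_extendField p hz] at hlcw
  have hgauss := diff_inducedConnection (h.isInvertible_frameMap (chartInv p z))
    (extendField (chartPush p z v)) (chartPush p z u)
  rw [← hd, diff_diff_field h.smooth_map p hz hY, diff_map_chartPush h.smooth_map p hz,
    chartField_extendField p hz, ← fderiv_chartPos h hlam p hz,
    ← (fderiv_chartPos_eventuallyEq h hlam p hz).fderiv_eq] at hgauss
  -- `ξ` is a multiple of the position vector, on which `ℓ` is constant and all its derivatives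
  -- along the hypersurface vanish. Applying `D_w ℓ` to the Gauss formula therefore removes the
  -- transversal term.
  have hξ : fderiv ℝ ℓ z w (ξ (chartInv p z)) = 0 := by
    have h₁ := hC.fderiv_conormal_self hz w
    have h₂ : ξ (chartInv p z) = (-lam) • f z := by
      rw [hf, chartPos, smul_smul, mul_inv_cancel₀ (neg_ne_zero.2 hlam), one_smul]
    rw [h₂, map_smul, h₁, smul_zero]
  have hind := congrArg (fderiv ℝ ℓ z w) hgauss
  rw [map_add, map_smul, hξ, smul_zero, add_zero, map_add] at hind
  rw [← hf] at hind
  rw [differenceTensor, ← hl, ← hd, ← map_sub, affineMetric_chartPush h hlam p hz,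
    IsCentroaffine.metric_sub_left, mul_sub, hlcw, ← hf, ← hℓ, hC.metric_symm hz d w,
    hC.metric_symm hz D w]
  simp only [conormalMetric, conormalCubic]
  linarith

end ChartData

/-! ### Rigidity of the axis -/

section Rigidity

variable {E F : Type*} [NormedAddCommGroup E] [NormedSpace ℝ E]
  [NormedAddCommGroup F] [NormedSpace ℝ F]

/-- The position vector field that is parallel up to a factor. -/
def axisField (f : E → F) (T : E → E) (b : ℝ) (z : E) : F := fderiv ℝ f z (T z) - b • f z

/-- The conormal field that is parallel up to a factor. -/
def axisConormal (ℓ : E → F →L[ℝ] ℝ) (T : E → E) (b : ℝ) (z : E) : F →L[ℝ] ℝ :=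
  fderiv ℝ ℓ z (T z) + b • ℓ z

namespace IsCentroaffine

variable {Ω : Set E} {f : E → F} {ℓ : E → F →L[ℝ] ℝ} {κ : ℝ} {z : E} {T : E → E} {b μ : ℝ}

lemma exists_fderiv_eq [FiniteDimensional ℝ E] [FiniteDimensional ℝ F]
    (h : IsCentroaffine Ω f ℓ κ) (hd : Module.finrank ℝ F = Module.finrank ℝ E + 1)
    (hz : z ∈ Ω) (x : F) : ∃ a, ∃ c : ℝ, x = fderiv ℝ f z a + c • f z := by
  let L : E × ℝ →ₗ[ℝ] F := (fderiv ℝ f z : E →ₗ[ℝ] F).coprod (LinearMap.toSpanSingleton ℝ F (f z))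
  have hL (a : E) (c : ℝ) : L (a, c) = fderiv ℝ f z a + c • f z := by simp [L]
  have hinj : Function.Injective L := by
    refine (injective_iff_map_eq_zero _).2 ?_
    rintro ⟨a, c⟩ h0
    rw [hL] at h0
    have h₁ : ℓ z (fderiv ℝ f z a + c • f z) = 0 := by rw [h0, map_zero]
    rw [map_add, h.tangent z hz, zero_add, map_smul, smul_eq_mul] at h₁
    have hc : c = 0 := (mul_eq_zero.1 h₁).resolve_right (right_ne_zero_of_mul_eq_one (h.normal z hz))
    subst hc
    rw [zero_smul, add_zero] at h0
    rw [h.eq_zero_of_fderiv_eq_zero hz h0]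
    rfl
  obtain ⟨⟨a, c⟩, hac⟩ := (LinearMap.injective_iff_surjective_of_finrank_eq_finrank
    (by simp [hd])).1 hinj x
  exact ⟨a, c, by rw [← hac, hL]⟩

/-- By dimension the kernel of the conormal is exactly the tangent space. -/
lemma exists_fderiv_eq_of_conormal [FiniteDimensional ℝ E] [FiniteDimensional ℝ F]
    (h : IsCentroaffine Ω f ℓ κ) (hd : Module.finrank ℝ F = Module.finrank ℝ E + 1)
    (hz : z ∈ Ω) {x : F} (hx : ℓ z x = 0) : ∃ a, x = fderiv ℝ f z a := by
  obtain ⟨a, c, rfl⟩ := h.exists_fderiv_eq hd hz x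
  rw [map_add, h.tangent z hz, zero_add, map_smul, smul_eq_mul] at hx
  have hc : c = 0 := (mul_eq_zero.1 hx).resolve_right (right_ne_zero_of_mul_eq_one (h.normal z hz))
  exact ⟨a, by simp [hc]⟩

lemma functional_ext [FiniteDimensional ℝ E] [FiniteDimensional ℝ F]
    (h : IsCentroaffine Ω f ℓ κ) (hd : Module.finrank ℝ F = Module.finrank ℝ E + 1)
    (hz : z ∈ Ω) {η η' : F →L[ℝ] ℝ} (h₁ : ∀ a, η (fderiv ℝ f z a) = η' (fderiv ℝ f z a))
    (h₂ : η (f z) = η' (f z)) : η = η' := by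
  ext1 x
  obtain ⟨a, c, rfl⟩ := h.exists_fderiv_eq hd hz x
  simp [h₁, h₂]

lemma eq_zero_of_metric (h : IsCentroaffine Ω f ℓ κ) (hz : z ∈ Ω) {a : E}
    (ha : ∀ c, conormalMetric f ℓ z a c = 0) : a = 0 := by
  by_contra hne
  exact (h.pos z hz a hne).ne' (ha a)

lemma contDiffAt_axisField (h : IsCentroaffine Ω f ℓ κ) (hz : z ∈ Ω)
    (hT : ContDiffOn ℝ ∞ T Ω) : ContDiffAt ℝ ∞ (axisField f T b) z :=
  ((h.contDiffAt_fderiv hz).clm_apply (hT.contDiffAt (h.isOpen.mem_nhds hz))).sub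
    ((h.contDiffAt hz).const_smul b)

lemma contDiffAt_axisConormal (h : IsCentroaffine Ω f ℓ κ) (hz : z ∈ Ω)
    (hT : ContDiffOn ℝ ∞ T Ω) : ContDiffAt ℝ ∞ (axisConormal ℓ T b) z :=
  ((h.contDiffAt_fderiv_conormal hz).clm_apply (hT.contDiffAt (h.isOpen.mem_nhds hz))).add
    ((h.contDiffAt_conormal hz).const_smul b)

lemma fderiv_axisField (h : IsCentroaffine Ω f ℓ κ) (hz : z ∈ Ω) (hT : DifferentiableAt ℝ T z)
    (a : E) : fderiv ℝ (axisField f T b) z a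
      = fderiv ℝ (fderiv ℝ f) z a (T z) + fderiv ℝ f z (fderiv ℝ T z a) - b • fderiv ℝ f z a := by
  have hf := h.differentiableAt_fderiv hz
  have hf₀ := h.differentiableAt hz
  have hc : DifferentiableAt ℝ (fun z ↦ b • f z) z := hf₀.const_smul b
  unfold axisField
  rw [fderiv_fun_sub (hf.clm_apply hT) hc, fderiv_clm_apply hf hT,
    fderiv_fun_const_smul hf₀]
  simp [add_comm]

lemma fderiv_axisConormal (h : IsCentroaffine Ω f ℓ κ) (hz : z ∈ Ω) (hT : DifferentiableAt ℝ T z)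
    (a : E) : fderiv ℝ (axisConormal ℓ T b) z a
      = fderiv ℝ (fderiv ℝ ℓ) z a (T z) + fderiv ℝ ℓ z (fderiv ℝ T z a) + b • fderiv ℝ ℓ z a := by
  have hf := h.differentiableAt_fderiv_conormal hz
  have hf₀ := h.differentiableAt_conormal hz
  have hc : DifferentiableAt ℝ (fun z ↦ b • ℓ z) z := hf₀.const_smul b
  unfold axisConormal
  rw [fderiv_fun_add (hf.clm_apply hT) hc, fderiv_clm_apply hf hT,
    fderiv_fun_const_smul hf₀]
  simp [add_comm]

lemma second_conormal_self (h : IsCentroaffine Ω f ℓ κ) (hz : z ∈ Ω) (a c : E) :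
    fderiv ℝ (fderiv ℝ ℓ) z a c (f z) = conormalMetric f ℓ z a c := by
  have h₀ : (fun z' ↦ fderiv ℝ ℓ z' c (f z')) =ᶠ[𝓝 z] fun _ ↦ 0 := by
    filter_upwards [h.isOpen.mem_nhds hz] with z' hz' using h.fderiv_conormal_self hz' c
  have h₁ := h₀.fderiv_eq (𝕜 := ℝ)
  rw [fderiv_clm_apply ((h.differentiableAt_fderiv_conormal hz).clm_apply (differentiableAt_const c))
    (h.differentiableAt hz),
    fderiv_clm_apply (h.differentiableAt_fderiv_conormal hz) (differentiableAt_const c)] at h₁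
  have h₂ := DFunLike.congr_fun h₁ a
  simp at h₂
  rw [h.metric_symm hz, conormalMetric]
  linarith

/-- The direction field `T` has unit length, and is an eigenvector of all operators that the
cubic form defines; the eigenvalues of that of `T` are `b` and, on `T`, `b + μ`. -/
structure IsAxis (Ω : Set E) (f : E → F) (ℓ : E → F →L[ℝ] ℝ) (T : E → E) (b μ : ℝ) : Prop where
  smooth : ContDiffOn ℝ ∞ T Ω
  unit : ∀ z ∈ Ω, conormalMetric f ℓ z (T z) (T z) = 1
  cubic : ∀ z ∈ Ω, ∀ a c, conormalCubic f ℓ z (T z) a c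
    = -2 * (b * conormalMetric f ℓ z a c
      + μ * conormalMetric f ℓ z (T z) a * conormalMetric f ℓ z (T z) c)

/-- The left-hand side is `C(T, a, c)` up to two corrections. The terms with the derivative of `T`
cancel by symmetry of the metric, and the opposite shifts by `b` in the two axis fields absorb the
term `-2b h(a, c)`. -/
lemma axis_pairing (h : IsCentroaffine Ω f ℓ κ) (hA : IsAxis Ω f ℓ T b μ) (hz : z ∈ Ω) (a c : E) :
    fderiv ℝ ℓ z c (fderiv ℝ (axisField f T b) z a)
      - fderiv ℝ (axisConormal ℓ T b) z a (fderiv ℝ f z c)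
      = -2 * μ * conormalMetric f ℓ z (T z) a * conormalMetric f ℓ z (T z) c := by
  have hT := (hA.smooth.contDiffAt (h.isOpen.mem_nhds hz)).differentiableAt (by simp)
  rw [h.fderiv_axisField hz hT, h.fderiv_axisConormal hz hT]
  have h₁ := hA.cubic z hz a c
  rw [h.cubic_symm_left hz, conormalCubic] at h₁
  have h₂ := h.metric_symm hz c (fderiv ℝ T z a)
  have h₃ := h.metric_symm hz c a
  simp only [map_add, map_sub, map_smul, add_apply,
    smul_apply, smul_eq_mul]
  simp only [conormalMetric] at h₁ h₂ h₃ ⊢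
  linear_combination h₁ - h₂ + b * h₃

lemma IsAxis.differentiableAt (hA : IsAxis Ω f ℓ T b μ) (hΩ : IsOpen Ω) (hz : z ∈ Ω) :
    DifferentiableAt ℝ T z := (hA.smooth.contDiffAt (hΩ.mem_nhds hz)).differentiableAt (by simp)

lemma axis_pairing_fderiv (h : IsCentroaffine Ω f ℓ κ) (hA : IsAxis Ω f ℓ T b μ) (hz : z ∈ Ω)
    (a c e : E) :
    fderiv ℝ (fderiv ℝ ℓ) z e c (fderiv ℝ (axisField f T b) z a)
      + fderiv ℝ ℓ z c (fderiv ℝ (fderiv ℝ (axisField f T b)) z e a)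
      - fderiv ℝ (fderiv ℝ (axisConormal ℓ T b)) z e a (fderiv ℝ f z c)
      - fderiv ℝ (axisConormal ℓ T b) z a (fderiv ℝ (fderiv ℝ f) z e c)
      = -2 * μ * (fderiv ℝ (fun z' ↦ conormalMetric f ℓ z' (T z') a) z e
          * conormalMetric f ℓ z (T z) c
        + conormalMetric f ℓ z (T z) a
          * fderiv ℝ (fun z' ↦ conormalMetric f ℓ z' (T z') c) z e) := by
  have hT := hA.differentiableAt h.isOpen hz
  have hf := h.differentiableAt_fderiv hz
  have hℓ := h.differentiableAt_fderiv_conormal hz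
  have hσ : DifferentiableAt ℝ (fderiv ℝ (axisField f T b)) z :=
    ((h.contDiffAt_axisField hz hA.smooth).fderiv_right (m := 1) two_le_infty).differentiableAt
      one_ne_zero
  have hτ : DifferentiableAt ℝ (fderiv ℝ (axisConormal ℓ T b)) z :=
    ((h.contDiffAt_axisConormal hz hA.smooth).fderiv_right (m := 1) two_le_infty).differentiableAt
      one_ne_zero
  have hθ (c : E) : DifferentiableAt ℝ (fun z' ↦ conormalMetric f ℓ z' (T z') c) z :=
    h.differentiableAt_metric hz hT (differentiableAt_const c)
  have h₀ : (fun z' ↦ fderiv ℝ ℓ z' c (fderiv ℝ (axisField f T b) z' a)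
      - fderiv ℝ (axisConormal ℓ T b) z' a (fderiv ℝ f z' c))
      =ᶠ[𝓝 z] fun z' ↦ -2 * μ * (conormalMetric f ℓ z' (T z') a * conormalMetric f ℓ z' (T z') c) := by
    filter_upwards [h.isOpen.mem_nhds hz] with z' hz'
    rw [h.axis_pairing hA hz']
    ring
  have h₁ := DFunLike.congr_fun (h₀.fderiv_eq (𝕜 := ℝ)) e
  have hθθ : DifferentiableAt ℝ
      (fun z' ↦ conormalMetric f ℓ z' (T z') a * conormalMetric f ℓ z' (T z') c) z :=
    (hθ a).mul (hθ c)
  have d {G : Type _} [NormedAddCommGroup G] [NormedSpace ℝ G] {g : E → E →L[ℝ] G}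
      (hg : DifferentiableAt ℝ g z) (a : E) : DifferentiableAt ℝ (fun z' ↦ g z' a) z :=
    hg.clm_apply (differentiableAt_const a)
  rw [fderiv_fun_sub ((d hℓ c).clm_apply (d hσ a)) ((d hτ a).clm_apply (d hf c)),
    fderiv_clm_apply (d hℓ c) (d hσ a), fderiv_clm_apply (d hτ a) (d hf c),
    fderiv_clm_apply hℓ (differentiableAt_const c), fderiv_clm_apply hσ (differentiableAt_const a),
    fderiv_clm_apply hτ (differentiableAt_const a), fderiv_clm_apply hf (differentiableAt_const c),
    fderiv_const_mul hθθ, fderiv_fun_mul (hθ a) (hθ c)] at h₁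
  simp at h₁
  linear_combination h₁

/-- Here and in `fderiv_axisForm'` the derivative of `T` is traded for that of one axis field. The
sum of the two formulas expresses the derivative of `h(T, ·)` by the Levi-Civita derivative of `T`
and terms symmetric in the two arguments. -/
lemma fderiv_axisForm (h : IsCentroaffine Ω f ℓ κ) (hA : IsAxis Ω f ℓ T b μ) (hz : z ∈ Ω)
    (a c : E) : fderiv ℝ (fun z' ↦ conormalMetric f ℓ z' (T z') c) z a
      = -(fderiv ℝ (axisConormal ℓ T b) z a (fderiv ℝ f z c)) - b * conormalMetric f ℓ z a c
        - fderiv ℝ ℓ z (T z) (fderiv ℝ (fderiv ℝ f) z a c) := by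
  have hT := hA.differentiableAt h.isOpen hz
  rw [h.fderiv_metric hz hT (differentiableAt_const c), h.fderiv_axisConormal hz hT]
  simp [conormalMetric]
  ring

lemma fderiv_axisForm' (h : IsCentroaffine Ω f ℓ κ) (hA : IsAxis Ω f ℓ T b μ) (hz : z ∈ Ω)
    (a c : E) : fderiv ℝ (fun z' ↦ conormalMetric f ℓ z' (T z') c) z a
      = -(fderiv ℝ ℓ z c (fderiv ℝ (axisField f T b) z a)) + b * conormalMetric f ℓ z a c
        - fderiv ℝ (fderiv ℝ ℓ) z a c (fderiv ℝ f z (T z)) := by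
  have hT := hA.differentiableAt h.isOpen hz
  have h₀ : (fun z' ↦ conormalMetric f ℓ z' (T z') c)
      =ᶠ[𝓝 z] fun z' ↦ conormalMetric f ℓ z' c (T z') := by
    filter_upwards [h.isOpen.mem_nhds hz] with z' hz' using h.metric_symm hz' _ _
  rw [h₀.fderiv_eq, h.fderiv_metric hz (differentiableAt_const c) hT, h.fderiv_axisField hz hT,
    h.metric_symm hz a c]
  simp [conormalMetric]
  ring

/-- The axis fields are parallel up to a factor. -/
theorem fderiv_axis_eq [FiniteDimensional ℝ E] [FiniteDimensional ℝ F]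
    (h : IsCentroaffine Ω f ℓ κ) (hd : Module.finrank ℝ F = Module.finrank ℝ E + 1)
    (hA : IsAxis Ω f ℓ T b μ) (hκ : κ = -(b * μ)) (hbμ : μ ≠ b) (hz : z ∈ Ω) (a : E) :
    fderiv ℝ (axisField f T b) z a = (μ * conormalMetric f ℓ z (T z) a) • axisField f T b z ∧
    fderiv ℝ (axisConormal ℓ T b) z a
      = -(μ * conormalMetric f ℓ z (T z) a) • axisConormal ℓ T b z := by
  have hT := hA.differentiableAt h.isOpen hz
  set H := conormalMetric f ℓ z with hH
  set σ := axisField f T b with hσ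
  set τ := axisConormal ℓ T b with hτ
  have hn : -(b * μ) * ℓ z (f z) = 1 := hκ ▸ h.normal z hz
  -- The coefficient is the one that makes the difference tangent: `ℓ(D_a σ) = h(T, a)`, while `ℓ(σ)
  -- = -b ℓ(f) = 1 / μ`. Geometrically `P a` is the Levi-Civita derivative of `T` along `a`, so the
  -- aim is `P = 0`.
  have hP : ∀ a, ∃ x, fderiv ℝ σ z a - (μ * H (T z) a) • σ z = fderiv ℝ f z x := by
    intro a
    refine h.exists_fderiv_eq_of_conormal hd hz ?_
    have h₁ := h.metric_eq hz a (T z)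
    have h₂ := h.metric_symm hz a (T z)
    rw [hσ, h.fderiv_axisField hz hT, axisField]
    simp only [map_sub, map_add, map_smul, smul_eq_mul, h.tangent z hz, ← h₁, h₂, ← hH]
    linear_combination (-H (T z) a) * hn
  choose P hP using hP
  have hσD : ∀ a, fderiv ℝ σ z a = fderiv ℝ f z (P a) + (μ * H (T z) a) • σ z := fun a ↦
    sub_eq_iff_eq_add.1 (hP a)
  have hHs : ∀ a c, H a c = H c a := h.metric_symm hz
  have hℓf : ∀ a c, fderiv ℝ ℓ z a (fderiv ℝ f z c) = -H a c := fun a c ↦ by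
    rw [hH, conormalMetric, neg_neg]
  have hℓσ : ∀ c, fderiv ℝ ℓ z c (σ z) = -H (T z) c := fun c ↦ by
    rw [hσ, axisField, map_sub, hℓf, map_smul, h.fderiv_conormal_self hz, smul_zero, sub_zero, hHs]
  have hτf : ∀ c, τ z (fderiv ℝ f z c) = -H (T z) c := fun c ↦ by
    rw [hτ, axisConormal, add_apply, hℓf, smul_apply, h.tangent z hz, smul_zero, add_zero]
  -- The same `P` governs `τ`. On tangent vectors this is `axis_pairing`, and on the position vector
  -- it follows from `κ = -bμ`.
  have hPτ : ∀ a, fderiv ℝ τ z a + (μ * H (T z) a) • τ z = fderiv ℝ ℓ z (P a) := by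
    intro a
    refine h.functional_ext hd hz (fun c ↦ ?_) ?_
    · have h₁ := h.axis_pairing hA hz a c
      rw [← hσ, ← hτ, hσD, map_add, hℓf, map_smul, hℓσ, smul_eq_mul] at h₁
      rw [add_apply, smul_apply, hτf, hℓf, smul_eq_mul, hHs (P a)]
      linear_combination -h₁
    · rw [add_apply, smul_apply, h.fderiv_conormal_self hz, hτ, h.fderiv_axisConormal hz hT]
      simp only [axisConormal, add_apply, smul_apply, smul_eq_mul, h.fderiv_conormal_self hz,
        h.second_conormal_self hz, ← hH, hHs a]
      linear_combination (-H (T z) a) * hn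
  have hτD : ∀ a, fderiv ℝ τ z a = fderiv ℝ ℓ z (P a) - (μ * H (T z) a) • τ z := fun a ↦
    eq_sub_of_add_eq (hPτ a)
  -- `T` has unit length, so its derivative is orthogonal to it. In the present terms this is the
  -- constancy of `τ(σ) = -1 + b / μ`: the scalar multiples of `σ` and `τ` in the two derivatives
  -- compensate, and `P` contributes `-2 h(T, P a)`.
  have hTP : ∀ a, H (T z) (P a) = 0 := by
    intro a
    have h₀ : (fun z' ↦ τ z' (σ z')) =ᶠ[𝓝 z] fun _ ↦ -1 + b * μ⁻¹ := by
      filter_upwards [h.isOpen.mem_nhds hz] with z' hz'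
      have h₁ := hA.unit z' hz'
      have h₂ : -(b * μ) * ℓ z' (f z') = 1 := hκ ▸ h.normal z' hz'
      have hμ : μ ≠ 0 := by rintro rfl; simp at h₂
      rw [conormalMetric] at h₁
      simp only [hτ, hσ, axisConormal, axisField, add_apply, smul_apply, map_sub, map_smul,
        h.tangent z' hz', h.fderiv_conormal_self hz', smul_eq_mul]
      field_simp
      linear_combination (-μ) * h₁ + b * h₂
    have h₁ := DFunLike.congr_fun (h₀.fderiv_eq (𝕜 := ℝ)) a
    rw [fderiv_clm_apply ((h.contDiffAt_axisConormal hz hA.smooth).differentiableAt (by simp))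
      ((h.contDiffAt_axisField hz hA.smooth).differentiableAt (by simp))] at h₁
    simp only [fderiv_fun_const, add_apply, ContinuousLinearMap.comp_apply,
      ContinuousLinearMap.flip_apply, ← hσ, ← hτ, hσD, hτD, map_add, map_smul, hτf, hℓσ,
      sub_apply, smul_apply, smul_eq_mul, Pi.zero_apply, zero_apply] at h₁
    linarith
  have hθ : ∀ a c, 2 * fderiv ℝ (fun z' ↦ conormalMetric f ℓ z' (T z') c) z a
      = 2 * H (P a) c - fderiv ℝ (fderiv ℝ ℓ) z a c (fderiv ℝ f z (T z))
        - fderiv ℝ ℓ z (T z) (fderiv ℝ (fderiv ℝ f) z a c) := by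
    intro a c
    have h₁ := h.fderiv_axisForm hA hz a c
    have h₂ := h.fderiv_axisForm' hA hz a c
    rw [← hτ, hτD, sub_apply, smul_apply, hτf, hℓf, ← hH, smul_eq_mul] at h₁
    rw [← hσ, hσD, map_add, map_smul, hℓσ, hℓf, ← hH, smul_eq_mul, hHs c] at h₂
    linear_combination h₁ + h₂
  -- Differentiate `axis_pairing` along `e` and antisymmetrize in `a` and `e`. The second
  -- derivatives of `σ` and `τ` are symmetric and drop out, so only `P` undifferentiated remains.
  have key : ∀ a c e, conormalCubic f ℓ z e c (P a) - conormalCubic f ℓ z a c (P e)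
      - 2 * μ * (H (T z) a * H (P e) c - H (T z) e * H (P a) c)
      = 2 * μ * (H (P e) a - H (P a) e) * H (T z) c := by
    intro a c e
    have h₁ := h.axis_pairing_fderiv hA hz a c e
    have h₂ := h.axis_pairing_fderiv hA hz e c a
    have sσ := ((h.contDiffAt_axisField (b := b) hz hA.smooth).isSymmSndFDerivAt
      (by simpa using two_le_infty)).eq e a
    have sτ := ((h.contDiffAt_axisConormal (b := b) hz hA.smooth).isSymmSndFDerivAt
      (by simpa using two_le_infty)).eq e a
    have hℓℓσ : ∀ a c, fderiv ℝ (fderiv ℝ ℓ) z a c (σ z)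
        = fderiv ℝ (fderiv ℝ ℓ) z a c (fderiv ℝ f z (T z)) - b * H a c := fun a c ↦ by
      rw [hσ, axisField, map_sub, map_smul, h.second_conormal_self hz, smul_eq_mul]
    have hτff : ∀ a c, τ z (fderiv ℝ (fderiv ℝ f) z a c)
        = fderiv ℝ ℓ z (T z) (fderiv ℝ (fderiv ℝ f) z a c) + b * H a c := fun a c ↦ by
      rw [hτ, axisConormal, add_apply, smul_apply, ← h.metric_eq hz, smul_eq_mul]
    have e₁ := hθ e c
    have e₂ := hθ a c
    have e₃ := hθ e a
    have e₄ := hθ a e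
    rw [h.second_symm hz e a, h.second_conormal_symm hz e a] at e₃
    rw [← hσ, ← hτ, sσ, sτ, hσD, hτD, map_add, map_smul, hℓℓσ, sub_apply, smul_apply, hτff,
      smul_eq_mul, smul_eq_mul, ← hH] at h₁
    rw [← hσ, ← hτ, hσD, hτD, map_add, map_smul, hℓℓσ, sub_apply, smul_apply, hτff,
      smul_eq_mul, smul_eq_mul, ← hH] at h₂
    rw [conormalCubic, conormalCubic]
    linear_combination h₂ - h₁ + μ * H (T z) a * e₁ - μ * H (T z) e * e₂
      + μ * H (T z) c * (e₃ - e₄)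
  have hTT : H (T z) (T z) = 1 := hA.unit z hz
  -- With `c = T` the cubic form is known explicitly, and `P` is self-adjoint because `μ ≠ b`. This
  -- says that `h(T, ·)` is closed.
  have hself : ∀ a e, H e (P a) = H a (P e) := by
    intro a e
    have h₁ := key a (T z) e
    rw [h.cubic_symm_left hz, hA.cubic z hz, h.cubic_symm_left hz, hA.cubic z hz, ← hH, hTP, hTP,
      hHs (P e) (T z), hTP, hHs (P a) (T z), hTP, hTT, hHs (P e), hHs (P a)] at h₁
    have h₂ : (μ - b) * (H e (P a) - H a (P e)) = 0 := by linear_combination h₁ / 2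
    exact sub_eq_zero.1 ((mul_eq_zero.1 h₂).resolve_left (sub_ne_zero.2 hbμ))
  have hPT : P (T z) = 0 := by
    refine h.eq_zero_of_metric hz fun c ↦ ?_
    rw [← hH, hHs, hself, hTP]
  -- Since `P T = 0`, the choice `e = T` leaves `(μ - b) h(P a, c) = 0`.
  have hP0 : ∀ a, P a = 0 := by
    intro a
    refine h.eq_zero_of_metric hz fun c ↦ ?_
    have h₁ := key a c (T z)
    have h₀ : ∀ c, H 0 c = 0 := fun c ↦ by simp [hH, conormalMetric]
    have hC0 : conormalCubic f ℓ z a c 0 = 0 := by simp [conormalCubic]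
    rw [hA.cubic z hz, ← hH, hPT, hTP, hC0, h₀, h₀, hTT, hHs (P a) (T z), hTP, hHs c] at h₁
    have h₂ : (μ - b) * H (P a) c = 0 := by linear_combination h₁ / 2
    exact (mul_eq_zero.1 h₂).resolve_left (sub_ne_zero.2 hbμ)
  constructor
  · rw [hσD, hP0, map_zero, zero_add]
  · rw [hτD, hP0, map_zero, zero_sub]
    exact (neg_smul _ _).symm

end IsCentroaffine
end Rigidity

/-! ### Apolarity and the ratio of the eigenvalues -/

section Apolarity

/-- The derivative of the determinant at the identity is the trace. -/
lemma hasFDerivAt_det_of_eq_one {E : Type*} [NormedAddCommGroup E] [NormedSpace ℝ E] {k : ℕ}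
    {A : E → Matrix (Fin k) (Fin k) ℝ} {z : E}
    (hA : ∀ i j, DifferentiableAt ℝ (fun z' ↦ A z' i j) z) (hz : A z = 1) :
    HasFDerivAt (fun z' ↦ (A z').det) (∑ i, fderiv ℝ (fun z' ↦ A z' i i) z) z := by
  let D : ContinuousMultilinearMap ℝ (fun _ : Fin k ↦ Fin k → ℝ) ℝ :=
    { (Matrix.detRowAlternating (R := ℝ) (n := Fin k)).toMultilinearMap with
      cont := Continuous.matrix_det continuous_id }
  have hD (B : Matrix (Fin k) (Fin k) ℝ) : D B = B.det := rfl
  have hrow (i : Fin k) : HasFDerivAt (fun z' ↦ A z' i)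
      (ContinuousLinearMap.pi fun j ↦ fderiv ℝ (fun z' ↦ A z' i j) z) z :=
    hasFDerivAt_pi.2 fun j ↦ (hA i j).hasFDerivAt
  have h := HasFDerivAt.multilinear_comp D hrow
  refine h.congr_fderiv ?_
  ext a
  simp only [sum_apply]
  refine Finset.sum_congr rfl fun i _ ↦ ?_
  have : (Matrix.updateRow (A z) i fun j ↦ fderiv ℝ (fun z' ↦ A z' i j) z a).det
      = fderiv ℝ (fun z' ↦ A z' i i) z a := by
    rw [← Matrix.cramer_transpose_apply, hz, Matrix.transpose_one, Matrix.cramer_one]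
    rfl
  exact this

variable {E : Type*} [NormedAddCommGroup E] [NormedSpace ℝ E] {k : ℕ}
  {Ω : Set E} {f : E → Aff (k + 1)} {ℓ : E → Aff (k + 1) →L[ℝ] ℝ} {κ : ℝ} {z : E}

/-- The volume that a hypersurface with transversal field `κ f` induces is that of its metric. -/
def HasMetricVolume (Ω : Set E) (f : E → Aff (k + 1)) (ℓ : E → Aff (k + 1) →L[ℝ] ℝ)
    (κ : ℝ) : Prop :=
  ∀ z ∈ Ω, ∀ e : Fin k → E,
    (Matrix.of (Fin.snoc (α := fun _ ↦ Aff (k + 1)) (fun i ↦ fderiv ℝ f z (e i)) (κ • f z))).det ^ 2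
      = |(Matrix.of fun i j ↦ conormalMetric f ℓ z (e i) (e j)).det|

namespace IsCentroaffine

/-- Apolarity. -/
theorem sum_cubic_eq_zero (h : IsCentroaffine Ω f ℓ κ) (hvol : HasMetricVolume Ω f ℓ κ)
    (hz : z ∈ Ω) {e : Fin k → E}
    (he : ∀ i j, conormalMetric f ℓ z (e i) (e j) = if i = j then 1 else 0) (a : E) :
    ∑ i, conormalCubic f ℓ z a (e i) (e i) = 0 := by
  have hf := h.differentiableAt_fderiv hz
  -- The basis dual to the frame `(Df(e_i), κ f)` at the fixed point `z`. Pairing the moving frame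
  -- with it makes the matrix the identity at `z`, at the cost of the constant factor `Q`.
  let d : Fin (k + 1) → (Aff (k + 1) →L[ℝ] ℝ) :=
    Fin.snoc (α := fun _ ↦ Aff (k + 1) →L[ℝ] ℝ) (fun j ↦ -fderiv ℝ ℓ z (e j)) (ℓ z)
  let R : E → Fin (k + 1) → Aff (k + 1) := fun z' ↦
    Fin.snoc (α := fun _ ↦ Aff (k + 1)) (fun i ↦ fderiv ℝ f z' (e i)) (κ • f z')
  let N : E → Matrix (Fin (k + 1)) (Fin (k + 1)) ℝ := fun z' ↦ Matrix.of fun i j ↦ d j (R z' i)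
  let Q : Matrix (Fin (k + 1)) (Fin (k + 1)) ℝ := Matrix.of fun l j ↦ d j (Pi.single l 1)
  let G : E → Matrix (Fin k) (Fin k) ℝ := fun z' ↦
    Matrix.of fun i j ↦ conormalMetric f ℓ z' (e i) (e j)
  have hNQ : ∀ z', N z' = Matrix.of (R z') * Q := by
    intro z'
    ext i j
    simp only [N, Q, Matrix.mul_apply, Matrix.of_apply]
    have := LinearMap.pi_apply_eq_sum_univ (d j : Aff (k + 1) →ₗ[ℝ] ℝ) (R z' i)
    refine this.trans (Finset.sum_congr rfl fun l _ ↦ ?_)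
    rw [smul_eq_mul]
    have : (fun j ↦ if l = j then (1 : ℝ) else 0) = Pi.single l 1 := by
      ext j
      simp [Pi.single_apply, eq_comm]
    rw [this]
    rfl
  have hN1 : N z = 1 := by
    ext i j
    simp only [N, Matrix.of_apply, Matrix.one_apply]
    refine Fin.lastCases ?_ (fun i ↦ ?_) i <;> refine Fin.lastCases ?_ (fun j ↦ ?_) j
    · simpa [d, R] using h.normal z hz
    · simp [d, R, h.fderiv_conormal_self hz, Fin.ext_iff, (Fin.is_lt j).ne']
    · simp [d, R, h.tangent z hz, Fin.ext_iff, (Fin.is_lt i).ne]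
    · have := he j i
      rw [conormalMetric] at this
      simp [d, R, this, eq_comm]
  have hG1 : G z = 1 := by
    ext i j
    simp only [G, Matrix.of_apply, Matrix.one_apply, he]
  have hGd : ∀ i j, DifferentiableAt ℝ (fun z' ↦ G z' i j) z := fun i j ↦
    h.differentiableAt_metric hz (differentiableAt_const _) (differentiableAt_const _)
  have hRd : ∀ i, DifferentiableAt ℝ (fun z' ↦ R z' i) z := by
    intro i
    refine Fin.lastCases ?_ (fun i ↦ ?_) i
    · simpa [R] using (h.differentiableAt hz).const_smul κ
    · simpa [R] using hf.clm_apply (differentiableAt_const (e i))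
  have hNd : ∀ i j, DifferentiableAt ℝ (fun z' ↦ N z' i j) z := fun i j ↦
    (d j).differentiableAt.comp z (hRd i)
  have hdetG := hasFDerivAt_det_of_eq_one hGd hG1
  have hdetN := hasFDerivAt_det_of_eq_one hNd hN1
  have hQ : Q.det ^ 2 = 1 := by
    have h₁ : (Matrix.of (R z)).det ^ 2 = |(G z).det| := hvol z hz e
    rw [hG1, Matrix.det_one, abs_one] at h₁
    have h₂ : (N z).det = _ := congrArg Matrix.det (hNQ z)
    rw [hN1, Matrix.det_one, Matrix.det_mul] at h₂
    calc Q.det ^ 2 = ((Matrix.of (R z)).det * Q.det) ^ 2 := by rw [mul_pow, h₁, one_mul]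
      _ = 1 := by rw [← h₂, one_pow]
  -- Near `z` the absolute value in the volume condition can be dropped. Differentiating `(det N)² =
  -- det G` at `z` then compares two traces whose difference is the trace of the cubic form.
  have hpos : ∀ᶠ z' in 𝓝 z, 0 < (G z').det := by
    have h₀ : 0 < (G z).det := by rw [hG1, Matrix.det_one]; exact one_pos
    exact hdetG.continuousAt.eventually (lt_mem_nhds h₀)
  have heq : (fun z' ↦ (N z').det ^ 2) =ᶠ[𝓝 z] fun z' ↦ (G z').det := by
    filter_upwards [hpos, h.isOpen.mem_nhds hz] with z' h₁ hz'
    rw [hNQ, Matrix.det_mul, mul_pow, hQ, mul_one, ← abs_of_pos h₁]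
    exact hvol z' hz' e
  have h₁ := ((hdetN.pow 2).unique (hdetG.congr_of_eventuallyEq heq))
  have h₂ := DFunLike.congr_fun h₁ a
  have hlast : fderiv ℝ (fun z' ↦ N z' (Fin.last k) (Fin.last k)) z a = 0 := by
    have h₃ : (fun z' ↦ N z' (Fin.last k) (Fin.last k)) = fun z' ↦ ℓ z (κ • f z') := by
      ext z'
      simp [N, d, R]
    have h₄ : DifferentiableAt ℝ (fun z' ↦ κ • f z') z := (h.differentiableAt hz).const_smul κ
    rw [h₃, fderiv_clm_apply (differentiableAt_const _) h₄,
      fderiv_fun_const_smul (h.differentiableAt hz)]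
    simp [h.tangent z hz]
  have hNi : ∀ i, fderiv ℝ (fun z' ↦ N z' (Fin.castSucc i) (Fin.castSucc i)) z a
      = - fderiv ℝ ℓ z (e i) (fderiv ℝ (fderiv ℝ f) z a (e i)) := by
    intro i
    have h₃ : (fun z' ↦ N z' (Fin.castSucc i) (Fin.castSucc i))
        = fun z' ↦ (-fderiv ℝ ℓ z (e i)) (fderiv ℝ f z' (e i)) := by
      ext z'
      simp [N, d, R]
    rw [h₃, fderiv_clm_apply (differentiableAt_const _)
      (hf.clm_apply (differentiableAt_const (e i))),
      fderiv_clm_apply hf (differentiableAt_const (e i))]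
    simp
  have hGi : ∀ i, fderiv ℝ (fun z' ↦ G z' i i) z a
      = - fderiv ℝ (fderiv ℝ ℓ) z a (e i) (fderiv ℝ f z (e i))
        - fderiv ℝ ℓ z (e i) (fderiv ℝ (fderiv ℝ f) z a (e i)) := by
    intro i
    refine (h.fderiv_metric hz (differentiableAt_const (e i)) (differentiableAt_const (e i)) a).trans
      ?_
    simp [conormalMetric]
  have hNsum : ∑ i, fderiv ℝ (fun z' ↦ N z' i i) z a
      = ∑ i, -fderiv ℝ ℓ z (e i) (fderiv ℝ (fderiv ℝ f) z a (e i)) := by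
    rw [Fin.sum_univ_castSucc]
    exact (congrArg₂ (· + ·) (Finset.sum_congr rfl fun i _ ↦ hNi i) hlast).trans (add_zero _)
  rw [hN1, Matrix.det_one, smul_apply, sum_apply, sum_apply, hNsum] at h₂
  have h₃ := h₂.trans (Finset.sum_congr rfl fun i _ ↦ hGi i)
  simp only [conormalCubic, Finset.sum_sub_distrib, Finset.sum_neg_distrib] at h₃ ⊢
  norm_num at h₃
  linarith

lemma exists_orthonormal [FiniteDimensional ℝ E] (h : IsCentroaffine Ω f ℓ κ) (hz : z ∈ Ω)
    (hk : Module.finrank ℝ E = k) : ∃ e : Fin k → E,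
    (∀ i j, conormalMetric f ℓ z (e i) (e j) = if i = j then 1 else 0) ∧
    ∀ x, ∑ i, conormalMetric f ℓ z x (e i) ^ 2 = conormalMetric f ℓ z x x := by
  subst hk
  let B : LinearMap.BilinForm ℝ E := LinearMap.mk₂ ℝ (conormalMetric f ℓ z)
    (metric_add_left z) (metric_smul_left z) (metric_add_right z) (metric_smul_right z)
  have hB : ∀ x y, B x y = conormalMetric f ℓ z x y := fun x y ↦ rfl
  obtain ⟨v, hv⟩ := LinearMap.BilinForm.exists_orthogonal_basis (B := B)
    ⟨fun x y ↦ h.metric_symm hz x y⟩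
  have hv' : ∀ i j, i ≠ j → B (v i) (v j) = 0 := fun i j hij ↦ hv hij
  have hpos : ∀ i, 0 < B (v i) (v i) := fun i ↦ h.pos z hz _ (v.ne_zero i)
  have hsq : ∀ i, (√(B (v i) (v i))) ≠ 0 := fun i ↦ (Real.sqrt_pos.2 (hpos i)).ne'
  refine ⟨fun i ↦ (√(B (v i) (v i)))⁻¹ • v i, fun i j ↦ ?_, fun x ↦ ?_⟩
  · rw [metric_smul_left, metric_smul_right, ← hB]
    split_ifs with hij
    · subst hij
      field_simp
      rw [Real.sq_sqrt (hpos i).le, div_self (hpos i).ne']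
    · rw [hv' i j hij, mul_zero, mul_zero]
  · have hx : ∀ i, B x (v i) = v.repr x i * B (v i) (v i) := by
      intro i
      conv_lhs => rw [← v.sum_repr x]
      rw [map_sum, LinearMap.sum_apply, Finset.sum_eq_single i]
      · simp
      · intro j _ hj
        simp [hv' j i hj]
      · simp
    have hxx : B x x = ∑ i, v.repr x i * B x (v i) := by
      conv_lhs => rw [← v.sum_repr x, map_sum]
      simp [v.sum_repr x]
    rw [← hB, hxx]
    refine Finset.sum_congr rfl fun i _ ↦ ?_
    rw [metric_smul_right, ← hB, mul_pow, inv_pow, Real.sq_sqrt (hpos i).le, hx]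
    have := (hpos i).ne'
    field_simp

/-- Apolarity determines the ratio of the two eigenvalues. -/
theorem eigenvalue_eq [FiniteDimensional ℝ E] (h : IsCentroaffine Ω f ℓ κ)
    (hvol : HasMetricVolume Ω f ℓ κ) (hz : z ∈ Ω) (hk : Module.finrank ℝ E = k) {x : E} {b μ : ℝ}
    (hx : conormalMetric f ℓ z x x = 1)
    (hc : ∀ a c, conormalCubic f ℓ z x a c = -2 * (b * conormalMetric f ℓ z a c
      + μ * conormalMetric f ℓ z x a * conormalMetric f ℓ z x c)) : μ = -(k * b) := by
  obtain ⟨e, he, hp⟩ := h.exists_orthonormal hz hk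
  have h₁ := h.sum_cubic_eq_zero hvol hz he x
  have h₂ : ∑ i, conormalCubic f ℓ z x (e i) (e i)
      = ∑ i, -2 * (b * 1 + μ * conormalMetric f ℓ z x (e i) ^ 2) :=
    Finset.sum_congr rfl fun i _ ↦ by rw [hc, he, if_pos rfl]; ring
  rw [h₁, ← Finset.mul_sum, Finset.sum_add_distrib, ← Finset.mul_sum,
    ← Finset.mul_sum, hp, hx] at h₂
  simp at h₂
  linarith

end IsCentroaffine
end Apolarity

/-! ### Integration along the axis -/

section Potential

namespace IsCentroaffine

variable {E F : Type*} [NormedAddCommGroup E] [NormedSpace ℝ E]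
  [NormedAddCommGroup F] [NormedSpace ℝ F]
  {Ω : Set E} {f : E → F} {ℓ : E → F →L[ℝ] ℝ} {κ : ℝ} {z z₀ : E} {T : E → E} {b μ : ℝ}

lemma axisConormal_axisField (h : IsCentroaffine Ω f ℓ κ) (hA : IsAxis Ω f ℓ T b μ)
    (hκ : κ = -(b * μ)) (hz : z ∈ Ω) :
    μ * axisConormal ℓ T b z (axisField f T b z) = b - μ := by
  have h₁ := hA.unit z hz
  have h₂ : -(b * μ) * ℓ z (f z) = 1 := hκ ▸ h.normal z hz
  rw [conormalMetric] at h₁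
  simp only [axisConormal, axisField, add_apply, smul_apply, map_sub, map_smul,
    h.tangent z hz, h.fderiv_conormal_self hz, smul_eq_mul]
  linear_combination (-μ) * h₁ + b * h₂

lemma axisConormal_self (h : IsCentroaffine Ω f ℓ κ) (hκ : κ = -(b * μ)) (hz : z ∈ Ω) :
    μ * axisConormal ℓ T b z (f z) = -1 := by
  have h₂ : -(b * μ) * ℓ z (f z) = 1 := hκ ▸ h.normal z hz
  simp only [axisConormal, add_apply, smul_apply, h.fderiv_conormal_self hz, smul_eq_mul]
  linear_combination -h₂

/-- The product `e^{-ct} g` has zero derivative on a connected open set. -/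
lemma eqOn_exp_smul_of_fderiv {G : Type*} [NormedAddCommGroup G] [NormedSpace ℝ G] {U : Set E}
    (hU : IsOpen U) (hconv : Convex ℝ U) {g : E → G} {t : E → ℝ} (hz₀ : z₀ ∈ U) (ht₀ : t z₀ = 0)
    (hg : DifferentiableOn ℝ g U) (ht : DifferentiableOn ℝ t U) {c : ℝ}
    (hgt : ∀ z ∈ U, ∀ a, fderiv ℝ g z a = (c * fderiv ℝ t z a) • g z) :
    ∀ z ∈ U, g z = Real.exp (c * t z) • g z₀ := by
  have hd : ∀ z ∈ U, HasFDerivAt (fun z ↦ Real.exp (-(c * t z)) • g z) (0 : E →L[ℝ] G) z := by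
    intro z hz
    have h₁ := ((ht.differentiableAt (hU.mem_nhds hz)).hasFDerivAt.const_mul c).neg.exp
    have h₂ := (hg.differentiableAt (hU.mem_nhds hz)).hasFDerivAt
    refine (h₁.smul h₂).congr_fderiv ?_
    ext a
    simp only [add_apply, smul_apply, hgt z hz a, ContinuousLinearMap.smulRight_apply, neg_apply,
      smul_smul, smul_eq_mul, Pi.neg_apply, zero_apply, ← add_smul]
    convert zero_smul ℝ (g z)
    ring
  have hconst : ∀ z ∈ U, Real.exp (-(c * t z)) • g z = Real.exp (-(c * t z₀)) • g z₀ := by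
    intro z hz
    refine hU.is_const_of_fderiv_eq_zero (𝕜 := ℝ) hconv.isPreconnected
      (fun z hz ↦ (hd z hz).differentiableAt.differentiableWithinAt)
      (fun z hz ↦ (hd z hz).fderiv) hz hz₀
  intro z hz
  have h₁ := congrArg (fun x ↦ Real.exp (c * t z) • x) (hconst z hz)
  simpa [smul_smul, ← Real.exp_add, ht₀] using h₁

theorem exists_potential [FiniteDimensional ℝ E] [FiniteDimensional ℝ F]
    (h : IsCentroaffine Ω f ℓ κ) (hd : Module.finrank ℝ F = Module.finrank ℝ E + 1)
    (hA : IsAxis Ω f ℓ T b μ) (hκ : κ = -(b * μ)) (hbμ : μ ≠ b) (hz₀ : z₀ ∈ Ω) :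
    ∃ U ⊆ Ω, IsOpen U ∧ Convex ℝ U ∧ z₀ ∈ U ∧ ∃ t : E → ℝ, t z₀ = 0 ∧ ContDiffOn ℝ ∞ t U ∧
      (∀ z ∈ U, ∀ a, fderiv ℝ t z a = conormalMetric f ℓ z (T z) a) ∧
      (∀ z ∈ U, axisField f T b z = Real.exp (μ * t z) • axisField f T b z₀) ∧
      (∀ z ∈ U, axisConormal ℓ T b z = Real.exp (-(μ * t z)) • axisConormal ℓ T b z₀) := by
  have hμ : μ ≠ 0 := by
    rintro rfl
    simpa [hκ] using h.normal z₀ hz₀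
  set σ := axisField f T b with hσ
  set τ := axisConormal ℓ T b with hτ
  have hστ : τ z₀ (σ z₀) ≠ 0 := by
    intro h0
    have := h.axisConormal_axisField hA hκ hz₀
    rw [← hσ, ← hτ, h0, mul_zero] at this
    exact hbμ (sub_eq_zero.1 this.symm).symm
  have hσs : ContDiffOn ℝ ∞ σ Ω := fun z hz ↦
    (h.contDiffAt_axisField hz hA.smooth).contDiffWithinAt
  have hτs : ContDiffOn ℝ ∞ τ Ω := fun z hz ↦
    (h.contDiffAt_axisConormal hz hA.smooth).contDiffWithinAt
  -- Any functional that does not vanish at `σ z₀` makes the parallel field scalar: `Dσ = μ h(T, ·)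
  -- σ` becomes `d log g = μ h(T, ·)`. This yields the potential of `h(T, ·)` without a Poincaré
  -- lemma.
  let g : E → ℝ := fun z ↦ (τ z₀ (σ z₀))⁻¹ * τ z₀ (σ z)
  have hgs : ContDiffOn ℝ ∞ g Ω := contDiffOn_const.mul ((τ z₀).contDiff.comp_contDiffOn hσs)
  have hg₀ : g z₀ = 1 := inv_mul_cancel₀ hστ
  have hpos : ∀ᶠ z in 𝓝 z₀, z ∈ Ω ∧ 0 < g z := by
    have : 0 < g z₀ := by rw [hg₀]; exact one_pos
    exact Filter.Eventually.and (h.isOpen.mem_nhds hz₀)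
      ((hgs.continuousOn.continuousAt (h.isOpen.mem_nhds hz₀)).eventually (lt_mem_nhds this))
  obtain ⟨r, hr, hball⟩ := Metric.eventually_nhds_iff_ball.1 hpos
  have hUΩ : Metric.ball z₀ r ⊆ Ω := fun z hz ↦ (hball z hz).1
  let t : E → ℝ := fun z ↦ μ⁻¹ * Real.log (g z)
  have hts : ContDiffOn ℝ ∞ t (Metric.ball z₀ r) :=
    contDiffOn_const.mul ((hgs.mono hUΩ).log fun z hz ↦ (hball z hz).2.ne')
  have ht : ∀ z ∈ Metric.ball z₀ r, ∀ a, fderiv ℝ t z a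
      = conormalMetric f ℓ z (T z) a := by
    intro z hz a
    have hσd : DifferentiableAt ℝ σ z :=
      (h.contDiffAt_axisField (hUΩ hz) hA.smooth).differentiableAt (by simp)
    have h₁ : HasFDerivAt g ((τ z₀ (σ z₀))⁻¹ • (τ z₀ ∘L fderiv ℝ σ z)) z :=
      ((τ z₀).hasFDerivAt.comp z hσd.hasFDerivAt).const_mul _
    have h₂ := (h₁.log (hball z hz).2.ne').const_mul μ⁻¹
    rw [h₂.fderiv]
    have h₃ := (h.fderiv_axis_eq hd hA hκ hbμ (hUΩ hz) a).1
    rw [← hσ] at h₃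
    have h₄ := (hball z hz).2.ne'
    simp only [smul_apply, ContinuousLinearMap.comp_apply, h₃, map_smul, smul_eq_mul]
    rw [show g z = (τ z₀ (σ z₀))⁻¹ * τ z₀ (σ z) from rfl] at h₄ ⊢
    have h₅ := right_ne_zero_of_mul h₄
    field_simp
  have ht₀ : t z₀ = 0 := by simp only [t, hg₀, Real.log_one, mul_zero]
  refine ⟨Metric.ball z₀ r, hUΩ, Metric.isOpen_ball, convex_ball _ _, Metric.mem_ball_self hr,
    t, ht₀, hts, ht, ?_, ?_⟩
  · refine eqOn_exp_smul_of_fderiv Metric.isOpen_ball (convex_ball _ _) (Metric.mem_ball_self hr)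
      ht₀ ((hσs.mono hUΩ).differentiableOn (by simp)) (hts.differentiableOn (by simp)) ?_
    intro z hz a
    rw [ht z hz]
    exact (h.fderiv_axis_eq hd hA hκ hbμ (hUΩ hz) a).1
  · have := eqOn_exp_smul_of_fderiv (c := -μ) Metric.isOpen_ball (convex_ball _ _)
      (Metric.mem_ball_self hr) ht₀ ((hτs.mono hUΩ).differentiableOn (by simp))
      (hts.differentiableOn (by simp)) ?_
    · intro z hz
      rw [this z hz, neg_mul]
    · intro z hz a
      rw [ht z hz, neg_mul]
      exact (h.fderiv_axis_eq hd hA hκ hbμ (hUΩ hz) a).2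

end IsCentroaffine
end Potential

/-! ### Coordinates adapted to the axis -/

section Straightening

/-- Near `z₀`, the functions `s t` and `χ` have coordinates in which `s t` is the first one, and
`χ` does not depend on it. -/
theorem exists_straightening {m : ℕ} {F : Type*} [NormedAddCommGroup F] [NormedSpace ℝ F]
    [FiniteDimensional ℝ F] {U : Set (Model (m + 1))} (hU : IsOpen U) {t : Model (m + 1) → ℝ}
    {χ : Model (m + 1) → F} {T : Model (m + 1) → Model (m + 1)}
    (ht : ContDiffOn ℝ ∞ t U) (hχ : ContDiffOn ℝ ∞ χ U)
    (htT : ∀ z ∈ U, fderiv ℝ t z (T z) = 1) (hχT : ∀ z ∈ U, fderiv ℝ χ z (T z) = 0)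
    (hker : ∀ z ∈ U, ∀ a, fderiv ℝ t z a = 0 → fderiv ℝ χ z a = 0 → a = 0)
    {z₀ : Model (m + 1)} (hz₀ : z₀ ∈ U) (ht₀ : t z₀ = 0) {s : ℝ} (hs : s ≠ 0) :
    ∃ (ε : ℝ) (Q : Opens (Model m)) (e : OpenPartialHomeomorph (Model (m + 1)) (ℝ × Model m)),
      0 < ε ∧ z₀ ∈ e.source ∧ e.source ⊆ U ∧ e.target = Set.Ioo (-ε) ε ×ˢ (Q : Set (Model m)) ∧
      ContDiffOn ℝ ∞ e e.source ∧ ContDiffOn ℝ ∞ e.symm e.target ∧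
      (∀ p ∈ e.target, s * t (e.symm p) = p.1) ∧
      (∀ p ∈ e.target, χ (e.symm p) = χ (e.symm (0, p.2))) := by
  have htd : ∀ z ∈ U, DifferentiableAt ℝ t z := fun z hz ↦
    (ht.contDiffAt (hU.mem_nhds hz)).differentiableAt (by simp)
  have hχd : ∀ z ∈ U, DifferentiableAt ℝ χ z := fun z hz ↦
    (hχ.contDiffAt (hU.mem_nhds hz)).differentiableAt (by simp)
  let K : Model (m + 1) →ₗ[ℝ] F := (fderiv ℝ χ z₀ : Model (m + 1) →ₗ[ℝ] F)
  have hKker : Module.finrank ℝ (LinearMap.ker K) = 1 := by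
    have hT0 : T z₀ ≠ 0 := by
      intro h0
      have := htT z₀ hz₀
      simp [h0] at this
    refine finrank_eq_one_iff'.2 ⟨⟨T z₀, hχT z₀ hz₀⟩, fun h0 ↦ hT0 (congrArg Subtype.val h0), ?_⟩
    rintro ⟨a, ha⟩
    refine ⟨fderiv ℝ t z₀ a, Subtype.ext ?_⟩
    change fderiv ℝ t z₀ a • T z₀ = a
    refine (sub_eq_zero.1 (hker z₀ hz₀ _ ?_ ?_)).symm
    · rw [map_sub, map_smul, htT z₀ hz₀]
      simp
    · rw [map_sub, map_smul, hχT z₀ hz₀, smul_zero, sub_zero]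
      exact ha
  have hKrange : Module.finrank ℝ (LinearMap.range K) = Module.finrank ℝ (Model m) := by
    have := LinearMap.finrank_range_add_finrank_ker K
    rw [hKker] at this
    simpa using this
  let J : LinearMap.range K ≃ₗ[ℝ] Model m := LinearEquiv.ofFinrankEq _ _ hKrange
  -- The kernel of `dχ` at `z₀` is the line of `T`, so its image has dimension `m`. A functional
  -- identification of this image with `ℝ^m` extends to the whole space, and `L ∘ χ` supplies the
  -- remaining `m` coordinates.
  obtain ⟨L₀, hL₀⟩ := LinearMap.exists_extend (J : LinearMap.range K →ₗ[ℝ] Model m)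
  let L : F →L[ℝ] Model m := LinearMap.toContinuousLinearMap L₀
  have hL : ∀ a, L (fderiv ℝ χ z₀ a) = 0 → fderiv ℝ χ z₀ a = 0 := by
    intro a ha
    have h₁ : J ⟨K a, LinearMap.mem_range_self K a⟩ = 0 :=
      (LinearMap.congr_fun hL₀ ⟨K a, LinearMap.mem_range_self K a⟩).symm.trans ha
    exact congrArg Subtype.val (J.map_eq_zero_iff.1 h₁)
  let G : Model (m + 1) → ℝ × Model m := fun z ↦ (s * t z, L (χ z))
  have hG : ContDiffOn ℝ ∞ G U :=
    (contDiffOn_const.mul ht).prodMk (L.contDiff.comp_contDiffOn hχ)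
  have hGd : ∀ z ∈ U, ∀ a, fderiv ℝ G z a = (s * fderiv ℝ t z a, L (fderiv ℝ χ z a)) := by
    intro z hz a
    have h₁ : HasFDerivAt G ((s • fderiv ℝ t z).prod (L ∘L fderiv ℝ χ z)) z :=
      ((htd z hz).hasFDerivAt.const_mul s).prodMk (L.hasFDerivAt.comp z (hχd z hz).hasFDerivAt)
    rw [h₁.fderiv]
    rfl
  have hGat : ContDiffAt ℝ ∞ G z₀ := hG.contDiffAt (hU.mem_nhds hz₀)
  obtain ⟨G₀, hG₀⟩ : (fderiv ℝ G z₀).IsInvertible := by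
    refine isInvertible_of_injective _ (fun a ha ↦ ?_) (by simp [add_comm])
    rw [hGd z₀ hz₀] at ha
    obtain ⟨h₁, h₂⟩ := Prod.mk_eq_zero.1 ha
    exact hker z₀ hz₀ a ((mul_eq_zero.1 h₁).resolve_left hs) (hL a h₂)
  have hG' : HasFDerivAt G (G₀ : Model (m + 1) →L[ℝ] ℝ × Model m) z₀ := by
    rw [hG₀]
    exact (hGat.differentiableAt (by simp)).hasFDerivAt
  let e₀ := hGat.toOpenPartialHomeomorph G hG' (by simp)
  have he₀ : ∀ z, e₀ z = G z := fun z ↦ rfl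
  have hz₀e : z₀ ∈ e₀.source := hGat.mem_toOpenPartialHomeomorph_source hG' (by simp)
  -- Invertibility of the derivative on a whole neighbourhood makes the inverse smooth at every
  -- point of the box, not only at the image of `z₀`.
  obtain ⟨V, hVsub, hVopen, hzV⟩ : ∃ V ⊆ {z | z ∈ U ∧ (fderiv ℝ G z).IsInvertible},
      IsOpen V ∧ z₀ ∈ V := by
    have h₁ : ContinuousAt (fderiv ℝ G) z₀ :=
      (hGat.fderiv_right (m := 0) (by simp)).continuousAt
    have h₂ : fderiv ℝ G ⁻¹' Set.range ((↑) : (Model (m + 1) ≃L[ℝ] ℝ × Model m) →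
        Model (m + 1) →L[ℝ] ℝ × Model m) ∈ 𝓝 z₀ := by
      refine h₁.preimage_mem_nhds ?_
      rw [← hG₀]
      exact G₀.nhds
    exact mem_nhds_iff.1 (Filter.inter_mem (hU.mem_nhds hz₀) h₂)
  let e₁ := e₀.restrOpen V hVopen
  have he₁ : e₁.source = e₀.source ∩ V := rfl
  have hGz₀ : G z₀ ∈ e₁.target := e₁.map_source (x := z₀) ⟨hz₀e, hzV⟩
  obtain ⟨ε, hε, hbox⟩ := Metric.isOpen_iff.1 e₁.open_target _ hGz₀
  have hG₀₀ : G z₀ = (0, (G z₀).2) := Prod.ext (by simp [G, ht₀]) rfl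
  rw [hG₀₀, ← ball_prod_same, Real.ball_eq_Ioo, zero_sub, zero_add] at hbox
  let Q : Opens (Model m) := ⟨Metric.ball (G z₀).2 ε, Metric.isOpen_ball⟩
  have hboxo : IsOpen (Set.Ioo (-ε) ε ×ˢ (Q : Set (Model m))) := isOpen_Ioo.prod Q.isOpen
  let e := (e₁.symm.restrOpen _ hboxo).symm
  have het : e.target = Set.Ioo (-ε) ε ×ˢ (Q : Set (Model m)) :=
    Set.inter_eq_right.2 hbox
  have hee : ∀ z, e z = G z := fun z ↦ rfl
  have hes : ∀ p, e.symm p = e₁.symm p := fun p ↦ rfl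
  have hsV : ∀ p ∈ e.target, e.symm p ∈ V := fun p hp ↦
    (e₁.map_target (hbox (het ▸ hp))).2
  have hsrc : e.source ⊆ V := fun z hz ↦ by
    have := hsV _ (e.map_source hz)
    rwa [e.left_inv hz] at this
  have hsU : e.source ⊆ U := fun z hz ↦ (hVsub (hsrc hz)).1
  have hsmooth : ContDiffOn ℝ ∞ e e.source := hG.mono hsU
  have hsymm : ContDiffOn ℝ ∞ e.symm e.target := by
    intro p hp
    obtain ⟨hpU, G₁, hG₁⟩ := hVsub (hsV p hp)
    have h₁ := hG.contDiffAt (hU.mem_nhds hpU)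
    refine (e.contDiffAt_symm (f₀' := G₁) hp ?_ h₁).contDiffWithinAt
    rw [hG₁]
    exact (h₁.differentiableAt (by simp)).hasFDerivAt
  have hright : ∀ p ∈ e.target, G (e.symm p) = p := fun p hp ↦ e.right_inv hp
  refine ⟨ε, Q, e, hε, ?_, hsU, het, hsmooth, hsymm, fun p hp ↦ congrArg Prod.fst (hright p hp), ?_⟩
  · have h₁ : e.symm (G z₀) = z₀ := e₁.left_inv (x := z₀) ⟨hz₀e, hzV⟩
    rw [← h₁]
    refine e.map_target ?_
    rw [het]
    refine ⟨?_, Metric.mem_ball_self hε⟩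
    simp [G, ht₀, hε]
  · rintro ⟨u, q⟩ hp
    have hq : q ∈ Q := by rw [het] at hp; exact hp.2
    have hu : u ∈ Set.Ioo (-ε) ε := by rw [het] at hp; exact hp.1
    have hmem : ∀ v ∈ Set.Ioo (-ε) ε, (v, q) ∈ e.target := fun v hv ↦ by rw [het]; exact ⟨hv, hq⟩
    have hderiv : ∀ v ∈ Set.Ioo (-ε) ε, HasFDerivAt (fun v : ℝ ↦ χ (e.symm (v, q))) (0 : ℝ →L[ℝ] F)
        v := by
      intro v hv
      have hp := hmem v hv
      have hin : HasFDerivAt (fun v : ℝ ↦ (v, q)) (ContinuousLinearMap.inl ℝ ℝ (Model m)) v :=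
        hasFDerivAt_prodMk_left v q
      have h₁ : HasFDerivAt (fun v : ℝ ↦ e.symm (v, q))
          (fderiv ℝ e.symm (v, q) ∘L ContinuousLinearMap.inl ℝ ℝ (Model m)) v :=
        HasFDerivAt.comp v ((hsymm.contDiffAt (e.open_target.mem_nhds hp)).differentiableAt
          (by simp)).hasFDerivAt hin
      set w := fderiv ℝ e.symm (v, q) (1, 0) with hw
      obtain ⟨hzU, hinv⟩ := hVsub (hsV _ hp)
      have h₂ : HasFDerivAt (fun v : ℝ ↦ G (e.symm (v, q)))
          (fderiv ℝ G (e.symm (v, q)) ∘L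
            (fderiv ℝ e.symm (v, q) ∘L ContinuousLinearMap.inl ℝ ℝ (Model m))) v :=
        HasFDerivAt.comp v ((hG.contDiffAt (hU.mem_nhds hzU)).differentiableAt
          (by simp)).hasFDerivAt h₁
      have h₃ : (fun v : ℝ ↦ G (e.symm (v, q))) =ᶠ[𝓝 v] fun v ↦ (v, q) := by
        filter_upwards [isOpen_Ioo.mem_nhds hv] with v' hv' using hright _ (hmem v' hv')
      have h₄ : fderiv ℝ G (e.symm (v, q)) w = (1, 0) :=
        DFunLike.congr_fun (h₂.unique (hin.congr_of_eventuallyEq h₃)) 1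
      have h₅ : fderiv ℝ G (e.symm (v, q)) (s⁻¹ • T (e.symm (v, q))) = (1, 0) := by
        rw [hGd _ hzU, map_smul, map_smul, htT _ hzU, hχT _ hzU]
        simp [hs]
      -- The first coordinate field is a multiple of `T`, along which `χ` does not change.
      have h₆ : w = s⁻¹ • T (e.symm (v, q)) := hinv.injective (h₄.trans h₅.symm)
      refine (HasFDerivAt.comp v (hχd _ hzU).hasFDerivAt h₁).congr_fderiv ?_
      ext
      change fderiv ℝ χ (e.symm (v, q)) w = 0
      rw [h₆, map_smul, hχT _ hzU, smul_zero]
    exact isOpen_Ioo.is_const_of_fderiv_eq_zero (𝕜 := ℝ) isPreconnected_Ioo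
      (fun v hv ↦ (hderiv v hv).differentiableAt.differentiableWithinAt)
      (fun v hv ↦ (hderiv v hv).fderiv) hu ⟨neg_lt_zero.2 hε, hε⟩

end Straightening

/-! ### Determinants of frames and adapted bases -/

section LinearAlgebra

lemma det_of_last_row {k : ℕ} (N : Matrix (Fin (k + 1)) (Fin (k + 1)) ℝ)
    (h : ∀ j : Fin k, N (Fin.last k) j.castSucc = 0) :
    N.det = N (Fin.last k) (Fin.last k) * (N.submatrix Fin.castSucc Fin.castSucc).det := by
  rw [Matrix.det_succ_row N (Fin.last k), Fin.sum_univ_castSucc,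
    Finset.sum_eq_zero fun j _ ↦ by rw [h]; ring, Fin.succAbove_last, zero_add,
    Fin.val_last, Even.neg_one_pow ⟨k, rfl⟩, one_mul]

lemma snoc_snoc_comp_swap {k : ℕ} {V : Type*} (X : Fin k → V) (u v : V) :
    (Fin.snoc (α := fun _ ↦ V) (Fin.snoc (α := fun _ ↦ V) X u) v : Fin (k + 2) → V)
      ∘ Equiv.swap (Fin.last k).castSucc (Fin.last (k + 1))
      = Fin.snoc (α := fun _ ↦ V) (Fin.snoc (α := fun _ ↦ V) X v) u := by
  have hne : ∀ i : Fin k, i.castSucc ≠ Fin.last k := fun i ↦ (Fin.castSucc_lt_last i).ne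
  have hne' : ∀ i : Fin (k + 1), i.castSucc ≠ Fin.last (k + 1) :=
    fun i ↦ (Fin.castSucc_lt_last i).ne
  funext i
  refine Fin.lastCases ?_ (fun i ↦ Fin.lastCases ?_ (fun i ↦ ?_) i) i
  · simp [Equiv.swap_apply_right]
  · simp [Equiv.swap_apply_left]
  · rw [Function.comp_apply, Equiv.swap_apply_of_ne_of_ne
      (fun h ↦ hne i (Fin.castSucc_injective _ h)) (hne' _)]
    simp

lemma det_snoc_snoc_swap {k : ℕ} (X : Fin k → Aff (k + 2)) (u v : Aff (k + 2)) :
    (Matrix.of (Fin.snoc (α := fun _ ↦ Aff (k + 2))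
      (Fin.snoc (α := fun _ ↦ Aff (k + 2)) X u) v)).det
      = -(Matrix.of (Fin.snoc (α := fun _ ↦ Aff (k + 2))
        (Fin.snoc (α := fun _ ↦ Aff (k + 2)) X v) u)).det := by
  have := (Matrix.detRowAlternating (n := Fin (k + 2)) (R := ℝ)).map_swap
    (Fin.snoc (α := fun _ ↦ Aff (k + 2)) (Fin.snoc (α := fun _ ↦ Aff (k + 2)) X v) u)
    (Fin.castSucc_lt_last (Fin.last k)).ne
  rw [snoc_snoc_comp_swap] at this
  exact this

lemma det_snoc_add_smul {k : ℕ} (X : Fin k → Aff (k + 1)) (u v : Aff (k + 1)) (α β : ℝ) :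
    (Matrix.of (Fin.snoc (α := fun _ ↦ Aff (k + 1)) X (α • u + β • v))).det
      = α * (Matrix.of (Fin.snoc (α := fun _ ↦ Aff (k + 1)) X u)).det
        + β * (Matrix.of (Fin.snoc (α := fun _ ↦ Aff (k + 1)) X v)).det := by
  have h₁ := (Matrix.detRowAlternating (n := Fin (k + 1)) (R := ℝ)).toMultilinearMap.snoc_add
    X (α • u) (β • v)
  have h₂ := (Matrix.detRowAlternating (n := Fin (k + 1)) (R := ℝ)).toMultilinearMap.snoc_smul
    X α u
  have h₃ := (Matrix.detRowAlternating (n := Fin (k + 1)) (R := ℝ)).toMultilinearMap.snoc_smul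
    X β v
  rw [h₂, h₃] at h₁
  exact h₁

lemma det_snoc_snoc_self {k : ℕ} (X : Fin k → Aff (k + 2)) (u : Aff (k + 2)) :
    (Matrix.of (Fin.snoc (α := fun _ ↦ Aff (k + 2))
      (Fin.snoc (α := fun _ ↦ Aff (k + 2)) X u) u)).det = 0 := by
  have := det_snoc_snoc_swap X u u
  linarith

/-- The two last rows of a determinant are replaced by linear combinations. -/
lemma det_snoc_snoc_combine {k : ℕ} (X : Fin k → Aff (k + 2)) (u v : Aff (k + 2))
    (α β γ δ : ℝ) :
    (Matrix.of (Fin.snoc (α := fun _ ↦ Aff (k + 2))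
      (Fin.snoc (α := fun _ ↦ Aff (k + 2)) X (α • u + β • v)) (γ • u + δ • v))).det
      = (α * δ - β * γ) * (Matrix.of (Fin.snoc (α := fun _ ↦ Aff (k + 2))
        (Fin.snoc (α := fun _ ↦ Aff (k + 2)) X u) v)).det := by
  rw [det_snoc_add_smul, det_snoc_snoc_swap _ _ u, det_snoc_snoc_swap _ _ v, det_snoc_add_smul,
    det_snoc_add_smul, det_snoc_snoc_self, det_snoc_snoc_self, det_snoc_snoc_swap _ v u]
  ring

lemma det_map {k : ℕ} (A : Aff k →ₗ[ℝ] Aff k) (X : Fin k → Aff k) :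
    (Matrix.of fun i ↦ A (X i)).det = LinearMap.det A * (Matrix.of X).det := by
  have := (Pi.basisFun ℝ (Fin k)).det_comp A X
  rw [Pi.basisFun_det] at this
  exact this

lemma comp_snoc {k : ℕ} {V W : Type*} (A : V → W) (X : Fin k → V) (u : V) :
    (fun i ↦ A (Fin.snoc (α := fun _ ↦ V) X u i))
      = (Fin.snoc (α := fun _ ↦ W) (fun i ↦ A (X i)) (A u) : Fin (k + 1) → W) :=
  Fin.comp_snoc (g := A) (q := X) (y := u)

/-- The inclusion of `ℝ^k` as the hyperplane on which the last coordinate vanishes. -/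
def snocZero (k : ℕ) : Aff k →ₗ[ℝ] Aff (k + 1) where
  toFun x := Fin.snoc (α := fun _ ↦ ℝ) x 0
  map_add' x y := by
    funext i
    refine Fin.lastCases ?_ (fun i ↦ ?_) i <;> simp
  map_smul' r x := by
    funext i
    refine Fin.lastCases ?_ (fun i ↦ ?_) i <;> simp

/-- The last coordinate vector. -/
def lastVec (k : ℕ) : Aff (k + 1) := Fin.snoc (α := fun _ ↦ ℝ) 0 1

lemma snoc_eq {k : ℕ} (x : Aff k) (y : ℝ) :
    (Fin.snoc (α := fun _ ↦ ℝ) x y : Aff (k + 1)) = snocZero k x + y • lastVec k := by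
  funext i
  refine Fin.lastCases ?_ (fun i ↦ ?_) i <;> simp [snocZero, lastVec]

lemma det_snocZero_lastVec {k : ℕ} (X : Fin k → Aff k) :
    (Matrix.of (Fin.snoc (α := fun _ ↦ Aff (k + 1)) (fun i ↦ snocZero k (X i)) (lastVec k))).det
      = (Matrix.of X).det := by
  rw [det_of_last_row]
  · simp only [Matrix.of_apply, Fin.snoc_last, lastVec, one_mul]
    congr 1
    ext i j
    simp [snocZero]
  · intro j
    simp [lastVec]

/-- A basis adapted to a hyperplane and a transversal vector, of determinant `1`. -/
lemma exists_adapted_equiv {k : ℕ} (hk : 1 ≤ k) {τ : Aff (k + 1) →ₗ[ℝ] ℝ} {v : Aff (k + 1)}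
    (hv : τ v ≠ 0) : ∃ (A : Aff (k + 1) ≃ₗ[ℝ] Aff (k + 1)) (d : ℝ), 0 < d ∧
      LinearMap.det (A : Aff (k + 1) →ₗ[ℝ] Aff (k + 1)) = 1 ∧ A (d • lastVec k) = v ∧
      ∀ x, τ (A (snocZero k x)) = 0 := by
  have hτ : τ ≠ 0 := by
    rintro rfl
    exact hv rfl
  have hfin : Module.finrank ℝ (LinearMap.ker τ) = k := by
    have h₁ := Module.Dual.finrank_ker_add_one_of_ne_zero hτ
    simpa using h₁
  let B : Module.Basis (Fin k) ℝ (LinearMap.ker τ) :=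
    Module.finBasisOfFinrankEq ℝ (LinearMap.ker τ) hfin
  let P : Aff (k + 1) →ₗ[ℝ] Aff k := LinearMap.funLeft ℝ ℝ Fin.castSucc
  let A₁ : Aff (k + 1) →ₗ[ℝ] Aff (k + 1) :=
    (LinearMap.ker τ).subtype ∘ₗ (B.equivFun.symm : Aff k →ₗ[ℝ] LinearMap.ker τ) ∘ₗ P
      + (LinearMap.proj (Fin.last k)).smulRight v
  have hA₁ : ∀ x, A₁ x = (B.equivFun.symm (P x) : Aff (k + 1)) + x (Fin.last k) • v :=
    fun x ↦ rfl
  have hinj : ∀ x, A₁ x = 0 → x = 0 := by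
    intro x hx
    have h₁ : τ (A₁ x) = 0 := by rw [hx, map_zero]
    rw [hA₁, map_add, map_smul, smul_eq_mul,
      show τ (B.equivFun.symm (P x) : Aff (k + 1)) = 0 from (B.equivFun.symm (P x)).2, zero_add]
      at h₁
    have h₂ := (mul_eq_zero.1 h₁).resolve_right hv
    rw [hA₁, h₂, zero_smul, add_zero] at hx
    have h₃ : P x = 0 := B.equivFun.symm.map_eq_zero_iff.1 (Subtype.ext hx)
    funext i
    refine Fin.lastCases h₂ (fun i ↦ congrFun h₃ i) i
  have hdet : LinearMap.det A₁ ≠ 0 := by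
    refine (LinearMap.isUnit_iff_isUnit_det A₁).1 ?_ |>.ne_zero
    exact (LinearMap.isUnit_iff_ker_eq_bot A₁).2 (LinearMap.ker_eq_bot'.2 hinj)
  -- The length `d` absorbs the modulus of the determinant: the factor `d⁻¹` on the last axis
  -- normalizes it and still sends `d` times the last vector to `v`. The sign is corrected on axis
  -- `0`, which is not the last one because `1 ≤ k`.
  set d := |LinearMap.det A₁| with hd
  have hdpos : 0 < d := abs_pos.2 hdet
  have hlast : (0 : Fin (k + 1)) ≠ Fin.last k := by
    intro h0
    have := congrArg Fin.val h0
    simp at this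
    omega
  let w : Aff (k + 1) := Function.update (Function.update 1 (Fin.last k) d⁻¹) 0
    (SignType.sign (LinearMap.det A₁) : ℝ)
  let R : Aff (k + 1) →ₗ[ℝ] Aff (k + 1) := Matrix.toLin' (Matrix.diagonal w)
  have hR : ∀ x i, R x i = w i * x i := fun x i ↦ by
    simp [R, Matrix.mulVec_diagonal]
  have hRdet : LinearMap.det R = SignType.sign (LinearMap.det A₁) * d⁻¹ := by
    rw [LinearMap.det_toLin', Matrix.det_diagonal, Finset.prod_update_of_mem (Finset.mem_univ _),
      Finset.prod_update_of_mem (by simp [hlast.symm])]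
    simp
  have hARdet : LinearMap.det (A₁ ∘ₗ R) = 1 := by
    rw [LinearMap.det_comp, hRdet, ← mul_assoc, self_mul_sign]
    exact mul_inv_cancel₀ hdpos.ne'
  have hARu : IsUnit (LinearMap.det (A₁ ∘ₗ R)) := by rw [hARdet]; exact isUnit_one
  have hwlast : w (Fin.last k) = d⁻¹ := by
    simp [w, Function.update_of_ne hlast.symm]
  refine ⟨LinearEquiv.ofIsUnitDet (v := Pi.basisFun ℝ (Fin (k + 1)))
    (v' := Pi.basisFun ℝ (Fin (k + 1))) (f := A₁ ∘ₗ R)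
    (by rwa [LinearMap.det_toMatrix]), d, hdpos, ?_, ?_, fun x ↦ ?_⟩
  · exact hARdet
  · change A₁ (R (d • lastVec k)) = v
    have h₁ : P (R (d • lastVec k)) = 0 := by
      funext i
      change R _ _ = 0
      rw [hR]
      simp [lastVec]
    rw [hA₁, h₁, map_zero, hR, hwlast]
    simp [lastVec, hdpos.ne']
  · change τ (A₁ (R (snocZero k x))) = 0
    rw [hA₁, hR]
    simp [snocZero]

end LinearAlgebra

/-! ### Splitting the position vector along the axis -/

section Cone

namespace IsCentroaffine

variable {E F : Type*} [NormedAddCommGroup E] [NormedSpace ℝ E]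
  [NormedAddCommGroup F] [NormedSpace ℝ F]
  {Ω : Set E} {f : E → F} {ℓ : E → F →L[ℝ] ℝ} {κ : ℝ} {z z₀ : E} {T : E → E} {b μ : ℝ}

/-- A hypersurface with an axis is `e^{bt} χ + e^{μt} v`, where `v` is constant, and `χ` lies in a
hyperplane and does not change along the axis. -/
theorem exists_cone [FiniteDimensional ℝ E] [FiniteDimensional ℝ F]
    (h : IsCentroaffine Ω f ℓ κ) (hd : Module.finrank ℝ F = Module.finrank ℝ E + 1)
    (hA : IsAxis Ω f ℓ T b μ) (hκ : κ = -(b * μ)) (hbμ : μ ≠ b) (hz₀ : z₀ ∈ Ω) :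
    ∃ U ⊆ Ω, IsOpen U ∧ z₀ ∈ U ∧ ∃ (t : E → ℝ) (χ : E → F) (τ₀ : F →L[ℝ] ℝ) (v : F),
      t z₀ = 0 ∧ ContDiffOn ℝ ∞ t U ∧ ContDiffOn ℝ ∞ χ U ∧ τ₀ v ≠ 0 ∧
      (∀ z ∈ U, ∀ a, fderiv ℝ t z a = conormalMetric f ℓ z (T z) a) ∧
      (∀ z ∈ U, ∀ a, fderiv ℝ χ z a = Real.exp (-(b * t z)) •
        (fderiv ℝ f z a - conormalMetric f ℓ z (T z) a • fderiv ℝ f z (T z))) ∧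
      (∀ z ∈ U, τ₀ (χ z) = 0) ∧
      (∀ z ∈ U, ℓ z (χ z) = Real.exp (-(b * t z)) * (b * (b - μ))⁻¹) ∧
      (∀ z ∈ U, f z = Real.exp (b * t z) • χ z + Real.exp (μ * t z) • v) ∧
      (∀ z ∈ U, fderiv ℝ f z (T z)
        = (b * Real.exp (b * t z)) • χ z + (μ * Real.exp (μ * t z)) • v) := by
  have hκ₀ : κ ≠ 0 := left_ne_zero_of_mul_eq_one (h.normal z₀ hz₀)
  have hb : b ≠ 0 := by
    rintro rfl
    simp [hκ] at hκ₀
  have hμ : μ ≠ 0 := by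
    rintro rfl
    simp [hκ] at hκ₀
  have hc : b - μ ≠ 0 := sub_ne_zero.2 hbμ.symm
  obtain ⟨U, hUΩ, hU, -, hzU, t, ht₀, hts, ht, hσ, hτ⟩ := h.exists_potential hd hA hκ hbμ hz₀
  set σ := axisField f T b with hσ_def
  set τ := axisConormal ℓ T b with hτ_def
  -- Along the axis `σ` grows like `e^{μt}`, while `D_T f = b f + σ`. Hence `f + σ / (b - μ)` is the
  -- part of `f` that grows like `e^{bt}`. The field `τ` annihilates it, since `μ τ(f) = -1` and `μ
  -- τ(σ) = b - μ`.
  let χ : E → F := fun z ↦ Real.exp (-(b * t z)) • (f z + (b - μ)⁻¹ • σ z)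
  have hχs : ContDiffOn ℝ ∞ χ U :=
    (contDiffOn_const.mul hts).neg.exp.smul ((h.smooth.mono hUΩ).add
      (contDiffOn_const.smul fun z hz ↦
        (h.contDiffAt_axisField (hUΩ hz) hA.smooth).contDiffWithinAt))
  have hfσ : ∀ z ∈ U, f z = Real.exp (b * t z) • χ z + Real.exp (μ * t z) • -((b - μ)⁻¹ • σ z₀) := by
    intro z hz
    simp only [χ, hσ z hz]
    rw [smul_smul (Real.exp _) (Real.exp _), ← Real.exp_add, add_neg_cancel, Real.exp_zero,
      one_smul, smul_neg, smul_comm (Real.exp (μ * t z)) (b - μ)⁻¹, add_neg_cancel_right]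
  refine ⟨U, hUΩ, hU, hzU, t, χ, τ z₀, -((b - μ)⁻¹ • σ z₀), ht₀, hts, hχs, ?_, ht, ?_, ?_, ?_,
    hfσ, ?_⟩
  · intro h0
    have h₁ := h.axisConormal_axisField hA hκ hz₀
    rw [map_neg, map_smul, neg_eq_zero, smul_eq_mul] at h0
    have h₂ := (mul_eq_zero.1 h0).resolve_left (inv_ne_zero hc)
    rw [← hσ_def, ← hτ_def, h₂, mul_zero] at h₁
    exact hc h₁.symm
  · intro z hz a
    have hσd : HasFDerivAt σ (fderiv ℝ σ z) z :=
      ((h.contDiffAt_axisField (hUΩ hz) hA.smooth).differentiableAt (by simp)).hasFDerivAt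
    have htd : HasFDerivAt t (fderiv ℝ t z) z :=
      ((hts.contDiffAt (hU.mem_nhds hz)).differentiableAt (by simp)).hasFDerivAt
    have hχd : HasFDerivAt χ _ z :=
      (htd.const_mul b).neg.exp.smul ((h.differentiableAt (hUΩ hz)).hasFDerivAt.add
        (hσd.const_smul (b - μ)⁻¹))
    rw [hχd.fderiv]
    have h₁ := (h.fderiv_axis_eq hd hA hκ hbμ (hUΩ hz) a).1
    rw [← hσ_def] at h₁
    have h₂ : fderiv ℝ f z (T z) = σ z + b • f z := (sub_add_cancel _ _).symm
    simp only [add_apply, smul_apply, ContinuousLinearMap.smulRight_apply, neg_apply,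
      Pi.neg_apply, smul_eq_mul, h₁, h₂, ht z hz]
    generalize conormalMetric f ℓ z (T z) a = θ
    generalize Real.exp (-(b * t z)) = r
    match_scalars <;> field_simp
    ring
  · intro z hz
    have h₁ := h.axisConormal_axisField hA hκ (hUΩ hz)
    have h₂ := h.axisConormal_self (T := T) hκ (hUΩ hz)
    rw [← hσ_def, ← hτ_def] at h₁
    rw [← hτ_def] at h₂
    have h₃ : τ z (f z + (b - μ)⁻¹ • σ z) = 0 := by
      rw [map_add, map_smul, smul_eq_mul]
      refine (mul_eq_zero.1 (?_ : μ * _ = 0)).resolve_left hμ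
      field_simp
      linear_combination (b - μ) * h₂ + h₁
    rw [hτ z hz, smul_apply, smul_eq_mul] at h₃
    simp only [χ, map_smul]
    rw [(mul_eq_zero.1 h₃).resolve_left (Real.exp_ne_zero _), smul_zero]
  · intro z hz
    have h₁ := h.normal z (hUΩ hz)
    have h₂ := h.tangent z (hUΩ hz) (T z)
    simp only [χ, map_smul, map_add, hσ_def, axisField, map_sub, h₂, smul_eq_mul]
    congr 1
    rw [hκ] at h₁
    field_simp
    linear_combination h₁
  · intro z hz
    have h₂ : fderiv ℝ f z (T z) = σ z + b • f z := (sub_add_cancel _ _).symm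
    rw [h₂, hσ z hz, hfσ z hz]
    generalize χ z = x
    generalize σ z₀ = y
    match_scalars <;> field_simp
    ring

end IsCentroaffine
end Cone

/-! ### The Calabi product -/

section Product

lemma det_snoc_smul {k : ℕ} (X : Fin k → Aff (k + 1)) (y : Aff (k + 1)) (r : ℝ) :
    (Matrix.of (Fin.snoc (α := fun _ ↦ Aff (k + 1)) (fun i ↦ r • X i) y)).det
      = r ^ k * (Matrix.of (Fin.snoc (α := fun _ ↦ Aff (k + 1)) X y)).det := by
  have h₁ := Matrix.det_mul_column (Fin.snoc (α := fun _ ↦ ℝ) (fun _ ↦ r) 1 : Fin (k + 1) → ℝ)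
    (Matrix.of (Fin.snoc (α := fun _ ↦ Aff (k + 1)) X y))
  rw [Fin.prod_univ_castSucc] at h₁
  simp only [Fin.snoc_castSucc, Fin.snoc_last, Finset.prod_const, Finset.card_univ,
    Fintype.card_fin, mul_one] at h₁
  rw [← h₁]
  congr 1
  ext i j
  refine Fin.lastCases ?_ (fun i ↦ ?_) i <;> simp

/-- The volume form of a hypersurface, evaluated on the frame `(w, T)`, where `T` points along
the axis. -/
lemma det_frame {m : ℕ} (A : Aff (m + 2) →ₗ[ℝ] Aff (m + 2)) (X : Fin m → Aff (m + 1))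
    (y : Aff (m + 1)) (r b μ d κ : ℝ) :
    (Matrix.of (Fin.snoc (α := fun _ ↦ Aff (m + 2)) (Fin.snoc (α := fun _ ↦ Aff (m + 2))
      (fun i ↦ A (snocZero (m + 1) (r • X i)))
      (A (b • snocZero (m + 1) (r • y) + μ • d • lastVec (m + 1))))
      (A (κ • (snocZero (m + 1) (r • y) + d • lastVec (m + 1)))))).det
    = LinearMap.det A * (κ * d * (b - μ) * r ^ (m + 1)
      * (Matrix.of (Fin.snoc (α := fun _ ↦ Aff (m + 1)) X y)).det) := by
  have h₁ := det_snoc_snoc_combine (fun i ↦ snocZero (m + 1) (r • X i)) (snocZero (m + 1) y)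
    (lastVec (m + 1)) (b * r) (μ * d) (κ * r) (κ * d)
  have h₂ : (Fin.snoc (α := fun _ ↦ Aff (m + 2)) (fun i ↦ snocZero (m + 1) (r • X i))
      (snocZero (m + 1) y) : Fin (m + 1) → Aff (m + 2))
      = fun i ↦ snocZero (m + 1) (Fin.snoc (α := fun _ ↦ Aff (m + 1)) (fun i ↦ r • X i) y i) :=
    (comp_snoc (snocZero (m + 1)) (fun i ↦ r • X i) y).symm
  rw [h₂, det_snocZero_lastVec, det_snoc_smul] at h₁
  rw [← comp_snoc A, ← comp_snoc A, det_map]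
  congr 1
  rw [show b • snocZero (m + 1) (r • y) + μ • d • lastVec (m + 1)
    = (b * r) • snocZero (m + 1) y + (μ * d) • lastVec (m + 1) by
      rw [map_smul, smul_smul, smul_smul],
    show κ • (snocZero (m + 1) (r • y) + d • lastVec (m + 1))
    = (κ * r) • snocZero (m + 1) y + (κ * d) • lastVec (m + 1) by
      rw [map_smul, smul_add, smul_smul, smul_smul], h₁]
  ring

/-- The Gram determinant of a frame `(w, T)` with `T` a unit normal to `w`. -/
lemma det_gram_snoc {V : Type*} {m : ℕ} (H : V → V → ℝ) (w : Fin m → V) (T : V)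
    (h₁ : H T T = 1) (h₂ : ∀ i, H T (w i) = 0) :
    (Matrix.of fun i j : Fin (m + 1) ↦ H (Fin.snoc (α := fun _ ↦ V) w T i)
      (Fin.snoc (α := fun _ ↦ V) w T j)).det = (Matrix.of fun i j ↦ H (w i) (w j)).det := by
  rw [det_of_last_row]
  · simp only [Matrix.of_apply, Fin.snoc_last, h₁, one_mul]
    congr 1
    ext i j
    simp
  · intro j
    simp [h₂]

variable {m : ℕ} {Ω : Set (Model (m + 1))} {f : Model (m + 1) → Aff (m + 2)}
  {ℓ : Model (m + 1) → Aff (m + 2) →L[ℝ] ℝ} {κ b μ : ℝ} {z₀ : Model (m + 1)}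
  {T : Model (m + 1) → Model (m + 1)}

/-- A hypersurface with an axis is a Calabi product, in suitable coordinates. -/
theorem exists_calabi_coordinates (h : IsCentroaffine Ω f ℓ κ)
    (hvol : HasMetricVolume Ω f ℓ κ) (hA : IsCentroaffine.IsAxis Ω f ℓ T b μ)
    (hμ : μ = -((m + 1 : ℕ) * b)) (hκ : κ = -(b * μ)) (hz₀ : z₀ ∈ Ω) :
    ∃ (ε : ℝ) (Q : Opens (Model m)) (e : OpenPartialHomeomorph (Model (m + 1)) (ℝ × Model m))
      (ψ : Model m → Aff (m + 1)) (η : Model m → Aff (m + 1) →L[ℝ] ℝ) (c₁ c₂ : ℝ)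
      (A : Aff (m + 2) ≃ₗ[ℝ] Aff (m + 2)),
      0 < ε ∧ z₀ ∈ e.source ∧ e.source ⊆ Ω ∧ e.target = Set.Ioo (-ε) ε ×ˢ (Q : Set (Model m)) ∧
      ContDiffOn ℝ ∞ e e.source ∧ ContDiffOn ℝ ∞ e.symm e.target ∧
      IsCentroaffine (Q : Set (Model m)) ψ η 1 ∧ HasMetricVolume (Q : Set (Model m)) ψ η 1 ∧
      0 < c₁ ∧ 0 < c₂ ∧ LinearMap.det (A : Aff (m + 2) →ₗ[ℝ] Aff (m + 2)) = 1 ∧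
      ∀ p ∈ e.target, f (e.symm p) = A (calabiProductPoint c₁ c₂ ψ p.1 p.2) := by
  have hn : (0 : ℝ) < (m + 1 : ℕ) := by positivity
  have hb : b ≠ 0 := by
    rintro rfl
    simpa [hκ] using h.normal z₀ hz₀
  have hbc : b * (b - μ) = ((m + 1 : ℕ) + 1) * b ^ 2 := by rw [hμ]; ring
  have hbcpos : 0 < b * (b - μ) := by rw [hbc]; positivity
  have hcne : b - μ ≠ 0 := right_ne_zero_of_mul hbcpos.ne'
  have hbμ : μ ≠ b := (sub_ne_zero.1 hcne).symm
  have hκ₀ : κ ≠ 0 := left_ne_zero_of_mul_eq_one (h.normal z₀ hz₀)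
  obtain ⟨U, hUΩ, hU, hzU, t, χ, τ₀, v, ht₀, hts, hχs, hτv, ht, hχ, hτχ, hℓχ, hf, hfT⟩ :=
    h.exists_cone (by simp) hA hκ hbμ hz₀
  -- With `n = m + 1` the coordinate `u = √n b t` gives `b t = u / √n` and, because `μ = -n b`, `μ t
  -- = -√n u`. These are the exponents of the Calabi product for either sign of `b`.
  have hs : √(m + 1 : ℕ) * b ≠ 0 := mul_ne_zero (Real.sqrt_pos.2 hn).ne' hb
  have htT : ∀ z ∈ U, fderiv ℝ t z (T z) = 1 := fun z hz ↦ by rw [ht z hz, hA.unit z (hUΩ hz)]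
  obtain ⟨ε, Q, e, hε, hze, heU, het, hes, hes', het', heχ⟩ := exists_straightening hU hts hχs htT
    (fun z hz ↦ by rw [hχ z hz, hA.unit z (hUΩ hz), one_smul, sub_self, smul_zero])
    (fun z hz a h₁ h₂ ↦ by
      rw [ht z hz] at h₁
      rw [hχ z hz, h₁, zero_smul, sub_zero] at h₂
      exact h.eq_zero_of_fderiv_eq_zero (hUΩ hz)
        ((smul_eq_zero.1 h₂).resolve_left (Real.exp_ne_zero _))) hzU ht₀ hs
  obtain ⟨A, d, hd, hdet, hAv, hτA⟩ := exists_adapted_equiv (k := m + 1) (by omega)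
    (τ := (τ₀ : Aff (m + 2) →ₗ[ℝ] ℝ)) hτv
  rw [map_smul] at hAv
  let ζ : Model m → Model (m + 1) := fun q ↦ e.symm (0, q)
  have hq : ∀ q ∈ Q, ((0 : ℝ), q) ∈ e.target := fun q hq ↦ by
    rw [het]
    exact ⟨⟨neg_lt_zero.2 hε, hε⟩, hq⟩
  have hζU : ∀ q ∈ Q, ζ q ∈ U := fun q h' ↦ heU (e.map_target (hq q h'))
  have hζs : ContDiffOn ℝ ∞ ζ (Q : Set (Model m)) :=
    hes'.comp (contDiff_prodMk_right (0 : ℝ)).contDiffOn hq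
  have hζd : ∀ q ∈ Q, HasFDerivAt ζ (fderiv ℝ ζ q) q := fun q h' ↦
    ((hζs.contDiffAt (Q.isOpen.mem_nhds h')).differentiableAt (by simp)).hasFDerivAt
  have hζt : ∀ q ∈ Q, t (ζ q) = 0 := fun q h' ↦
    (mul_eq_zero.1 (het' _ (hq q h'))).resolve_left hs
  -- The slice `ζ` lies in the level set `t = 0` and `dt = h(T, ·)`, so it is orthogonal to the
  -- axis.
  have hζθ : ∀ q ∈ Q, ∀ u, conormalMetric f ℓ (ζ q) (T (ζ q)) (fderiv ℝ ζ q u) = 0 := by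
    intro q h' u
    have h₁ : HasFDerivAt (fun q ↦ t (ζ q)) (fderiv ℝ t (ζ q) ∘L fderiv ℝ ζ q) q :=
      HasFDerivAt.comp q (((hts.contDiffAt (hU.mem_nhds (hζU q h'))).differentiableAt
        (by simp)).hasFDerivAt) (hζd q h')
    have h₂ : HasFDerivAt (fun q ↦ t (ζ q)) (0 : Model m →L[ℝ] ℝ) q :=
      (hasFDerivAt_const (0 : ℝ) q).congr_of_eventuallyEq (by
        filter_upwards [Q.isOpen.mem_nhds h'] with q' h'' using hζt q' h'')
    rw [← ht _ (hζU q h')]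
    exact DFunLike.congr_fun (h₁.unique h₂) u
  have hζinj : ∀ q ∈ Q, ∀ u, fderiv ℝ ζ q u = 0 → u = 0 := by
    intro q h' u hu
    have h₁ : HasFDerivAt (fun q ↦ e (ζ q)) (fderiv ℝ e (ζ q) ∘L fderiv ℝ ζ q) q :=
      HasFDerivAt.comp q (((hes.contDiffAt (e.open_source.mem_nhds
        (e.map_target (hq q h')))).differentiableAt (by simp)).hasFDerivAt) (hζd q h')
    have h₂ : HasFDerivAt (fun q ↦ e (ζ q)) (ContinuousLinearMap.inr ℝ ℝ (Model m)) q :=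
      (hasFDerivAt_prodMk_right (0 : ℝ) q).congr_of_eventuallyEq (by
        filter_upwards [Q.isOpen.mem_nhds h'] with q' h'' using e.right_inv (hq q' h''))
    have h₃ := DFunLike.congr_fun (h₁.unique h₂) u
    rw [ContinuousLinearMap.comp_apply, hu, map_zero] at h₃
    exact (congrArg Prod.snd h₃).symm
  have hχζ : ∀ q ∈ Q, HasFDerivAt (fun q ↦ χ (ζ q)) (fderiv ℝ f (ζ q) ∘L fderiv ℝ ζ q) q := by
    intro q h'
    refine (HasFDerivAt.comp q (((hχs.contDiffAt (hU.mem_nhds (hζU q h'))).differentiableAt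
      (by simp)).hasFDerivAt) (hζd q h')).congr_fderiv ?_
    ext1 u
    rw [ContinuousLinearMap.comp_apply, hχ _ (hζU q h'), hζθ q h', hζt q h']
    simp
  have hτχ' : ∀ q ∈ Q, ∀ u, τ₀ (fderiv ℝ f (ζ q) (fderiv ℝ ζ q u)) = 0 := by
    intro q h' u
    have h₁ : HasFDerivAt (fun q ↦ τ₀ (χ (ζ q)))
        (τ₀ ∘L (fderiv ℝ f (ζ q) ∘L fderiv ℝ ζ q)) q :=
      τ₀.hasFDerivAt.comp q (hχζ q h')
    have h₂ : HasFDerivAt (fun q ↦ τ₀ (χ (ζ q))) (0 : Model m →L[ℝ] ℝ) q :=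
      (hasFDerivAt_const (0 : ℝ) q).congr_of_eventuallyEq (by
        filter_upwards [Q.isOpen.mem_nhds h'] with q' h'' using hτχ _ (hζU q' h''))
    exact DFunLike.congr_fun (h₁.unique h₂) u
  -- The scale that gives `ψ` the volume of its metric. The frame determinant of `f` is that of `ψ`
  -- times `κ d (b - μ) r⁻¹ ^ (m + 1)`, and the metric determinant of `ψ` is that of the slice times
  -- `(b (b - μ)) ^ m`.
  obtain ⟨r, hr, hrpow⟩ : ∃ r : ℝ, 0 < r ∧
      r ^ (2 * (m + 1)) = (κ * d * (b - μ)) ^ 2 * (b * (b - μ)) ^ m := by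
    have hx : 0 < (κ * d * (b - μ)) ^ 2 * (b * (b - μ)) ^ m :=
      mul_pos (sq_pos_of_ne_zero (mul_ne_zero (mul_ne_zero hκ₀ hd.ne') hcne)) (pow_pos hbcpos m)
    exact ⟨_, Real.rpow_pos_of_pos hx _, Real.rpow_inv_natCast_pow hx.le (by omega)⟩
  let I : Aff (m + 1) →L[ℝ] Aff (m + 2) :=
    LinearMap.toContinuousLinearMap ((A : Aff (m + 2) →ₗ[ℝ] Aff (m + 2)) ∘ₗ snocZero (m + 1))
  let Λ : Aff (m + 2) →L[ℝ] Aff (m + 1) := LinearMap.toContinuousLinearMap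
    (r • (LinearMap.funLeft ℝ ℝ Fin.castSucc ∘ₗ (A.symm : Aff (m + 2) →ₗ[ℝ] Aff (m + 2))))
  have hI : ∀ x, I x = A (snocZero (m + 1) x) := fun x ↦ rfl
  have hIΛ : ∀ x, τ₀ x = 0 → x = I (r⁻¹ • Λ x) := by
    intro x hx
    have h₁ : A.symm x = snocZero (m + 1) (r⁻¹ • Λ x) + (A.symm x (Fin.last (m + 1))) •
        lastVec (m + 1) := by
      rw [← snoc_eq]
      funext i
      refine Fin.lastCases (by simp) (fun i ↦ ?_) i
      have : r⁻¹ * (r * A.symm x i.castSucc) = A.symm x i.castSucc :=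
        inv_mul_cancel_left₀ hr.ne' _
      rw [Fin.snoc_castSucc]
      exact this.symm
    have h₂ : x = I (r⁻¹ • Λ x) + (A.symm x (Fin.last (m + 1)) * d⁻¹) • v := by
      conv_lhs => rw [← A.apply_symm_apply x, h₁]
      rw [map_add, hI, ← hAv, map_smul A (A.symm x _), smul_smul, inv_mul_cancel_right₀ hd.ne']
    have h₃ := congrArg τ₀ h₂
    have h₄ : τ₀ (I (r⁻¹ • Λ x)) = 0 := hτA _
    rw [hx, map_add, h₄, zero_add, map_smul] at h₃
    have h₅ := (smul_eq_zero.1 h₃.symm).resolve_right hτv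
    conv_lhs => rw [h₂]
    rw [h₅, zero_smul, add_zero]
  let ψ : Model m → Aff (m + 1) := fun q ↦ Λ (χ (ζ q))
  -- The restriction of `ℓ` to the hyperplane, normalized by `η(ψ) = 1`: on the slice `ℓ(χ) = (b (b
  -- - μ))⁻¹`. The metric of `ψ` is then `b (b - μ)` times that of the slice, positive since `b (b -
  -- μ) = (n + 1) b²`, and independent of `r`.
  let η : Model m → Aff (m + 1) →L[ℝ] ℝ := fun q ↦ (r⁻¹ * (b * (b - μ))) • (ℓ (ζ q) ∘L I)
  have hχψ : ∀ q ∈ Q, χ (ζ q) = I (r⁻¹ • ψ q) := fun q h' ↦ hIΛ _ (hτχ _ (hζU q h'))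
  have hψd : ∀ q ∈ Q, HasFDerivAt ψ (Λ ∘L (fderiv ℝ f (ζ q) ∘L fderiv ℝ ζ q)) q := fun q h' ↦
    Λ.hasFDerivAt.comp q (hχζ q h')
  have hDψ : ∀ q ∈ Q, ∀ u, fderiv ℝ f (ζ q) (fderiv ℝ ζ q u) = I (r⁻¹ • fderiv ℝ ψ q u) := by
    intro q h' u
    rw [(hψd q h').fderiv]
    exact hIΛ _ (hτχ' q h' u)
  have hζmaps : Set.MapsTo ζ (Q : Set (Model m)) U := hζU
  have hη : ∀ q x, η q x = b * (b - μ) * ℓ (ζ q) (I (r⁻¹ • x)) := by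
    intro q x
    simp only [η, smul_apply, ContinuousLinearMap.comp_apply, map_smul, smul_eq_mul]
    ring
  have hηd : ∀ q ∈ Q, ∀ u x, fderiv ℝ η q u x
      = b * (b - μ) * fderiv ℝ ℓ (ζ q) (fderiv ℝ ζ q u) (I (r⁻¹ • x)) := by
    intro q h' u x
    have h₁ : HasFDerivAt (fun q ↦ ℓ (ζ q)) (fderiv ℝ ℓ (ζ q) ∘L fderiv ℝ ζ q) q :=
      HasFDerivAt.comp q (h.differentiableAt_conormal (hUΩ (hζU q h'))).hasFDerivAt (hζd q h')
    have h₂ : HasFDerivAt η _ q :=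
      ((h₁.clm_comp (hasFDerivAt_const I q)).const_smul (r⁻¹ * (b * (b - μ))))
    rw [h₂.fderiv]
    simp
    ring
  have hmetric : ∀ q ∈ Q, ∀ u w, conormalMetric ψ η q u w
      = b * (b - μ) * conormalMetric f ℓ (ζ q) (fderiv ℝ ζ q u) (fderiv ℝ ζ q w) := by
    intro q h' u w
    rw [conormalMetric, hηd q h', ← hDψ q h', conormalMetric]
    ring
  have hfχ : ∀ z ∈ U, t z = 0 → f z = χ z + v := by
    intro z hz h0
    rw [hf z hz, h0]
    simp
  refine ⟨ε, Q, e, ψ, η, r⁻¹, d, A, hε, hze, heU.trans hUΩ, het, hes, hes',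
    ⟨Q.isOpen, ?_, ?_, ?_, ?_, ?_⟩, ?_, inv_pos.2 hr, hd, hdet, ?_⟩
  · exact Λ.contDiff.comp_contDiffOn (hχs.comp hζs hζmaps)
  · exact (((h.smooth_conormal.mono hUΩ).comp hζs hζmaps).clm_comp contDiffOn_const).const_smul _
  · intro q h' u
    rw [hη, ← hDψ q h', h.tangent _ (hUΩ (hζU q h')), mul_zero]
  · intro q h'
    rw [hη, ← hχψ q h', hℓχ _ (hζU q h'), hζt q h', one_mul, mul_zero, neg_zero,
      Real.exp_zero, one_mul, mul_inv_cancel₀ hbcpos.ne']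
  · intro q h' u hu
    rw [hmetric q h']
    exact mul_pos hbcpos (h.pos _ (hUΩ (hζU q h')) _ fun h0 ↦ hu (hζinj q h' u h0))
  · intro q h' E
    set z := ζ q with hz
    have hzU : z ∈ U := hζU q h'
    -- The volume condition of `f` on a frame of the slice completed by the unit normal `T`. The
    -- rows of `D_T f` and `κ f` are combinations of `ψ` and the last vector, so the determinant
    -- reduces to that of `ψ`.
    have h₁ := hvol z (hUΩ hzU) (Fin.snoc (α := fun _ ↦ Model (m + 1))
      (fun i ↦ fderiv ℝ ζ q (E i)) (T z))
    rw [det_gram_snoc (conormalMetric f ℓ z) _ _ (hA.unit z (hUΩ hzU)) fun i ↦ hζθ q h' (E i)] at h₁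
    have hTz : fderiv ℝ f z (T z) = A (b • snocZero (m + 1) (r⁻¹ • ψ q) + μ • d • lastVec (m + 1)) := by
      rw [hfT z hzU, hζt q h', hχψ q h', hI, map_add, map_smul A b, map_smul A μ, map_smul A d, hAv]
      simp
    have hfz : κ • f z = A (κ • (snocZero (m + 1) (r⁻¹ • ψ q) + d • lastVec (m + 1))) := by
      rw [hfχ z hzU (hζt q h'), hχψ q h', hI, map_smul A κ, map_add, map_smul A d, hAv]
    have hw : (fun i ↦ fderiv ℝ f z (fderiv ℝ ζ q (E i)))
        = fun i ↦ A (snocZero (m + 1) (r⁻¹ • fderiv ℝ ψ q (E i))) :=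
      funext fun i ↦ hDψ q h' (E i)
    have h₂ := comp_snoc (fderiv ℝ f z) (fun i ↦ fderiv ℝ ζ q (E i)) (T z)
    rw [h₂, hTz, hfz, hw] at h₁
    have h₃ := det_frame (A : Aff (m + 2) →ₗ[ℝ] Aff (m + 2)) (fun i ↦ fderiv ℝ ψ q (E i)) (ψ q)
      r⁻¹ b μ d κ
    rw [hdet, one_mul] at h₃
    have h₄ : (Matrix.of fun i j ↦ conormalMetric ψ η q (E i) (E j)).det
        = (b * (b - μ)) ^ m * (Matrix.of fun i j ↦ conormalMetric f ℓ z (fderiv ℝ ζ q (E i))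
          (fderiv ℝ ζ q (E j))).det := by
      have h₅ := Matrix.det_smul (Matrix.of fun i j ↦ conormalMetric f ℓ z (fderiv ℝ ζ q (E i))
          (fderiv ℝ ζ q (E j))) (b * (b - μ))
      rw [Fintype.card_fin] at h₅
      rw [← h₅]
      congr 1
      ext i j
      exact hmetric q h' (E i) (E j)
    rw [h₄, abs_mul, ← h₁, abs_of_pos (pow_pos hbcpos m), one_smul]
    erw [h₃]
    have h₆ : r ^ (2 * (m + 1)) * (r⁻¹ ^ (m + 1)) ^ 2 = 1 := by
      rw [← pow_mul, mul_comm (m + 1) 2, ← mul_pow, mul_inv_cancel₀ hr.ne', one_pow]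
    rw [hrpow] at h₆
    set δ := (Matrix.of (Fin.snoc (α := fun _ ↦ Aff (m + 1)) (fun i ↦ fderiv ℝ ψ q (E i))
      (ψ q))).det
    linear_combination (-δ ^ 2) * h₆
  · rintro ⟨u, q⟩ hp
    have hzU : e.symm (u, q) ∈ U := heU (e.map_target hp)
    have hqQ : q ∈ Q := by rw [het] at hp; exact hp.2
    have h₁ : √(m + 1 : ℕ) * b * t (e.symm (u, q)) = u := het' _ hp
    have h₂ : χ (e.symm (u, q)) = A (snocZero (m + 1) (r⁻¹ • ψ q)) :=
      (heχ _ hp).trans (hχψ q hqQ)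
    have hsq : √(m + 1 : ℕ) * √(m + 1 : ℕ) = ((m + 1 : ℕ) : ℝ) := Real.mul_self_sqrt hn.le
    have hsne := (Real.sqrt_pos.2 hn).ne'
    have h₃ : b * t (e.symm (u, q)) = u / √(m + 1 : ℕ) := by
      rw [eq_div_iff hsne]
      linear_combination h₁
    have h₄ : μ * t (e.symm (u, q)) = -√(m + 1 : ℕ) * u := by
      rw [hμ]
      linear_combination (-√(m + 1 : ℕ)) * h₁ + b * t (e.symm (u, q)) * hsq
    rw [hf _ hzU, h₂, h₃, h₄, calabiProductPoint, snoc_eq, map_add, ← hAv]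
    simp only [map_smul, smul_smul, mul_comm]

end Product

/-! ### The factor as an affine hypersphere on an open subset -/

section OpenSubset

/-- Every point lies in its own preferred chart, so pointwise statements may be checked in chart
coordinates. -/
lemma forall_chartInv {n : ℕ} {M : Type*} [TopologicalSpace M] [ChartedSpace (Model n) M]
    {P : M → Prop} (h : ∀ p : M, ∀ z ∈ chartDom (n := n) p, P (chartInv p z)) (x : M) : P x := by
  have h₁ := h x (chartAt (Model n) x x) ((chartAt (Model n) x).map_source (mem_chart_source _ x))
  rwa [chartInv, (chartAt (Model n) x).left_inv (mem_chart_source _ x)] at h₁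

variable {n : ℕ} {Q : Opens (Model n)}

lemma coe_chartInv_opens (p : Q) {z : Model n} (hz : z ∈ chartDom p) :
    ((chartInv p z : Q) : Model n) = z :=
  (chartAt (Model n) p).right_inv hz

variable {ψ : Model n → Aff (n + 1)} {η : Model n → Aff (n + 1) →L[ℝ] ℝ}

/-- A centroaffine hypersurface on an open set, with the volume of its metric, is a hyperbolic
affine hypersphere with mean curvature `-1` and the origin as its centre. -/
theorem IsCentroaffine.isAffineHypersphere (h : IsCentroaffine (Q : Set (Model n)) ψ η 1)
    (hvol : HasMetricVolume (Q : Set (Model n)) ψ η 1) :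
    IsAffineHypersphere (fun q : Q ↦ ψ q) (fun q : Q ↦ ψ q) (-1) := by
  set φ : Q → Aff (n + 1) := fun q ↦ ψ q with hφ
  have hQ : ∀ p : Q, ∀ z ∈ chartDom (n := n) p, z ∈ Q := fun p z hz ↦ by
    rw [← coe_chartInv_opens p hz]
    exact (chartInv p z).2
  have hval : ∀ p : Q, ∀ z ∈ chartDom (n := n) p, φ (chartInv p z) = ψ z := fun p z hz ↦
    congrArg ψ (coe_chartInv_opens p hz)
  have hcomp : ∀ p : Q, ∀ z ∈ chartDom (n := n) p, φ ∘ chartInv p =ᶠ[𝓝 z] ψ := fun p z hz ↦ by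
    filter_upwards [(isOpen_chartDom p).mem_nhds hz] with z' hz' using hval p z' hz'
  have hsmooth : ContMDiff 𝓘(ℝ, Model n) 𝓘(ℝ, Aff (n + 1)) ∞ φ := fun x ↦
    contMDiffAt_subtype_iff.2 (h.contDiffAt x.2).contMDiffAt
  have hdiff : ∀ p : Q, ∀ z ∈ chartDom (n := n) p, ∀ u,
      diff φ (chartInv p z) (chartPush p z u) = fderiv ℝ ψ z u := fun p z hz u ↦ by
    rw [diff_map_chartPush hsmooth p hz, (hcomp p z hz).fderiv_eq]
  have himm : ∀ x : Q, Function.Injective (diff (n := n) φ x) := by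
    refine forall_chartInv (n := n) fun p z hz ↦ (injective_iff_map_eq_zero _).2 fun a ha ↦ ?_
    obtain ⟨u, rfl⟩ := (chartPush_bijective p hz).2 a
    rw [hdiff p z hz] at ha
    rw [h.eq_zero_of_fderiv_eq_zero (hQ p z hz) ha, map_zero]
  have hnormal : ∀ z ∈ Q, η z (ψ z) = 1 := fun z hz ↦ by simpa using h.normal z hz
  have htrans : ∀ x : Q, ∀ u : Tan n x, diff φ x u ≠ φ x := by
    refine forall_chartInv (n := n) fun p z hz a ha ↦ ?_
    obtain ⟨u, rfl⟩ := (chartPush_bijective p hz).2 a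
    rw [hdiff p z hz, hval p z hz] at ha
    have h₁ := h.tangent z (hQ p z hz) u
    rw [ha, hnormal z (hQ p z hz)] at h₁
    exact one_ne_zero h₁
  have hinv : ∀ x : Q, (frameMap φ φ x).IsInvertible := fun x ↦
    isInvertible_frameMap (himm x) (htrans x)
  have hcon : ∀ p : Q, ∀ z ∈ chartDom (n := n) p, η z = conormal φ φ (chartInv p z) := by
    intro p z hz
    refine conormal_unique (hinv _) (fun a ↦ ?_) ?_
    · obtain ⟨u, rfl⟩ := (chartPush_bijective p hz).2 a
      rw [hdiff p z hz]
      exact h.tangent z (hQ p z hz) u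
    · rw [hval p z hz]
      exact hnormal z (hQ p z hz)
  have hmetric : ∀ p : Q, ∀ z ∈ chartDom (n := n) p, ∀ u v,
      affineMetric φ φ (chartInv p z) (chartPush p z u) (chartPush p z v)
        = conormalMetric ψ η z u v := by
    intro p z hz u v
    rw [affineMetric_eq, diff_diff_field hsmooth p hz (diffFieldAt_extendField _) u,
      chartField_extendField p hz, ← hcon p z hz, (hcomp p z hz).fderiv_eq,
      (hcomp p z hz).fderiv.fderiv_eq, map_add, h.tangent z (hQ p z hz), add_zero,
      h.metric_eq (hQ p z hz)]
  refine ⟨⟨hsmooth, himm, hsmooth, htrans, fun x u ↦ ⟨u, rfl⟩, ?_⟩, ?_, fun x u ↦ ?_⟩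
  · refine forall_chartInv (n := n) fun p z hz e ↦ ?_
    choose a ha using fun i ↦ (chartPush_bijective p hz).2 (e i)
    obtain rfl : (fun i ↦ chartPush p z (a i)) = e := funext ha
    have h₁ := hvol z (hQ p z hz) a
    rw [one_smul] at h₁
    simp only [hdiff p z hz, hval p z hz, hmetric p z hz]
    exact h₁
  · refine forall_chartInv (n := n) fun p z hz a ha ↦ ?_
    obtain ⟨u, rfl⟩ := (chartPush_bijective p hz).2 a
    rw [hmetric p z hz]
    refine h.pos z (hQ p z hz) u fun h0 ↦ ha ?_
    rw [h0, map_zero]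
  · rw [map_smul, neg_smul, one_smul, neg_neg]

end OpenSubset

/-! ### The eigenvalue hypotheses in a chart -/

section ChartHypotheses

variable {n : ℕ} {M : Type*} [TopologicalSpace M] [ChartedSpace (Model n) M]
  [IsManifold 𝓘(ℝ, Model n) ∞ M] {φ ξ : M → Aff (n + 1)} {lam : ℝ}

lemma hasMetricVolume_chart (h : IsAffineHypersphere φ ξ lam) (hlam : lam ≠ 0) (p : M) :
    HasMetricVolume (chartDom p) (chartPos ξ lam p) (chartConormal φ ξ p) (-lam) := by
  intro z hz a
  have h₁ := h.volume_eq (chartInv p z) fun i ↦ chartPush p z (a i)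
  have h₂ : -lam • chartPos ξ lam p z = ξ (chartInv p z) := by
    rw [chartPos, smul_smul, mul_inv_cancel₀ (neg_ne_zero.2 hlam), one_smul]
  simp only [diff_map_chartPush h.smooth_map p hz, affineMetric_chartPush h hlam p hz] at h₁
  rw [h₂, fderiv_chartPos h hlam p hz]
  exact h₁

/-- The cubic form of a hypersphere whose difference tensor has the given eigenvalues. -/
lemma conormalCubic_chartField (h : IsAffineHypersphere φ ξ lam) (hlam : lam ≠ 0)
    {D₁ D₂ : Π x : M, Submodule ℝ (Tan n x)} (hsum : ∀ x : M, IsCompl (D₁ x) (D₂ x))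
    (horth : ∀ x : M, ∀ u ∈ D₁ x, ∀ v ∈ D₂ x, affineMetric φ ξ x u v = 0)
    {T : Π x : M, Tan n x} (hspan : ∀ x : M, D₁ x = Submodule.span ℝ {T x})
    (hunit : ∀ x : M, affineMetric φ ξ x (T x) (T x) = 1) {lam₁ lam₂ : M → ℝ}
    (hK₁ : ∀ x : M, differenceTensor φ ξ x (T x) (T x) = lam₁ x • T x)
    (hK₂ : ∀ x : M, ∀ u ∈ D₂ x, differenceTensor φ ξ x (T x) u = lam₂ x • u)
    (p : M) {z : Model n} (hz : z ∈ chartDom p) (a c : Model n) :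
    conormalCubic (chartPos ξ lam p) (chartConormal φ ξ p) z (chartField p T z) a c
      = -2 * (lam₂ (chartInv p z) * conormalMetric (chartPos ξ lam p) (chartConormal φ ξ p) z a c
        + (lam₁ (chartInv p z) - lam₂ (chartInv p z))
          * conormalMetric (chartPos ξ lam p) (chartConormal φ ξ p) z (chartField p T z) a
          * conormalMetric (chartPos ξ lam p) (chartConormal φ ξ p) z (chartField p T z) c) := by
  set x := chartInv p z with hx
  set f := chartPos ξ lam p with hf
  set ℓ := chartConormal φ ξ p with hℓ
  set t := chartField p T z with ht
  have hC : IsCentroaffine (chartDom p) f ℓ (-lam) := isCentroaffine_chart h hlam p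
  have hpush : chartPush p z t = T x := chartPush_chartField p T hz
  have hunit' : conormalMetric f ℓ z t t = 1 := by
    rw [← affineMetric_chartPush h hlam p hz, hpush]
    exact hunit x
  have hTD : T x ∈ D₁ x := by
    rw [hspan]
    exact Submodule.mem_span_singleton_self _
  obtain ⟨u', hu', v', hv', huv⟩ := Submodule.mem_sup.1
    ((hsum x).sup_eq_top ▸ Submodule.mem_top : chartPush p z a ∈ D₁ x ⊔ D₂ x)
  rw [hspan] at hu'
  obtain ⟨r, rfl⟩ := Submodule.mem_span_singleton.1 hu'
  obtain ⟨v, rfl⟩ := (chartPush_bijective p hz).2 v'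
  -- Linearity in `a` reduces the formula to `K(T, T)` and to `K(T, v)` with `v` orthogonal to `T`,
  -- where the eigenvalues are `lam₁ = b + μ` and `lam₂ = b`.
  have ha : a = r • t + v := by
    refine (chartPush_bijective p hz).1 (huv.symm.trans ?_)
    rw [map_add, map_smul, hpush]
  have hTv : conormalMetric f ℓ z t v = 0 := by
    rw [← affineMetric_chartPush h hlam p hz, hpush]
    exact horth x _ hTD _ hv'
  have h₁ : 2 * (lam₁ x * conormalMetric f ℓ z t c) = -conormalCubic f ℓ z t t c := by
    rw [← affineMetric_differenceTensor h hlam p hz, hpush]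
    have h₂ : differenceTensor φ ξ x (T x) (T x) = chartPush p z (lam₁ x • t) := by
      rw [map_smul, hpush]
      exact hK₁ x
    rw [h₂, affineMetric_chartPush h hlam p hz, IsCentroaffine.metric_smul_left]
  have h₃ : 2 * (lam₂ x * conormalMetric f ℓ z v c) = -conormalCubic f ℓ z t v c := by
    rw [← affineMetric_differenceTensor h hlam p hz, hpush]
    have h₂ : differenceTensor φ ξ x (T x) (chartPush p z v) = chartPush p z (lam₂ x • v) := by
      rw [map_smul]
      exact hK₂ x _ hv'
    rw [h₂, affineMetric_chartPush h hlam p hz, IsCentroaffine.metric_smul_left]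
  have h₄ : conormalCubic f ℓ z t a c = r * conormalCubic f ℓ z t t c
      + conormalCubic f ℓ z t v c := by
    rw [ha]
    simp only [conormalCubic, map_add, map_smul, add_apply, smul_apply, smul_eq_mul]
    ring
  have h₅ : conormalMetric f ℓ z t a = r := by
    rw [ha, IsCentroaffine.metric_add_right, IsCentroaffine.metric_smul_right, hunit', hTv]
    ring
  have h₆ : conormalMetric f ℓ z a c = r * conormalMetric f ℓ z t c + conormalMetric f ℓ z v c := by
    rw [ha, IsCentroaffine.metric_add_left, IsCentroaffine.metric_smul_left]
  rw [h₄, h₅, h₆]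
  linear_combination r * h₁ + h₃

end ChartHypotheses

/-! ### Product coordinates on the manifold -/

section ProductChart

variable {m : ℕ} {M : Type*} [TopologicalSpace M] [ChartedSpace (Model (m + 1)) M]
  [IsManifold 𝓘(ℝ, Model (m + 1)) ∞ M]

/-- Product coordinates in the domain of a chart are a diffeomorphism onto an open subset. -/
lemma exists_partialDiffeomorph (p : M) {ε : ℝ} {Q : Opens (Model m)}
    {e : OpenPartialHomeomorph (Model (m + 1)) (ℝ × Model m)}
    (htarget : e.target = Set.Ioo (-ε) ε ×ˢ (Q : Set (Model m)))
    (hsource : e.source ⊆ chartDom p) (he : ContDiffOn ℝ ∞ e e.source)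
    (hes : ContDiffOn ℝ ∞ e.symm e.target) (hp : chartAt (Model (m + 1)) p p ∈ e.source) :
    ∃ Φ : PartialDiffeomorph (𝓘(ℝ, ℝ).prod 𝓘(ℝ, Model m)) 𝓘(ℝ, Model (m + 1)) (ℝ × Q) M ∞,
      Φ.source = Set.Ioo (-ε) ε ×ˢ Set.univ ∧ p ∈ Φ.target ∧
      ∀ (t : ℝ) (q : Q), Φ (t, q) = chartInv p (e.symm (t, (q : Model m))) := by
  classical
  set c := chartAt (Model (m + 1)) p with hc
  have hmem : ∀ z ∈ e.source, (e z).1 ∈ Set.Ioo (-ε) ε ∧ (e z).2 ∈ Q := fun z hz ↦ by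
    have := e.map_source hz
    rwa [htarget] at this
  have hmem' : ∀ t ∈ Set.Ioo (-ε) ε, ∀ q : Q, (t, (q : Model m)) ∈ e.target := fun t ht q ↦ by
    rw [htarget]
    exact ⟨ht, q.2⟩
  let q₀ : Q := ⟨(e (c p)).2, (hmem _ hp).2⟩
  -- A total map into the subtype is needed for the inverse; its value `q₀` outside `Q` is never
  -- reached on the target.
  let proj : Model m → Q := fun y ↦ if h : y ∈ Q then ⟨y, h⟩ else q₀
  have hproj : ∀ y ∈ Q, (proj y : Model m) = y := fun y hy ↦ by simp [proj, hy]
  refine ⟨{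
    toFun := fun x ↦ chartInv p (e.symm (x.1, (x.2 : Model m)))
    invFun := fun x ↦ ((e (c x)).1, proj (e (c x)).2)
    source := Set.Ioo (-ε) ε ×ˢ Set.univ
    target := c.source ∩ c ⁻¹' e.source
    map_source' := ?_
    map_target' := ?_
    left_inv' := ?_
    right_inv' := ?_
    open_source := isOpen_Ioo.prod isOpen_univ
    open_target := c.isOpen_inter_preimage e.open_source
    contMDiffOn_toFun := ?_
    contMDiffOn_invFun := ?_ }, rfl, ⟨mem_chart_source _ p, hp⟩, fun t q ↦ rfl⟩
  · rintro ⟨t, q⟩ ⟨ht, -⟩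
    have h₁ := e.map_target (hmem' t ht q)
    refine ⟨c.map_target (hsource h₁), ?_⟩
    change c (c.symm (e.symm (t, (q : Model m)))) ∈ e.source
    rwa [c.right_inv (hsource h₁)]
  · rintro x ⟨-, hx⟩
    exact ⟨(hmem _ hx).1, trivial⟩
  · rintro ⟨t, q⟩ ⟨ht, -⟩
    have h₁ := hmem' t ht q
    have h₂ : e (c (c.symm (e.symm (t, (q : Model m))))) = (t, (q : Model m)) := by
      rw [c.right_inv (hsource (e.map_target h₁)), e.right_inv h₁]
    change ((e (c (c.symm (e.symm (t, (q : Model m)))))).1,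
      proj (e (c (c.symm (e.symm (t, (q : Model m)))))).2) = (t, q)
    rw [h₂]
    exact Prod.ext rfl (Subtype.ext (hproj _ q.2))
  · rintro x ⟨hx, hx'⟩
    change c.symm (e.symm ((e (c x)).1, (proj (e (c x)).2 : Model m))) = x
    rw [hproj _ (hmem _ hx').2, e.left_inv hx', c.left_inv hx]
  · rintro ⟨t, q⟩ ⟨ht, -⟩
    have h₁ := hmem' t ht q
    have h₂ : ContMDiffAt 𝓘(ℝ, ℝ × Model m) 𝓘(ℝ, Model (m + 1)) ∞ e.symm (t, (q : Model m)) :=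
      (hes.contDiffAt (e.open_target.mem_nhds h₁)).contMDiffAt
    have h₃ : ContMDiffAt (𝓘(ℝ, ℝ).prod 𝓘(ℝ, Model m)) 𝓘(ℝ, ℝ × Model m) ∞
        (fun x : ℝ × Q ↦ (x.1, (x.2 : Model m))) (t, q) :=
      contMDiffAt_fst.prodMk_space (contMDiff_subtype_val.contMDiffAt.comp _ contMDiffAt_snd)
    exact ((contMDiffAt_chartInv p (hsource (e.map_target h₁))).comp (t, q)
      (h₂.comp (t, q) h₃)).contMDiffWithinAt
  · rintro x ⟨hx, hx'⟩
    have h₁ : ContMDiffAt 𝓘(ℝ, Model (m + 1)) 𝓘(ℝ, Model (m + 1)) ∞ c x :=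
      (contMDiffOn_chart (I := 𝓘(ℝ, Model (m + 1))) (x := p) (n := ∞)).contMDiffAt
        (c.open_source.mem_nhds hx)
    have h₂ : ContDiffAt ℝ ∞ e (c x) := he.contDiffAt (e.open_source.mem_nhds hx')
    have h₃ : ContMDiffAt 𝓘(ℝ, Model (m + 1)) 𝓘(ℝ, ℝ) ∞ (fun x ↦ (e (c x)).1) x :=
      ContMDiffAt.comp (g := fun z ↦ (e z).1) (f := c) x
        (contDiff_fst.contDiffAt.comp (c x) h₂).contMDiffAt h₁
    have h₄ : ContMDiffAt 𝓘(ℝ, Model (m + 1)) 𝓘(ℝ, Model m) ∞ (fun x ↦ (e (c x)).2) x :=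
      ContMDiffAt.comp (g := fun z ↦ (e z).2) (f := c) x
        (contDiff_snd.contDiffAt.comp (c x) h₂).contMDiffAt h₁
    have h₅ : ContMDiffAt 𝓘(ℝ, Model (m + 1)) 𝓘(ℝ, Model m) ∞ (fun x ↦ proj (e (c x)).2) x := by
      rw [← ContMDiffAt.subtypeVal_comp_iff]
      refine h₄.congr_of_eventuallyEq ?_
      filter_upwards [(c.isOpen_inter_preimage e.open_source).mem_nhds ⟨hx, hx'⟩] with y hy
      exact hproj _ (hmem _ hy.2).2
    exact (h₃.prodMk h₅).contMDiffWithinAt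

end ProductChart

/-! ### Constancy of the eigenvalues and conclusion -/

section Main

variable {m : ℕ}

lemma IsCentroaffine.continuousOn_cubic {E F : Type*} [NormedAddCommGroup E] [NormedSpace ℝ E]
    [NormedAddCommGroup F] [NormedSpace ℝ F] {Ω : Set E} {f : E → F} {ℓ : E → F →L[ℝ] ℝ} {κ : ℝ}
    {T : E → E} (h : IsCentroaffine Ω f ℓ κ) (hT : ContinuousOn T Ω) :
    ContinuousOn (fun z ↦ conormalCubic f ℓ z (T z) (T z) (T z)) Ω := by
  intro z hz
  have h₁ := (h.contDiffAt_fderiv hz).continuousAt.continuousWithinAt (s := Ω)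
  have h₂ := (h.contDiffAt_fderiv_conormal hz).continuousAt.continuousWithinAt (s := Ω)
  have h₃ := ((h.contDiffAt_fderiv hz).fderiv_right (m := 0)
    (by simp)).continuousAt.continuousWithinAt (s := Ω)
  have h₄ := ((h.contDiffAt_fderiv_conormal hz).fderiv_right (m := 0)
    (by simp)).continuousAt.continuousWithinAt (s := Ω)
  exact ((h₂.clm_apply (hT z hz)).clm_apply ((h₃.clm_apply (hT z hz)).clm_apply (hT z hz))).sub
    (((h₄.clm_apply (hT z hz)).clm_apply (hT z hz)).clm_apply (h₁.clm_apply (hT z hz)))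

/-- The eigenvalue functions of a hypersphere are locally constant. -/
lemma exists_ball_isAxis {Ω : Set (Model (m + 1))} {f : Model (m + 1) → Aff (m + 2)}
    {ℓ : Model (m + 1) → Aff (m + 2) →L[ℝ] ℝ} {κ : ℝ} {T : Model (m + 1) → Model (m + 1)}
    (hm : 1 ≤ m) (h : IsCentroaffine Ω f ℓ κ) (hvol : HasMetricVolume Ω f ℓ κ) (hκ : κ ≠ 0)
    (hT : ContDiffOn ℝ ∞ T Ω) (hunit : ∀ z ∈ Ω, conormalMetric f ℓ z (T z) (T z) = 1)
    {b μ : Model (m + 1) → ℝ} (hbμ : ∀ z ∈ Ω, κ = -(b z * μ z))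
    (hcubic : ∀ z ∈ Ω, ∀ a c, conormalCubic f ℓ z (T z) a c
      = -2 * (b z * conormalMetric f ℓ z a c
        + μ z * conormalMetric f ℓ z (T z) a * conormalMetric f ℓ z (T z) c))
    {z₀ : Model (m + 1)} (hz₀ : z₀ ∈ Ω) :
    ∃ r, 0 < r ∧ Metric.ball z₀ r ⊆ Ω ∧ μ z₀ = -((m + 1 : ℕ) * b z₀) ∧
      IsCentroaffine.IsAxis (Metric.ball z₀ r) f ℓ T (b z₀) (μ z₀) := by
  obtain ⟨r, hr, hball⟩ := Metric.isOpen_iff.1 h.isOpen z₀ hz₀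
  have hμ : ∀ z ∈ Ω, μ z = -((m + 1 : ℕ) * b z) := fun z hz ↦
    h.eigenvalue_eq hvol hz (by simp) (hunit z hz) (hcubic z hz)
  have hm' : (m : ℝ) ≠ 0 := by positivity
  -- Since `C(T, T, T) = -2(b + μ)` and `μ = -(m + 1) b`, the eigenvalue is recovered as `C(T, T, T)
  -- / (2m)`. It is therefore continuous although no regularity of it is assumed; this is where `m ≥
  -- 1` matters.
  have hb : ∀ z ∈ Ω, b z = (2 * (m : ℝ))⁻¹ * conormalCubic f ℓ z (T z) (T z) (T z) := by
    intro z hz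
    rw [hcubic z hz, hunit z hz, hμ z hz]
    push_cast
    field_simp
    ring
  have hsq : ∀ z ∈ Ω, κ = (m + 1 : ℕ) * b z ^ 2 := fun z hz ↦ by
    rw [hbμ z hz, hμ z hz]
    ring
  have hcont : ContinuousOn b (Metric.ball z₀ r) :=
    ((continuousOn_const.mul (h.continuousOn_cubic hT.continuousOn)).congr hb).mono hball
  have hconst : Set.EqOn b (fun _ ↦ b z₀) (Metric.ball z₀ r) := by
    -- The square of `b` is the nonzero constant `κ / (m + 1)`, so a continuous `b` cannot change
    -- sign on the ball.
    refine (convex_ball z₀ r).isPreconnected.eq_of_sq_eq hcont continuousOn_const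
      (fun z hz ↦ ?_) (fun {z} hz h0 ↦ hκ ?_) (Metric.mem_ball_self hr) rfl
    · have h₁ := (hsq z (hball hz)).symm.trans (hsq z₀ hz₀)
      exact mul_left_cancel₀ (by positivity) h₁
    · rw [hsq z₀ hz₀, show b z₀ = 0 from h0]
      simp
  refine ⟨r, hr, hball, hμ z₀ hz₀, hT.mono hball, fun z hz ↦ hunit z (hball hz), fun z hz a c ↦ ?_⟩
  have h₁ : b z = b z₀ := hconst hz
  rw [hcubic z (hball hz), hμ z (hball hz), hμ z₀ hz₀, h₁]

end Main

end AffineGeometry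

end

theorem theorem1 {m : ℕ} (hm : 1 ≤ m)
    {M : Type*} [TopologicalSpace M] [ChartedSpace (AffineGeometry.Model (m + 1)) M]
    [IsManifold 𝓘(ℝ, AffineGeometry.Model (m + 1)) ∞ M]
    (φ ξ : M → AffineGeometry.Aff (m + 2)) (lam : ℝ) (hlam : lam < 0)
    (hφ : AffineGeometry.IsAffineHypersphere φ ξ lam)
    (D₁ D₂ : Π x : M, Submodule ℝ (AffineGeometry.Tan (m + 1) x))
    (hsum : ∀ x : M, IsCompl (D₁ x) (D₂ x))
    (horth : ∀ x : M, ∀ u ∈ D₁ x, ∀ v ∈ D₂ x, AffineGeometry.affineMetric φ ξ x u v = 0)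
    (T : Π x : M, AffineGeometry.Tan (m + 1) x) (hT : AffineGeometry.SmoothField T)
    (hspan : ∀ x : M, D₁ x = Submodule.span ℝ {T x})
    (hunit : ∀ x : M, AffineGeometry.affineMetric φ ξ x (T x) (T x) = 1)
    (lam₁ lam₂ : M → ℝ)
    (hlam₁₂ : ∀ x : M, -lam + lam₁ x * lam₂ x - lam₂ x ^ 2 = 0)
    (hK₁ : ∀ x : M, AffineGeometry.differenceTensor φ ξ x (T x) (T x) = lam₁ x • T x)
    (hK₂ : ∀ x : M, ∀ u ∈ D₂ x,
      AffineGeometry.differenceTensor φ ξ x (T x) u = lam₂ x • u) :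
    AffineGeometry.IsLocallyCalabiProductPoint φ := by
  open AffineGeometry in
  intro p
  have hC := isCentroaffine_chart hφ hlam.ne p
  have hvol := hasMetricVolume_chart hφ hlam.ne p
  have hz₀ : chartAt (Model (m + 1)) p p ∈ chartDom p :=
    (chartAt (Model (m + 1)) p).map_source (mem_chart_source _ p)
  obtain ⟨r, hr, hball, hμ, hA⟩ := exists_ball_isAxis hm hC hvol (neg_ne_zero.2 hlam.ne)
    (contDiffOn_chartField p hT)
    (fun z hz ↦ by
      rw [← affineMetric_chartPush hφ hlam.ne p hz, chartPush_chartField p T hz]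
      exact hunit _)
    (b := fun z ↦ lam₂ (chartInv p z)) (μ := fun z ↦ lam₁ (chartInv p z) - lam₂ (chartInv p z))
    (fun z _ ↦ by linear_combination hlam₁₂ (chartInv p z))
    (fun z hz ↦ conormalCubic_chartField hφ hlam.ne hsum horth hspan hunit hK₁ hK₂ p hz) hz₀
  set z₀ := chartAt (Model (m + 1)) p p with hz₀_def
  obtain ⟨ε, Q, e, ψ, η, c₁, c₂, A, hε, hze, heB, het, hes, hes', hψ, hψvol, hc₁, hc₂, hdet, hf⟩ :=
    exists_calabi_coordinates (hC.mono Metric.isOpen_ball hball)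
      (fun z hz ↦ hvol z (hball hz)) hA hμ
      (by linear_combination hlam₁₂ (chartInv p z₀)) (Metric.mem_ball_self hr)
  obtain ⟨Φ, hΦs, hΦp, hΦ⟩ := exists_partialDiffeomorph p het (heB.trans hball) hes hes' hze
  set f := chartPos ξ lam p with hf_def
  -- The vector `w` is the centre of the hypersphere; it becomes the translation part of the
  -- equiaffine map.
  obtain ⟨w, hw⟩ : ∃ w, ∀ z ∈ Metric.ball z₀ r, φ (chartInv p z) = w + f z := by
    refine ⟨φ (chartInv p z₀) - f z₀, fun z hz ↦ ?_⟩
    have hd₁ : ∀ z ∈ Metric.ball z₀ r, DifferentiableAt ℝ (φ ∘ chartInv p) z := fun z hz ↦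
      ((contDiffOn_comp_chartInv p hφ.smooth_map).contDiffAt
        ((isOpen_chartDom p).mem_nhds (hball hz))).differentiableAt (by simp)
    have hd₂ : ∀ z ∈ Metric.ball z₀ r, DifferentiableAt ℝ f z := fun z hz ↦
      hC.differentiableAt (hball hz)
    have h₁ : (φ ∘ chartInv p - f : Model (m + 1) → Aff (m + 2)) z
        = (φ ∘ chartInv p - f : Model (m + 1) → Aff (m + 2)) z₀ := by
      refine Metric.isOpen_ball.is_const_of_fderiv_eq_zero (𝕜 := ℝ)
        (convex_ball z₀ r).isPreconnected
        (fun z hz ↦ ((hd₁ z hz).sub (hd₂ z hz)).differentiableWithinAt) (fun z hz ↦ ?_) hz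
        (Metric.mem_ball_self hr)
      rw [fderiv_sub (hd₁ z hz) (hd₂ z hz), fderiv_chartPos hφ hlam.ne p (hball hz), sub_self]
      rfl
    exact sub_eq_iff_eq_add.1 h₁
  refine ⟨-ε, ε, Q, fun q ↦ ψ q, c₁, c₂,
    A.toAffineEquiv.trans (AffineEquiv.constVAdd ℝ (Aff (m + 2)) w), Φ,
    hψ.isAffineHypersphere hψvol, hc₁, hc₂, hdet, hΦs, hΦp, fun t ht q ↦ ?_⟩
  have hmem : (t, (q : Model m)) ∈ e.target := by
    rw [het]
    exact ⟨ht, q.2⟩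
  rw [hΦ, hw _ (heB (e.map_target hmem)), hf _ hmem]
  rfl
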